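/- **Setting.** For every value $\lambda\in\mathbb N$ of the security parameter there are $N=N(\lambda)$ users $1,\dots,N$, where $N$ is bounded by a polynomial in $\lambda$; a nonempty set $\mathcal S=\mathcal S(\lambda)\subseteq[N]$ of $n=n(\lambda)$ users that also act as servers; a number $L=L(\lambda)$ of hops; and a message space $\mathcal M=\mathcal M(\lambda)$. An input has the form $\sigma=(\{(m_1,\pi(1))\},\dots,\{(m_N,\pi(N))\})$ with $m_i\in\mathcal M$ and $\pi$ a permutation of $[N]$ (simple I/O setting): user $i$ wants to send $m_i$ to user $\pi(i)$. **Protocol $\Pi_p$.** Every user $i$ picks servers $T_1,\dots,T_L$ independently and uniformly at random from $\mathcal S$ and forms an onion for the message $m_i$ and the routing path $(T_1,\dots,T_L,\pi(i))$. In round $1$ user $i$ sends its onion to $T_1$. After each round $r\in\{1,\dots,L\}$ every server peels the onions it received in round $r$, and in round $r+1$ it sends the peeled onions, in random order, to their next destinations. After round $L+1$ every user opens the onion it received and obtains a message. Encryption is idealized: the ciphertexts of the onion layers reveal nothing about contents, destinations, or which layers belong to the same onion. Concretely, in each round the $N$ onions under way carry distinct opaque labels from $[N]$, assigned by a uniformly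 random permutation that is independent of everything else and of the other rounds. **Adversary.** A passive adversary chooses a set $C\subseteq[N]$ of monitored parties, possibly at random but independently of the execution. Its view $V^{\Pi_p,\mathcal A}(\sigma)$ consists of its own randomness, the number of onions on every link in every round, and the internal states and operations of all parties in $C$: such a party's input, its chosen routing path and all layers of the onion it formed; for every onion it receives as a server, the label of that onion, the sender, the next destination and the label of the peeled onion; and for every onion it receives as a recipient, the label, the delivering party and the message. The adversary *monitors at most a fraction $\kappa$* if always $|C\cap\mathcal S|\le\kappa n$ and $|C|\le\kappa N$ (in particular, it may monitor any set of at most $\kappa n$ servers and nobody else). **Theorem.** Let $\kappa\in[0,1)$ be a constant, and suppose that $N/n=\Omega(\log^2\lambda)$ and $L=\Omega(\log^2\lambda)$. Then $\Pi_p$ is statistically private from the passive adversaries that monitor at most a fraction $\kappa$. That is, for every family $(\mathcal A_\lambda)$ of such adversaries and all families $(\sigma_{0,\lambda}),(\sigma_{1,\lambda})$ of inputs such that, for every possible choice of $C$, every party in $C$ has the same input and receives the same message in $\sigma_{0,\lambda}$ and in $\sigma_{1,\lambda}$, the total variation distance between $V^{\Pi_p,\mathcal A_\lambda}(\sigma_{0,\lambda})$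 and $V^{\Pi_p,\mathcal A_\lambda}(\sigma_{1,\lambda})$ is negligible in $\lambda$, i.e. it is smaller than $1/p(\lambda)$ for all sufficiently large $\lambda$, for every polynomial $p$ that is positive for all large $\lambda$. -/

import Mathlib

open Filter Asymptotics

noncomputable section

/-- A function of the security parameter is negligible if it is eventually smaller than the
reciprocal of every polynomial (with eventually positive values). -/
def Negligible (f : ℕ → ℝ) : Prop :=
  ∀ p : Polynomial ℝ, (∀ᶠ k : ℕ in atTop, 0 < p.eval (k : ℝ)) →
    ∀ᶠ k : ℕ in atTop, f k < 1 / p.eval (k : ℝ)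

/-- Statistical (total variation) distance of two discrete distributions. -/
def statDist {α : Type*} (p q : PMF α) : ℝ :=
  (1 / 2) * ∑' a, |(p a).toReal - (q a).toReal|

namespace OnionRouting

universe u

/-- The public parameters of one instance of the protocol: `N` users (the parties), a nonempty
set of users that also act as servers, and the number `L` of server hops of every onion. -/
structure Config where
  N : ℕ
  servers : Finset (Fin N)
  servers_nonempty : servers.Nonempty
  L : ℕ

/-- An input vector in the simple I/O setting: user `i` has the single message pair
`(msg i, dest i)`, where `dest` is a permutation of the users. -/
structure SimpleInput (M : Type u) (N : ℕ) where
  msg : Fin N → M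
  dest : Equiv.Perm (Fin N)

/-- The input of user `i`. -/
def SimpleInput.input {M : Type u} {N : ℕ} (σ : SimpleInput M N) (i : Fin N) : M × Fin N :=
  (σ.msg i, σ.dest i)

/-- The output of user `j`: the message addressed to `j`. -/
def SimpleInput.output {M : Type u} {N : ℕ} (σ : SimpleInput M N) (j : Fin N) : M :=
  σ.msg (σ.dest.symm j)

/-- The two inputs differ at most in the inputs and outputs of parties outside `C`. -/
def SimpleInput.AgreeOn {M : Type u} {N : ℕ} (C : Finset (Fin N)) (σ₀ σ₁ : SimpleInput M N) :
    Prop :=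
  ∀ c ∈ C, σ₀.input c = σ₁.input c ∧ σ₀.output c = σ₁.output c

/-- The randomness of one execution.

* The first component gives the routing paths: `ω.1 i k` is the server that user `i` picks as
  hop number `k + 1` of its onion.
* The second component is the ideal encryption. An onion layer is an opaque ciphertext that is
  independent of its content, its destination and the other layers of the same onion. In each of
  the `L + 1` rounds there are `N` onions under way, one of each user, and `ω.2 r i` is the
  ciphertext (a handle) that the onion formed by user `i` has in round `r`. Within a round the
  handles are distinct and randomly arranged, so they also serve as the random order in which
  onions are sent. -/
abbrev Coins (P : Config) : Type :=
  (Fin P.N → Fin P.L → P.servers) × (Fin (P.L + 1) → Equiv.Perm (Fin P.N))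

instance (P : Config) : Nonempty P.servers := P.servers_nonempty.to_subtype

/-- Where the onion formed by user `i` is: at `i` itself before round `0`, at the `k`-th server of
its path after `k ≤ L` rounds, and at the recipient after `L + 1` rounds. -/
def hop {M : Type u} (P : Config) (σ : SimpleInput M P.N) (ω : Coins P) (i : Fin P.N) :
    ℕ → Fin P.N
  | 0 => i
  | k + 1 => if h : k < P.L then (ω.1 i ⟨k, h⟩ : Fin P.N) else σ.dest i

/-- Traffic volume: the number of onions sent in round `r` on the link from `a` to `b`. -/
def traffic {M : Type u} (P : Config) (σ : SimpleInput M P.N) (ω : Coins P)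
    (r : Fin (P.L + 1)) (a b : Fin P.N) : ℕ :=
  (Finset.univ.filter fun i : Fin P.N => hop P σ ω i r = a ∧ hop P σ ω i (r + 1) = b).card

/-- The internal state and the operations of one party over the whole execution. -/
structure LocalState (M : Type u) (P : Config) where
  /-- the party's own input -/
  input : M × Fin P.N
  /-- the routing path that it chose for its own onion -/
  path : Fin P.L → Fin P.N
  /-- all layers of the onion that it formed -/
  formed : Fin (P.L + 1) → Fin P.N
  /-- For each onion that it receives as a server (given by round and ciphertext): the party that
  sent it, and the result of peeling it: the next destination and the peeled onion. -/
  peeled : Fin P.L → Fin P.N → Option (Fin P.N × Fin P.N × Fin P.N)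
  /-- For each onion that it receives in the last round, as a recipient: the server that
  delivered it and the message inside. -/
  received : Fin P.N → Option (Fin P.N × M)

/-- The internal state and the operations of party `c` in the execution with randomness `ω`. -/
def localState {M : Type u} (P : Config) (σ : SimpleInput M P.N) (ω : Coins P) (c : Fin P.N) :
    LocalState M P where
  input := σ.input c
  path k := ω.1 c k
  formed r := ω.2 r c
  peeled r h :=
    let i := (ω.2 r.castSucc).symm h
    if hop P σ ω i (r + 1) = c then
      some (hop P σ ω i r, hop P σ ω i (r + 2), ω.2 r.succ i)
    else none
  received h :=
    let i := (ω.2 (Fin.last P.L)).symm h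
    if hop P σ ω i (P.L + 1) = c then some (hop P σ ω i P.L, σ.msg i) else none

/-- What a passive adversary sees: the traffic volumes on all links in all rounds, and the
internal states and operations of the monitored parties. -/
structure Observables (M : Type u) (P : Config) where
  traffic : Fin (P.L + 1) → Fin P.N → Fin P.N → ℕ
  states : Fin P.N → Option (LocalState M P)

/-- The observables when the set `C` of parties is monitored. -/
def observe {M : Type u} (P : Config) (C : Finset (Fin P.N)) (σ : SimpleInput M P.N)
    (ω : Coins P) : Observables M P where
  traffic := traffic P σ ω
  states c := if c ∈ C then some (localState P σ ω c) else none

/-- A passive adversary: it chooses, non-adaptively and with the help of random coins, which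
parties to monitor. -/
structure Adversary (P : Config) where
  Rand : Type
  law : PMF Rand
  monitored : Rand → Finset (Fin P.N)

/-- The distribution of the view of the adversary: its own random coins and its observables in a
random execution of the protocol on input `σ`. -/
def view {M : Type u} (P : Config) (A : Adversary P) (σ : SimpleInput M P.N) :
    PMF (A.Rand × Observables M P) :=
  A.law.bind fun ρ =>
    (PMF.uniformOfFintype (Coins P)).map fun ω => (ρ, observe P (A.monitored ρ) σ ω)

/-- The passive adversaries that monitor at most a fraction `κ` of the servers. Parties that are
not servers may be monitored as well, as long as at most a fraction `κ` of all parties is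
monitored; this is no restriction if only servers are monitored. -/
def passiveAdversaries (κ : ℝ) (P : Config) : Set (Adversary P) :=
  {A | ∀ ρ ∈ A.law.support,
    ((A.monitored ρ ∩ P.servers).card : ℝ) ≤ κ * (P.servers.card : ℝ) ∧
    ((A.monitored ρ).card : ℝ) ≤ κ * (P.N : ℝ)}

/-- Statistical privacy of the protocol, run with parameters `P k` and message space `M k` for the
security parameter `k`, from the adversaries in the class `𝔸`. -/
def StatisticallyPrivate (P : ℕ → Config) (M : ℕ → Type u) (𝔸 : ∀ P : Config, Set (Adversary P)) :
    Prop :=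
  ∀ A : ∀ k, Adversary (P k), (∀ k, A k ∈ 𝔸 (P k)) →
    ∀ σ₀ σ₁ : ∀ k, SimpleInput (M k) (P k).N,
      (∀ k, ∀ ρ ∈ (A k).law.support,
        SimpleInput.AgreeOn ((A k).monitored ρ) (σ₀ k) (σ₁ k)) →
      Negligible fun k => statDist (view (P k) (A k) (σ₀ k)) (view (P k) (A k) (σ₁ k))

end OnionRouting

end

/-! An unmonitored server hides which incoming onion leaves as which outgoing one. If unmonitored
users meet at an unmonitored server in some hop, permuting the remaining parts of their onions among
them, together with their inputs, leaves the observables unchanged (`observe_shift`). Two inputs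
that agree on the monitored parties differ, up to messages that nobody monitored sees, by a
permutation `τ` of the `h` unmonitored users (`exists_perm_observe`). Hence the difference of the
two view distributions is unaffected when the signed measure `δ₁ - δ_τ` on the symmetric group is
averaged, hop by hop, over the permutations that preserve the server choices of that hop and fix the
users at monitored servers (`sum_walk_mul`). The total variation distance is therefore at most half
the mean `ℓ¹` norm of this random walk (`sum_abs_observe_sub_le`).

The walk is estimated in mean square. The regular representation is split by depth `k = h - a` into
layers, which all averages preserve; in terms of representation theory, depth `k` collects the
partitions whose first row has length `h - k`. The layers of depth at most `k` have total dimension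
at most `h ^ (2k)` (`finrank_freeOn_orthogonal_le`), so by translation invariance a point mass has
squared norm at most `h ^ (2k) / h!` there. With `p = 1 - κ`, one hop contracts depth `k` in mean
square by `exp (-(p / 4096) k)` (`sum_norm_avg_le`). After `L` hops depth `k` contributes a multiple
of `x ^ k` with `x = h² exp (-(p / 4096) L)`, and the geometric series is of order `x`, which is
negligible.

For the contraction, a typical hop brings linearly many disjoint pairs of users together at
unmonitored servers, and averaging over the block group contracts at least as much as averaging over
the transpositions of these pairs. For large depth the pairs are used one after the other, each with
the spectral gap of the random transposition operator on vectors of that depth (`le_inner_energy`,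
`sum_norm_matchAvg_le`). For small depth the problem is reduced to a vector invariant under `Sym(A)`
with `#A = a`. There every pair with exactly one element in `A` gives a factor `3/4`
(`inner_matchAvg_le`), and a generating function controls the number of such pairs under a random
relabelling (`coeff_crossPoly_le`). -/

open Finset
open scoped InnerProductSpace
set_option linter.unusedSectionVars false

namespace OnionMixing

/-! ### Group averages as orthogonal projections. -/

section Average

variable {G : Type*} [Group G] [Fintype G]
variable {E : Type*} [NormedAddCommGroup E] [InnerProductSpace ℝ E]
variable (ρ : Representation ℝ G E)

open Classical in
/-- The average of a representation over a subgroup: the projection onto the invariant vectors. -/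
noncomputable def avg (H : Subgroup G) : Module.End ℝ E :=
  (Nat.card H : ℝ)⁻¹ • ∑ g with g ∈ H, ρ g

open Classical in
theorem avg_apply (H : Subgroup G) (x : E) :
    avg ρ H x = (Nat.card H : ℝ)⁻¹ • ∑ g with g ∈ H, ρ g x := by
  simp [avg, LinearMap.sum_apply]

open Classical in
theorem card_filter_mem (H : Subgroup G) : #{g | g ∈ H} = Nat.card H := by
  rw [Nat.card_eq_fintype_card, Fintype.card_subtype]

theorem natCard_ne_zero (H : Subgroup G) : (Nat.card H : ℝ) ≠ 0 :=
  Nat.cast_ne_zero.mpr Nat.card_pos.ne'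

variable {ρ}

theorem avg_of_fixed {H : Subgroup G} {x : E} (hx : ∀ g ∈ H, ρ g x = x) : avg ρ H x = x := by
  classical
  rw [avg_apply, Finset.sum_congr rfl (g := fun _ => x) (by simpa using hx), Finset.sum_const,
    card_filter_mem, ← Nat.cast_smul_eq_nsmul ℝ, smul_smul, inv_mul_cancel₀ (natCard_ne_zero H),
    one_smul]

theorem rho_avg {H : Subgroup G} {h : G} (hh : h ∈ H) (x : E) : ρ h (avg ρ H x) = avg ρ H x := by
  classical
  rw [avg_apply, map_smul, map_sum]
  congr 1
  refine Finset.sum_bij' (fun g _ => h * g) (fun g _ => h⁻¹ * g) ?_ ?_ ?_ ?_ ?_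
  · intro g hg; simpa using H.mul_mem hh (by simpa using hg)
  · intro g hg; simpa using H.mul_mem (H.inv_mem hh) (by simpa using hg)
  · simp
  · simp
  · simp

theorem avg_rho {H : Subgroup G} {h : G} (hh : h ∈ H) (x : E) : avg ρ H (ρ h x) = avg ρ H x := by
  classical
  rw [avg_apply, avg_apply]
  congr 1
  refine Finset.sum_bij' (fun g _ => g * h) (fun g _ => g * h⁻¹) ?_ ?_ ?_ ?_ ?_
  · intro g hg; simpa using H.mul_mem (by simpa using hg) hh
  · intro g hg; simpa using H.mul_mem (by simpa using hg) (H.inv_mem hh)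
  · simp
  · simp
  · simp

theorem avg_avg_of_le {H K : Subgroup G} (hHK : H ≤ K) (x : E) :
    avg ρ K (avg ρ H x) = avg ρ K x := by
  classical
  rw [avg_apply ρ H, map_smul, map_sum,
    Finset.sum_congr rfl (g := fun _ => avg ρ K x)
      (fun g hg => avg_rho (hHK (by simpa using hg)) x), Finset.sum_const,
    card_filter_mem, ← Nat.cast_smul_eq_nsmul ℝ, smul_smul, inv_mul_cancel₀ (natCard_ne_zero H),
    one_smul]

theorem rho_avg_conj {H K : Subgroup G} {g : G} (hK : ∀ y, y ∈ K ↔ g⁻¹ * y * g ∈ H) (x : E) :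
    ρ g (avg ρ H x) = avg ρ K (ρ g x) := by
  classical
  have hcard : Nat.card H = Nat.card K := by
    rw [← card_filter_mem, ← card_filter_mem]
    refine Finset.card_bij' (fun y _ => g * y * g⁻¹) (fun y _ => g⁻¹ * y * g) ?_ ?_ ?_ ?_
    · intro y hy
      have hy' : y ∈ H := by simpa using hy
      simp [hK, mul_assoc, hy']
    · intro y hy
      have hy' : y ∈ K := by simpa using hy
      simpa using (hK y).1 hy'
    · intro y _; simp [mul_assoc]
    · intro y _; simp [mul_assoc]
  rw [avg_apply, avg_apply, map_smul, map_sum, hcard]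
  congr 1
  refine Finset.sum_bij' (fun y _ => g * y * g⁻¹) (fun y _ => g⁻¹ * y * g) ?_ ?_ ?_ ?_ ?_
  · intro y hy
    have hy' : y ∈ H := by simpa using hy
    simp [hK, mul_assoc, hy']
  · intro y hy
    have hy' : y ∈ K := by simpa using hy
    simpa using (hK y).1 hy'
  · intro y _; simp [mul_assoc]
  · intro y _; simp [mul_assoc]
  · intro y _; simp

/-- This turns an eigenvector of an equivariant operator into an `H`-invariant one with the same
eigenvalue, provided that the average is nonzero. -/
theorem map_avg {H : Subgroup G} (T : Module.End ℝ E) (hT : ∀ g ∈ H, ∀ x, T (ρ g x) = ρ g (T x))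
    (x : E) : T (avg ρ H x) = avg ρ H (T x) := by
  classical
  rw [avg_apply, avg_apply, map_smul, map_sum]
  congr 1
  exact Finset.sum_congr rfl fun g hg => hT g (by simpa using hg) x

variable (ρ) in
/-- The representation acts by isometries. -/
def Orthogonal : Prop := ∀ g x, ‖ρ g x‖ = ‖x‖

theorem Orthogonal.inner_rho (hρ : Orthogonal ρ) (g : G) (x y : E) :
    ⟪ρ g x, ρ g y⟫_ℝ = ⟪x, y⟫_ℝ := by
  have := (⟨ρ g, hρ g⟩ : E →ₗᵢ[ℝ] E).inner_map_map x y
  simpa using this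

theorem Orthogonal.inner_rho_left (hρ : Orthogonal ρ) (g : G) (x y : E) :
    ⟪ρ g x, y⟫_ℝ = ⟪x, ρ g⁻¹ y⟫_ℝ := by
  rw [← hρ.inner_rho g x (ρ g⁻¹ y)]; simp

theorem Orthogonal.inner_avg (hρ : Orthogonal ρ) (H : Subgroup G) (x y : E) :
    ⟪avg ρ H x, y⟫_ℝ = ⟪x, avg ρ H y⟫_ℝ := by
  classical
  rw [avg_apply, avg_apply, inner_smul_left, inner_smul_right, sum_inner, inner_sum]
  simp only [RCLike.conj_to_real]
  congr 1
  refine Finset.sum_bij' (fun g _ => g⁻¹) (fun g _ => g⁻¹) ?_ ?_ ?_ ?_ ?_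
  · simp
  · simp
  · simp
  · simp
  · intro g _; exact hρ.inner_rho_left g x y

theorem avg_idem (H : Subgroup G) (x : E) : avg ρ H (avg ρ H x) = avg ρ H x :=
  avg_avg_of_le le_rfl x

theorem Orthogonal.inner_avg_self (hρ : Orthogonal ρ) (H : Subgroup G) (x : E) :
    ⟪avg ρ H x, x⟫_ℝ = ‖avg ρ H x‖ ^ 2 := by
  rw [← real_inner_self_eq_norm_sq, hρ.inner_avg H x (avg ρ H x), avg_idem, hρ.inner_avg]

theorem Orthogonal.norm_avg_le (hρ : Orthogonal ρ) (H : Subgroup G) (x : E) :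
    ‖avg ρ H x‖ ≤ ‖x‖ := by
  have h := hρ.inner_avg_self H x
  have h2 := real_inner_le_norm (avg ρ H x) x
  by_contra! hc
  nlinarith [norm_nonneg x, norm_nonneg (avg ρ H x)]

/-- The projection onto the vectors fixed by an involution. -/
noncomputable def half (ρ : Representation ℝ G E) (t : G) : Module.End ℝ E :=
  (2 : ℝ)⁻¹ • (1 + ρ t)

theorem half_apply (t : G) (x : E) : half ρ t x = (2 : ℝ)⁻¹ • (x + ρ t x) := by
  simp [half]

theorem avg_half {H : Subgroup G} {t : G} (ht : t ∈ H) (x : E) :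
    avg ρ H (half ρ t x) = avg ρ H x := by
  rw [half_apply, map_smul, map_add, avg_rho ht, ← two_smul ℝ, smul_smul]; norm_num

theorem Orthogonal.inner_half (hρ : Orthogonal ρ) {t : G} (ht : t * t = 1) (x y : E) :
    ⟪half ρ t x, y⟫_ℝ = ⟪x, half ρ t y⟫_ℝ := by
  have : t⁻¹ = t := inv_eq_of_mul_eq_one_left ht
  rw [half_apply, half_apply, inner_smul_left, inner_smul_right, inner_add_left, inner_add_right,
    hρ.inner_rho_left, this]
  simp

theorem half_idem {t : G} (ht : t * t = 1) (x : E) : half ρ t (half ρ t x) = half ρ t x := by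
  have : ρ t (ρ t x) = x := by rw [← Module.End.mul_apply, ← map_mul, ht]; simp
  simp only [half_apply, map_smul, map_add, this]
  module

theorem Orthogonal.norm_half_sq (hρ : Orthogonal ρ) {t : G} (ht : t * t = 1) (x : E) :
    ‖half ρ t x‖ ^ 2 = ⟪half ρ t x, x⟫_ℝ := by
  rw [← real_inner_self_eq_norm_sq, hρ.inner_half ht x (half ρ t x), half_idem ht,
    hρ.inner_half ht]

theorem Orthogonal.norm_half_le (hρ : Orthogonal ρ) (t : G) (x : E) :
    ‖half ρ t x‖ ≤ ‖x‖ := by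
  rw [half_apply, norm_smul]
  have := norm_add_le x (ρ t x)
  rw [hρ] at this
  norm_num
  linarith

end Average

/-! ### Rayleigh quotients on invariant subspaces. -/

section Eigen

variable {E : Type*} [NormedAddCommGroup E] [InnerProductSpace ℝ E] [FiniteDimensional ℝ E]

/-- A symmetric operator is bounded by the largest of its eigenvalues, also on an invariant
subspace. -/
theorem inner_le_of_eigen {T : Module.End ℝ E} (hT : T.IsSymmetric) (W : Submodule ℝ E)
    (hW : ∀ x ∈ W, T x ∈ W) {q : ℝ}
    (hq : ∀ c : ℝ, ∀ x ∈ W, x ≠ 0 → T x = c • x → c ≤ q) {x : E} (hx : x ∈ W) :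
    ⟪T x, x⟫_ℝ ≤ q * ‖x‖ ^ 2 := by
  have hS : (T.restrict hW).IsSymmetric := hT.restrict_invariant hW
  set b := hS.eigenvectorBasis rfl
  set ev := hS.eigenvalues rfl
  have hev : ∀ i, ev i ≤ q := by
    intro i
    have h1 := hS.apply_eigenvectorBasis rfl i
    refine hq (ev i) (b i) (b i).2 ?_ ?_
    · intro h0
      have := b.orthonormal.ne_zero i
      exact this (Subtype.ext h0)
    · exact congrArg Subtype.val h1
  have key : ⟪T x, x⟫_ℝ = ∑ i, ev i * ⟪b i, (⟨x, hx⟩ : W)⟫_ℝ ^ 2 := by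
    have h2 : ⟪T x, x⟫_ℝ = ⟪(T.restrict hW) ⟨x, hx⟩, (⟨x, hx⟩ : W)⟫_ℝ := rfl
    rw [h2, ← b.sum_inner_mul_inner]
    refine Finset.sum_congr rfl fun i _ => ?_
    rw [hS, hS.apply_eigenvectorBasis rfl i]
    rw [inner_smul_right, real_inner_comm]
    simp only [RCLike.ofReal_real_eq_id, id]
    rw [sq]; ring
  have hn : ‖x‖ ^ 2 = ∑ i, ⟪b i, (⟨x, hx⟩ : W)⟫_ℝ ^ 2 := by
    have := b.sum_sq_norm_inner_right (⟨x, hx⟩ : W)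
    simp only [Real.norm_eq_abs, sq_abs] at this
    rw [this]; rfl
  rw [key, hn, Finset.mul_sum]
  exact Finset.sum_le_sum fun i _ => mul_le_mul_of_nonneg_right (hev i) (sq_nonneg _)

theorem le_inner_of_eigen {T : Module.End ℝ E} (hT : T.IsSymmetric) (W : Submodule ℝ E)
    (hW : ∀ x ∈ W, T x ∈ W) {q : ℝ}
    (hq : ∀ c : ℝ, ∀ x ∈ W, x ≠ 0 → T x = c • x → q ≤ c) {x : E} (hx : x ∈ W) :
    q * ‖x‖ ^ 2 ≤ ⟪T x, x⟫_ℝ := by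
  have hneg : (-T).IsSymmetric := by
    intro u v; simp [hT u v]
  have := inner_le_of_eigen (T := -T) hneg W (fun y hy => W.neg_mem (hW y hy)) (q := -q)
    (fun c y hy hy0 hc => by
      have := hq (-c) y hy hy0 (by rw [neg_smul, ← hc]; simp)
      linarith) hx
  simp at this
  linarith

end Eigen

end OnionMixing

namespace OnionMixing

/-! ### Depth in representations of the symmetric group, and the Dirichlet form of transpositions.
-/

section Symmetric

open Equiv (Perm swap)

variable {ι : Type*} [Fintype ι] [DecidableEq ι]
variable {E : Type*} [NormedAddCommGroup E] [InnerProductSpace ℝ E]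
variable {ρ : Representation ℝ (Perm ι) E}

/-- The permutations that move only elements of `A`. -/
def symOn (A : Finset ι) : Subgroup (Perm ι) where
  carrier := {g | ∀ i ∉ A, g i = i}
  one_mem' := by simp
  mul_mem' := by
    intro g h hg hh i hi
    simp [hh i hi, hg i hi]
  inv_mem' := by
    intro g hg i hi
    rw [Equiv.Perm.inv_eq_iff_eq]; exact (hg i hi).symm

theorem mem_symOn {A : Finset ι} {g : Perm ι} : g ∈ symOn A ↔ ∀ i ∉ A, g i = i := Iff.rfl

theorem symOn_mono {A B : Finset ι} (h : A ⊆ B) : symOn A ≤ symOn B :=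
  fun _ hg i hi => hg i fun hA => hi (h hA)

theorem swap_mem_symOn {A : Finset ι} {a b : ι} (ha : a ∈ A) (hb : b ∈ A) :
    swap a b ∈ symOn A := fun i hi =>
  Equiv.swap_apply_of_ne_of_ne (by rintro rfl; exact hi ha) (by rintro rfl; exact hi hb)

theorem apply_mem_of_mem_symOn {A : Finset ι} {g : Perm ι} (hg : g ∈ symOn A) {i : ι} :
    g i ∈ A ↔ i ∈ A := by
  constructor
  · intro h
    by_contra hi
    rw [hg i hi] at h; exact hi h
  · intro h
    by_contra hi
    have := hg _ hi
    rw [g.injective this] at hi; exact hi h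

theorem rho_swap_self (x : ι) (f : E) : ρ (swap x x) f = f := by
  rw [Equiv.swap_self]
  exact congrArg (fun T : Module.End ℝ E => T f) (map_one ρ)

theorem mem_symOn_map {A : Finset ι} {g y : Perm ι} :
    y ∈ symOn (A.map g.toEmbedding) ↔ g⁻¹ * y * g ∈ symOn A := by
  simp only [mem_symOn]
  constructor
  · intro h i hi
    simp [h (g i) (by simpa using hi)]
  · intro h i hi
    have := h (g⁻¹ i) (by simpa using hi)
    simpa [Equiv.Perm.inv_eq_iff_eq] using this

theorem rho_avg_symOn (g : Perm ι) (A : Finset ι) (x : E) :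
    ρ g (avg ρ (symOn A) x) = avg ρ (symOn (A.map g.toEmbedding)) (ρ g x) :=
  rho_avg_conj (fun _ => mem_symOn_map) x

theorem symOn_eq_bot {A : Finset ι} (hA : #A ≤ 1) {g : Perm ι} (hg : g ∈ symOn A) : g = 1 := by
  ext i
  by_cases hi : i ∈ A
  · exact Finset.card_le_one.1 hA _ ((apply_mem_of_mem_symOn hg).2 hi) _ hi
  · exact hg i hi

theorem avg_symOn_of_card_le_one {A : Finset ι} (hA : #A ≤ 1) (x : E) :
    avg ρ (symOn A) x = x :=
  avg_of_fixed fun g hg => by simp [symOn_eq_bot hA hg]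

variable (ρ) in
/-- The vectors without invariant component under any symmetric group on `a` letters of `R`. -/
noncomputable def freeOn (R : Finset ι) (a : ℕ) : Submodule ℝ E where
  carrier := {f | ∀ A ⊆ R, #A = a → avg ρ (symOn A) f = 0}
  add_mem' := by
    intro f g hf hg A hA ha
    simp [hf A hA ha, hg A hA ha]
  zero_mem' := by simp
  smul_mem' := by
    intro c f hf A hA ha
    simp [hf A hA ha]

theorem mem_freeOn {R : Finset ι} {a : ℕ} {f : E} :
    f ∈ freeOn ρ R a ↔ ∀ A ⊆ R, #A = a → avg ρ (symOn A) f = 0 := Iff.rfl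

theorem freeOn_anti {R R' : Finset ι} (h : R' ⊆ R) {a : ℕ} {f : E} (hf : f ∈ freeOn ρ R a) :
    f ∈ freeOn ρ R' a := fun A hA ha => hf A (hA.trans h) ha

theorem rho_mem_freeOn {R : Finset ι} {a : ℕ} {f : E} (hf : f ∈ freeOn ρ R a) {g : Perm ι}
    (hg : g ∈ symOn R) : ρ g f ∈ freeOn ρ R a := by
  intro A hA ha
  have h1 := rho_avg_symOn (ρ := ρ) g (A.map g.symm.toEmbedding) f
  have h2 : (A.map g.symm.toEmbedding).map g.toEmbedding = A := by
    ext i; simp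
  rw [h2] at h1
  rw [← h1, hf _ _ (by simpa using ha), map_zero]
  intro i hi
  have : g i ∈ A := by simpa using hi
  exact (apply_mem_of_mem_symOn hg).1 (hA this)

theorem avg_mem_freeOn {R : Finset ι} {a : ℕ} {f : E} (hf : f ∈ freeOn ρ R a) {H : Subgroup (Perm ι)}
    (hH : H ≤ symOn R) : avg ρ H f ∈ freeOn ρ R a := by
  classical
  rw [avg_apply]
  exact Submodule.smul_mem _ _ (Submodule.sum_mem _ fun g hg =>
    rho_mem_freeOn hf (hH (by simpa using hg)))

/-- The action of the star transpositions at `x` on a vector that is invariant on `A` and has no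
invariant component on `insert x A`. -/
theorem sum_swap_eq_neg {A : Finset ι} {x : ι} (hx : x ∉ A) {f : E}
    (hf : ∀ g ∈ symOn A, ρ g f = f) (h0 : avg ρ (symOn (insert x A)) f = 0) :
    ∑ b ∈ A, ρ (swap x b) f = -f := by
  have hsum : ∑ b ∈ insert x A, ρ (swap x b) f = f + ∑ b ∈ A, ρ (swap x b) f := by
    rw [Finset.sum_insert hx, rho_swap_self]
  -- The transpositions `swap x b` represent the cosets of `Sym(A)` in `Sym(insert x A)`, so the sum
  -- is invariant under the larger group. It thus equals its own average, which vanishes because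
  -- each term has the same average as `f`.
  have hinv : ∀ h ∈ symOn (insert x A),
      ρ h (∑ b ∈ insert x A, ρ (swap x b) f) = ∑ b ∈ insert x A, ρ (swap x b) f := by
    intro h hh
    rw [map_sum]
    refine Finset.sum_bij' (fun b _ => h b) (fun b _ => h⁻¹ b) ?_ ?_ ?_ ?_ ?_
    · intro b hb; exact (apply_mem_of_mem_symOn hh).2 hb
    · intro b hb; exact (apply_mem_of_mem_symOn (Subgroup.inv_mem _ hh)).2 hb
    · simp
    · simp
    · intro b hb
      have hmem : swap x (h b) * h * swap x b ∈ symOn A := by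
        have hbig : swap x (h b) * h * swap x b ∈ symOn (insert x A) :=
          Subgroup.mul_mem _ (Subgroup.mul_mem _ (swap_mem_symOn (by simp)
            ((apply_mem_of_mem_symOn hh).2 hb)) hh) (swap_mem_symOn (by simp) hb)
        intro i hi
        by_cases hix : i = x
        · subst hix; simp
        · exact hbig i (by simp [hi, hix])
      have := hf _ hmem
      calc ρ h (ρ (swap x b) f)
          = ρ (swap x (h b)) (ρ (swap x (h b) * h * swap x b) f) := by
            simp only [← Module.End.mul_apply, ← map_mul]
            simp [← mul_assoc]
        _ = _ := by rw [this]
  have h1 := avg_of_fixed hinv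
  rw [map_sum, Finset.sum_congr rfl (g := fun _ => (0 : E)), Finset.sum_const_zero, hsum] at h1
  · exact (neg_eq_of_add_eq_zero_right h1.symm).symm
  · intro b hb
    rw [avg_rho (swap_mem_symOn (by simp) hb), h0]

/-- The Dirichlet form of the transpositions of `R`, on ordered pairs. -/
noncomputable def energy (ρ : Representation ℝ (Perm ι) E) (R : Finset ι) : Module.End ℝ E :=
  ∑ x ∈ R, ∑ y ∈ R, (1 - ρ (swap x y))

theorem energy_apply (R : Finset ι) (f : E) :
    energy ρ R f = ∑ x ∈ R, ∑ y ∈ R, (f - ρ (swap x y) f) := by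
  simp [energy, LinearMap.sum_apply]

theorem inner_energy (R : Finset ι) (f : E) :
    ⟪energy ρ R f, f⟫_ℝ = ∑ x ∈ R, ∑ y ∈ R, ⟪f - ρ (swap x y) f, f⟫_ℝ := by
  simp only [energy_apply, sum_inner]

theorem Orthogonal.inner_sub_rho_nonneg (hρ : Orthogonal ρ) (g : Perm ι) (f : E) :
    0 ≤ ⟪f - ρ g f, f⟫_ℝ := by
  rw [inner_sub_left, real_inner_self_eq_norm_sq]
  have := real_inner_le_norm (ρ g f) f
  rw [hρ] at this
  nlinarith

theorem energy_symmetric (hρ : Orthogonal ρ) (R : Finset ι) : (energy ρ R).IsSymmetric := by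
  intro u v
  simp only [energy_apply, sum_inner, inner_sum]
  refine Finset.sum_congr rfl fun x _ => Finset.sum_congr rfl fun y _ => ?_
  rw [inner_sub_left, inner_sub_right, hρ.inner_rho_left]
  simp

theorem energy_rho {R : Finset ι} {g : Perm ι} (hg : g ∈ symOn R) (f : E) :
    energy ρ R (ρ g f) = ρ g (energy ρ R f) := by
  simp only [energy_apply, map_sum, map_sub]
  symm
  refine Finset.sum_equiv g (fun i => (apply_mem_of_mem_symOn hg).symm) fun x _ => ?_
  refine Finset.sum_equiv g (fun i => (apply_mem_of_mem_symOn hg).symm) fun y _ => ?_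
  rw [← Module.End.mul_apply, ← Module.End.mul_apply, ← map_mul, ← map_mul,
    Equiv.mul_swap_eq_swap_mul]

theorem energy_mem_freeOn {R : Finset ι} {a : ℕ} {f : E} (hf : f ∈ freeOn ρ R a) :
    energy ρ R f ∈ freeOn ρ R a := by
  rw [energy_apply]
  exact Submodule.sum_mem _ fun x hx => Submodule.sum_mem _ fun y hy =>
    Submodule.sub_mem _ hf (rho_mem_freeOn hf (swap_mem_symOn hx hy))

/-- Every term of the energy is nonnegative, so only the pairs with exactly one element in `A` are
kept. For each `x` outside `A`, `sum_swap_eq_neg` evaluates the star at `x` exactly; the factor 2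
comes from the two orders of a pair. -/
theorem energy_of_invariant (hρ : Orthogonal ρ) {R A : Finset ι} (hA : A ⊆ R) {f : E}
    (hf : ∀ g ∈ symOn A, ρ g f = f) (h0 : f ∈ freeOn ρ R (#A + 1)) :
    2 * ((#R : ℝ) - #A) * (#A + 1) * ‖f‖ ^ 2 ≤ ⟪energy ρ R f, f⟫_ℝ := by
  have hstar : ∀ x ∈ R \ A, ∑ y ∈ A, ⟪f - ρ (swap x y) f, f⟫_ℝ = (#A + 1) * ‖f‖ ^ 2 := by
    intro x hx
    rw [Finset.mem_sdiff] at hx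
    rw [← sum_inner, Finset.sum_sub_distrib, sum_swap_eq_neg hx.2 hf
      (h0 _ (Finset.insert_subset hx.1 hA) (by rw [Finset.card_insert_of_notMem hx.2])),
      Finset.sum_const, ← Nat.cast_smul_eq_nsmul ℝ, sub_neg_eq_add, inner_add_left,
      inner_smul_left, real_inner_self_eq_norm_sq]
    simp; ring
  have hcard : (#(R \ A) : ℝ) = #R - #A := by
    rw [Finset.card_sdiff_of_subset hA, Nat.cast_sub (Finset.card_le_card hA)]
  have hpart1 : ∑ x ∈ R \ A, ∑ y ∈ A, ⟪f - ρ (swap x y) f, f⟫_ℝ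
      = (#R - #A) * ((#A + 1) * ‖f‖ ^ 2) := by
    rw [Finset.sum_congr rfl hstar, Finset.sum_const, nsmul_eq_mul, hcard]
  have hpart2 : ∑ x ∈ A, ∑ y ∈ R \ A, ⟪f - ρ (swap x y) f, f⟫_ℝ
      = (#R - #A) * ((#A + 1) * ‖f‖ ^ 2) := by
    rw [Finset.sum_comm, ← hpart1]
    simp only [Equiv.swap_comm]
  rw [inner_energy, ← Finset.sum_sdiff hA]
  have h1 : ∑ x ∈ R \ A, ∑ y ∈ A, ⟪f - ρ (swap x y) f, f⟫_ℝ
      ≤ ∑ x ∈ R \ A, ∑ y ∈ R, ⟪f - ρ (swap x y) f, f⟫_ℝ :=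
    Finset.sum_le_sum fun x _ => Finset.sum_le_sum_of_subset_of_nonneg hA fun y _ _ =>
      hρ.inner_sub_rho_nonneg _ _
  have h2 : ∑ x ∈ A, ∑ y ∈ R \ A, ⟪f - ρ (swap x y) f, f⟫_ℝ
      ≤ ∑ x ∈ A, ∑ y ∈ R, ⟪f - ρ (swap x y) f, f⟫_ℝ :=
    Finset.sum_le_sum fun x _ => Finset.sum_le_sum_of_subset_of_nonneg Finset.sdiff_subset
      fun y _ _ => hρ.inner_sub_rho_nonneg _ _
  linarith

/-- A pair of distinct points survives the deletion of `z` for `#R - 2` choices of `z`. -/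
theorem sum_erase_sum_erase (R : Finset ι) (d : ι → ι → ℝ) (hd : ∀ x, d x x = 0) :
    ∑ z ∈ R, ∑ x ∈ R.erase z, ∑ y ∈ R.erase z, d x y
      = ((#R : ℝ) - 2) * ∑ x ∈ R, ∑ y ∈ R, d x y := by
  rw [Finset.sum_comm' (t' := R) (s' := fun x => R.erase x)
    (by intro x y; simp only [Finset.mem_erase]; tauto)]
  rw [Finset.mul_sum]
  refine Finset.sum_congr rfl fun x hx => ?_
  rw [Finset.sum_comm' (t' := R) (s' := fun y => (R.erase x).erase y)
    (by intro x y; simp only [Finset.mem_erase]; tauto)]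
  rw [Finset.mul_sum]
  refine Finset.sum_congr rfl fun y hy => ?_
  rw [Finset.sum_const, nsmul_eq_mul]
  by_cases hxy : y = x
  · subst hxy; simp [hd]
  · have h1 : y ∈ R.erase x := Finset.mem_erase.2 ⟨hxy, hy⟩
    have h2 : #((R.erase x).erase y) + 2 = #R := by
      rw [← Finset.card_erase_add_one hx, ← Finset.card_erase_add_one h1]
    rw [← h2]; push_cast; ring

/-- Lower bound of the Dirichlet form of transpositions on the vectors without invariant component
under symmetric groups on `a` letters. -/
theorem le_inner_energy [FiniteDimensional ℝ E] (hρ : Orthogonal ρ) {γ : ℝ} (hγ2 : γ ≤ 1 / 2) :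
    ∀ (r : ℕ) (R : Finset ι) (a : ℕ), #R = r → 1 ≤ r → a ≤ r → γ * r ≤ r - a + 1 →
      ∀ f ∈ freeOn ρ R a, r * (r - 1) * γ * ‖f‖ ^ 2 ≤ ⟪energy ρ R f, f⟫_ℝ := by
  intro r
  induction r with
  | zero => intro R a _ h; omega
  | succ r ih =>
    intro R a hR _ har hγ f hf
    refine le_inner_of_eigen (energy_symmetric hρ R) (freeOn ρ R a)
      (fun x hx => energy_mem_freeOn hx) ?_ hf
    intro c f hf hf0 hc
    classical
    have hnpos : 0 < ‖f‖ ^ 2 := by positivity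
    have hex : ∃ b, f ∈ freeOn ρ R b := ⟨a, hf⟩
    -- By minimality of `b` some set `A` of `b - 1` letters has a nonzero average `f1`. It is again
    -- an eigenvector for `c`, so the energy bound for `Sym(A)`-invariant vectors applies to `c`
    -- itself.
    set b := Nat.find hex with hb
    have hfb : f ∈ freeOn ρ R b := Nat.find_spec hex
    have hba : b ≤ a := Nat.find_min' hex hf
    have hb2 : 2 ≤ b := by
      by_contra! hb1
      obtain ⟨A, hA, hAb⟩ := Finset.exists_subset_card_eq (show b ≤ #R by omega)
      exact hf0 (by rw [← avg_symOn_of_card_le_one (ρ := ρ) (A := A) (by omega) f, hfb A hA hAb])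
    obtain ⟨a', ha'⟩ : ∃ a', b = a' + 1 := ⟨b - 1, by omega⟩
    have hnot : f ∉ freeOn ρ R a' := Nat.find_min hex (by omega)
    rw [mem_freeOn] at hnot
    push Not at hnot
    obtain ⟨A, hA, hAcard, hf1⟩ := hnot
    set f1 := avg ρ (symOn A) f with hf1def
    have hcf1 : energy ρ R f1 = c • f1 := by
      rw [hf1def, map_avg _ fun g hg x => energy_rho (symOn_mono hA hg) x, hc, map_smul]
    have hen := energy_of_invariant hρ hA (f := f1) (fun g hg => rho_avg hg f)
      (by rw [hAcard, ← ha']; exact avg_mem_freeOn hfb (symOn_mono hA))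
    rw [hcf1, inner_smul_left, real_inner_self_eq_norm_sq, hR, hAcard] at hen
    have hf1pos : 0 < ‖f1‖ ^ 2 := by positivity
    have hc1 : 2 * (((r + 1 : ℕ) : ℝ) - a') * (a' + 1) ≤ c :=
      le_of_mul_le_mul_right (by simpa using hen) hf1pos
    have haa : (a' : ℝ) + 1 ≤ a := by exact_mod_cast ha' ▸ hba
    have har' : (a : ℝ) ≤ r + 1 := by exact_mod_cast har
    push_cast at hc1 hγ ⊢
    have hγ' : γ * (r + 1) ≤ r + 1 - a' := by linarith
    -- If `A` has roughly half of the letters or more, the bound from `f1` suffices. Otherwise one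
    -- letter is deleted, where `γ ≤ 1 / 2` secures the hypothesis on `γ`, and the induction
    -- hypothesis is averaged over the deleted letter.
    by_cases hcase : r ≤ 2 * (a' + 1)
    · have hcase' : (r : ℝ) ≤ 2 * (a' + 1) := by exact_mod_cast hcase
      have h1 : γ * (r + 1) * r ≤ (r + 1 - a') * r :=
        mul_le_mul_of_nonneg_right hγ' (by positivity)
      have h2 : ((r : ℝ) + 1 - a') * r ≤ (r + 1 - a') * (2 * (a' + 1)) :=
        mul_le_mul_of_nonneg_left hcase' (by linarith)
      nlinarith
    · push Not at hcase
      have hcase' : 2 * ((a' : ℝ) + 1) + 1 ≤ r := by exact_mod_cast hcase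
      have hstep : ∀ z ∈ R, (r : ℝ) * (r - 1) * γ * ‖f‖ ^ 2
          ≤ ∑ x ∈ R.erase z, ∑ y ∈ R.erase z, ⟪f - ρ (swap x y) f, f⟫_ℝ := by
        intro z hz
        rw [← inner_energy]
        refine ih (R.erase z) (a' + 1) ?_ (by omega) (by omega) ?_ f
          (freeOn_anti (Finset.erase_subset _ _) (ha' ▸ hfb))
        · rw [Finset.card_erase_of_mem hz, hR]; rfl
        · have : γ * r ≤ 1 / 2 * r := mul_le_mul_of_nonneg_right hγ2 (by positivity)
          push_cast
          linarith
      have hsum := Finset.sum_le_sum hstep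
      rw [sum_erase_sum_erase R (fun x y => ⟪f - ρ (swap x y) f, f⟫_ℝ) (by simp [rho_swap_self, -Equiv.swap_self]), ← inner_energy,
        hc, inner_smul_left, real_inner_self_eq_norm_sq, Finset.sum_const, nsmul_eq_mul, hR] at hsum
      simp only [RCLike.conj_to_real] at hsum
      push_cast at hsum
      have hr1 : (0 : ℝ) < r - 1 := by
        have : (0 : ℝ) ≤ a' := by positivity
        linarith
      have : ((r : ℝ) - 1) * ‖f‖ ^ 2 * ((r + 1) * (r + 1 - 1) * γ) ≤ (r - 1) * ‖f‖ ^ 2 * c := by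
        nlinarith
      exact le_of_mul_le_mul_left this (by positivity)

end Symmetric

end OnionMixing

namespace OnionMixing

/-! ### Averages over matchings. -/

section Pairs

open Equiv (Perm swap)

variable {ι : Type*} [Fintype ι] [DecidableEq ι]
variable {E : Type*} [NormedAddCommGroup E] [InnerProductSpace ℝ E]
variable {ρ : Representation ℝ (Perm ι) E}

/-- The list consists of disjoint pairs of different elements of `R`. -/
def PairsIn : Finset ι → List (ι × ι) → Prop
  | _, [] => True
  | R, e :: M => e.1 ∈ R ∧ e.2 ∈ R ∧ e.1 ≠ e.2 ∧ PairsIn ((R.erase e.1).erase e.2) M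

theorem PairsIn.mono {R R' : Finset ι} {M : List (ι × ι)} (hM : PairsIn R M) (h : R ⊆ R') :
    PairsIn R' M := by
  induction M generalizing R R' with
  | nil => trivial
  | cons e M ih =>
    exact ⟨h hM.1, h hM.2.1, hM.2.2.1,
      ih hM.2.2.2 (Finset.erase_subset_erase _ (Finset.erase_subset_erase _ h))⟩

theorem PairsIn.mem {R : Finset ι} {M : List (ι × ι)} (hM : PairsIn R M) {p : ι × ι}
    (hp : p ∈ M) : p.1 ∈ R ∧ p.2 ∈ R := by
  induction M generalizing R with
  | nil => simp at hp
  | cons e M ih =>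
    rcases List.mem_cons.1 hp with rfl | hp
    · exact ⟨hM.1, hM.2.1⟩
    · have := ih hM.2.2.2 hp
      simp only [Finset.mem_erase] at this
      exact ⟨this.1.2.2, this.2.2.2⟩

theorem card_erase_erase {R : Finset ι} {e : ι × ι} (h1 : e.1 ∈ R) (h2 : e.2 ∈ R)
    (h12 : e.1 ≠ e.2) : #((R.erase e.1).erase e.2) + 2 = #R := by
  have h3 : e.2 ∈ R.erase e.1 := Finset.mem_erase.2 ⟨h12.symm, h2⟩
  rw [← Finset.card_erase_add_one h1, ← Finset.card_erase_add_one h3]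

theorem PairsIn.two_mul_length_le {R : Finset ι} {M : List (ι × ι)} (hM : PairsIn R M) :
    2 * M.length ≤ #R := by
  induction M generalizing R with
  | nil => simp
  | cons e M ih =>
    have := ih hM.2.2.2
    have h := card_erase_erase hM.1 hM.2.1 hM.2.2.1
    rw [List.length_cons]
    omega

theorem PairsIn.sublist {R : Finset ι} {L M : List (ι × ι)} (hM : PairsIn R M)
    (h : L.Sublist M) : PairsIn R L := by
  induction h generalizing R with
  | slnil => trivial
  | cons e _ ih =>
    exact (ih hM.2.2.2).mono ((Finset.erase_subset _ _).trans (Finset.erase_subset _ _))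
  | cons_cons e _ ih => exact ⟨hM.1, hM.2.1, hM.2.2.1, ih hM.2.2.2⟩

/-- The product of the transpositions of the pairs. -/
def prodSwap : List (ι × ι) → Perm ι
  | [] => 1
  | e :: M => swap e.1 e.2 * prodSwap M

theorem prodSwap_append (L M : List (ι × ι)) : prodSwap (L ++ M) = prodSwap L * prodSwap M := by
  induction L with
  | nil => simp [prodSwap]
  | cons e L ih => simp [prodSwap, ih, mul_assoc]

theorem prodSwap_apply_of_forall_ne {M : List (ι × ι)} {z : ι}
    (hz : ∀ p ∈ M, z ≠ p.1 ∧ z ≠ p.2) : prodSwap M z = z := by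
  induction M with
  | nil => simp [prodSwap]
  | cons e M ih =>
    have h := hz e (by simp)
    rw [prodSwap, Perm.mul_apply, ih fun p hp => hz p (by simp [hp]),
      Equiv.swap_apply_of_ne_of_ne h.1 h.2]

theorem PairsIn.prodSwap_snd {R : Finset ι} {M : List (ι × ι)} (hM : PairsIn R M) {p : ι × ι}
    (hp : p ∈ M) : prodSwap M p.2 = p.1 := by
  induction M generalizing R with
  | nil => simp at hp
  | cons e M ih =>
    rw [prodSwap, Perm.mul_apply]
    rcases List.mem_cons.1 hp with rfl | hp
    · rw [prodSwap_apply_of_forall_ne, Equiv.swap_apply_right]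
      intro q hq
      have := hM.2.2.2.mem hq
      simp only [Finset.mem_erase] at this
      exact ⟨this.1.1.symm, this.2.1.symm⟩
    · rw [ih hM.2.2.2 hp]
      have := hM.2.2.2.mem hp
      simp only [Finset.mem_erase] at this
      exact Equiv.swap_apply_of_ne_of_ne this.1.2.1 this.1.1

/-- The average over the group generated by the transpositions of disjoint pairs. -/
noncomputable def matchAvg (ρ : Representation ℝ (Perm ι) E) : List (ι × ι) → Module.End ℝ E
  | [] => 1
  | e :: M => half ρ (swap e.1 e.2) * matchAvg ρ M

theorem matchAvg_cons (e : ι × ι) (M : List (ι × ι)) (x : E) :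
    matchAvg ρ (e :: M) x = half ρ (swap e.1 e.2) (matchAvg ρ M x) := rfl

theorem half_rho_comm {t g : Perm ι} (h : t * g = g * t) (x : E) :
    half ρ t (ρ g x) = ρ g (half ρ t x) := by
  rw [half_apply, half_apply, map_smul, map_add, ← Module.End.mul_apply, ← Module.End.mul_apply,
    ← map_mul, ← map_mul, h]

theorem swap_mul_comm {a b : ι} {g : Perm ι} (ha : g a = a) (hb : g b = b) :
    swap a b * g = g * swap a b := by
  rw [Equiv.mul_swap_eq_swap_mul, ha, hb]

theorem matchAvg_rho_comm {R : Finset ι} {M : List (ι × ι)} (hM : PairsIn R M) {g : Perm ι}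
    (hg : ∀ i ∈ R, g i = i) (x : E) : matchAvg ρ M (ρ g x) = ρ g (matchAvg ρ M x) := by
  induction M with
  | nil => rfl
  | cons e M ih =>
    rw [matchAvg_cons, matchAvg_cons, ih (hM.2.2.2.mono
      ((Finset.erase_subset _ _).trans (Finset.erase_subset _ _))),
      half_rho_comm (swap_mul_comm (hg _ hM.1) (hg _ hM.2.1))]

theorem matchAvg_half_comm {R : Finset ι} {M : List (ι × ι)} (hM : PairsIn R M) {a b : ι}
    (ha : a ∉ R) (hb : b ∉ R) (x : E) :
    matchAvg ρ M (half ρ (swap a b) x) = half ρ (swap a b) (matchAvg ρ M x) := by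
  have hg : ∀ i ∈ R, swap a b i = i := fun i hi =>
    Equiv.swap_apply_of_ne_of_ne (by rintro rfl; exact ha hi) (by rintro rfl; exact hb hi)
  rw [half_apply, map_smul, map_add, matchAvg_rho_comm hM hg, half_apply]

theorem matchAvg_cons' {R : Finset ι} {e : ι × ι} {M : List (ι × ι)} (hM : PairsIn R (e :: M))
    (x : E) : matchAvg ρ (e :: M) x = matchAvg ρ M (half ρ (swap e.1 e.2) x) := by
  rw [matchAvg_cons, matchAvg_half_comm hM.2.2.2 (by simp) (by simp)]

theorem matchAvg_inner (hρ : Orthogonal ρ) {R : Finset ι} {M : List (ι × ι)} (hM : PairsIn R M)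
    (x y : E) : ⟪matchAvg ρ M x, y⟫_ℝ = ⟪x, matchAvg ρ M y⟫_ℝ := by
  induction M generalizing R x y with
  | nil => rfl
  | cons e M ih =>
    rw [matchAvg_cons, hρ.inner_half (Equiv.swap_mul_self _ _), ih hM.2.2.2, matchAvg_cons' hM]

theorem matchAvg_idem {R : Finset ι} {M : List (ι × ι)} (hM : PairsIn R M) (x : E) :
    matchAvg ρ M (matchAvg ρ M x) = matchAvg ρ M x := by
  induction M generalizing R x with
  | nil => rfl
  | cons e M ih =>
    rw [matchAvg_cons, matchAvg_cons, matchAvg_half_comm hM.2.2.2 (by simp) (by simp),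
      ih hM.2.2.2, half_idem (Equiv.swap_mul_self _ _)]

theorem norm_matchAvg_sq (hρ : Orthogonal ρ) {R : Finset ι} {M : List (ι × ι)}
    (hM : PairsIn R M) (x : E) : ‖matchAvg ρ M x‖ ^ 2 = ⟪matchAvg ρ M x, x⟫_ℝ := by
  rw [← real_inner_self_eq_norm_sq, matchAvg_inner hρ hM x (matchAvg ρ M x), matchAvg_idem hM,
    matchAvg_inner hρ hM]

/-- Since `avg` does not increase norms, this bounds the average over a group by the average over
any matching inside it. -/
theorem avg_matchAvg {H : Subgroup (Perm ι)} {M : List (ι × ι)}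
    (hM : ∀ e ∈ M, swap e.1 e.2 ∈ H) (x : E) : avg ρ H (matchAvg ρ M x) = avg ρ H x := by
  induction M with
  | nil => rfl
  | cons e M ih =>
    rw [matchAvg_cons, avg_half (hM e (by simp)), ih fun p hp => hM p (by simp [hp])]

/-! ### Sequential estimate -/

theorem exists_perm_two {R : Finset ι} {a b x y : ι} (ha : a ∈ R) (hb : b ∈ R) (hab : a ≠ b)
    (hx : x ∈ R) (hy : y ∈ R) (hxy : x ≠ y) : ∃ k ∈ symOn R, k a = x ∧ k b = y := by
  have h1 : swap a x b ≠ x := by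
    intro h
    have : swap a x b = swap a x a := by rw [h, Equiv.swap_apply_left]
    exact hab ((swap a x).injective this).symm
  have hm : swap a x ∈ symOn R := swap_mem_symOn ha hx
  refine ⟨swap (swap a x b) y * swap a x,
    Subgroup.mul_mem _ (swap_mem_symOn ((apply_mem_of_mem_symOn hm).2 hb) hy) hm, ?_, ?_⟩
  · rw [Perm.mul_apply, Equiv.swap_apply_left, Equiv.swap_apply_of_ne_of_ne h1.symm hxy]
  · rw [Perm.mul_apply, Equiv.swap_apply_left]

-- `Sym(R)` is doubly transitive, so a random conjugate of one transposition is a uniformly random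
-- transposition of `R`.
open Classical in
theorem sum_symOn_pair {R : Finset ι} {a b : ι} (ha : a ∈ R) (hb : b ∈ R) (hab : a ≠ b)
    (d : ι → ι → ℝ) (hd : ∀ x, d x x = 0) :
    (#R : ℝ) * (#R - 1) * ∑ g with g ∈ symOn R, d (g⁻¹ a) (g⁻¹ b)
      = Nat.card (symOn R) * ∑ x ∈ R, ∑ y ∈ R, d x y := by
  have hconst : ∀ x ∈ R, ∀ y ∈ R.erase x, ∑ g with g ∈ symOn R, d (g⁻¹ x) (g⁻¹ y)
      = ∑ g with g ∈ symOn R, d (g⁻¹ a) (g⁻¹ b) := by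
    intro x hx y hy
    rw [Finset.mem_erase] at hy
    obtain ⟨k, hk, rfl, rfl⟩ := exists_perm_two ha hb hab hx hy.2 hy.1.symm
    refine Finset.sum_bij' (fun g _ => k⁻¹ * g) (fun g _ => k * g) ?_ ?_ ?_ ?_ ?_
    · intro g hg; simpa using Subgroup.mul_mem _ (Subgroup.inv_mem _ hk) (by simpa using hg)
    · intro g hg; simpa using Subgroup.mul_mem _ hk (by simpa using hg)
    · simp
    · simp
    · simp
  have hdiag : ∀ x ∈ R, ∑ y ∈ R, ∑ g with g ∈ symOn R, d (g⁻¹ x) (g⁻¹ y)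
      = (#R - 1) * ∑ g with g ∈ symOn R, d (g⁻¹ a) (g⁻¹ b) := by
    intro x hx
    rw [← Finset.sum_erase_add _ _ hx, Finset.sum_congr rfl (hconst x hx), Finset.sum_const,
      nsmul_eq_mul, Finset.card_erase_of_mem hx, Nat.cast_sub (Finset.card_pos.2 ⟨x, hx⟩)]
    simp [hd]
  calc (#R : ℝ) * (#R - 1) * ∑ g with g ∈ symOn R, d (g⁻¹ a) (g⁻¹ b)
      = ∑ x ∈ R, ∑ y ∈ R, ∑ g with g ∈ symOn R, d (g⁻¹ x) (g⁻¹ y) := by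
        rw [Finset.sum_congr rfl hdiag, Finset.sum_const, nsmul_eq_mul]; ring
    _ = ∑ g with g ∈ symOn R, ∑ x ∈ R, ∑ y ∈ R, d (g⁻¹ x) (g⁻¹ y) := by
        rw [Finset.sum_congr rfl fun x _ => Finset.sum_comm, Finset.sum_comm]
    _ = ∑ g with g ∈ symOn R, ∑ x ∈ R, ∑ y ∈ R, d x y := by
        refine Finset.sum_congr rfl fun g hg => ?_
        have hg' : g⁻¹ ∈ symOn R := Subgroup.inv_mem _ (by simpa using hg)
        exact Finset.sum_equiv g⁻¹ (fun i => (apply_mem_of_mem_symOn hg').symm) fun x _ =>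
          Finset.sum_equiv g⁻¹ (fun i => (apply_mem_of_mem_symOn hg').symm) fun y _ => rfl
    _ = _ := by rw [Finset.sum_const, card_filter_mem, nsmul_eq_mul]

theorem norm_half_rho_sq (hρ : Orthogonal ρ) (a b : ι) (g : Perm ι) (f : E) :
    ‖half ρ (swap a b) (ρ g f)‖ ^ 2
      = ‖f‖ ^ 2 - 2⁻¹ * ⟪f - ρ (swap (g⁻¹ a) (g⁻¹ b)) f, f⟫_ℝ := by
  have h1 : swap a b * g = g * swap (g⁻¹ a) (g⁻¹ b) := by
    rw [Equiv.mul_swap_eq_swap_mul]; simp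
  rw [hρ.norm_half_sq (Equiv.swap_mul_self _ _), half_apply, inner_smul_left, inner_add_left,
    ← Module.End.mul_apply, ← map_mul, h1, map_mul, Module.End.mul_apply, hρ.inner_rho,
    hρ.inner_rho, inner_sub_left, real_inner_self_eq_norm_sq]
  simp; ring

-- The pairs are peeled off one at a time. After a random relabelling the first transposition is
-- uniform in `R`, and `le_inner_energy` yields the factor `1 - γ / 2`. The other pairs avoid its
-- two points; the vector remains free on the smaller letter set, and a further random relabelling
-- of that set commutes with the transposition already used.
open Classical in
theorem sum_norm_matchAvg_le [FiniteDimensional ℝ E] (hρ : Orthogonal ρ) {γ : ℝ} (hγ0 : 0 ≤ γ)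
    (hγ2 : γ ≤ 1 / 2) {a : ℕ} :
    ∀ (M : List (ι × ι)) (R : Finset ι), PairsIn R M → a + 2 * M.length ≤ #R →
      γ * #R ≤ #R - 2 * M.length - a + 1 → ∀ f ∈ freeOn ρ R a,
      ∑ g with g ∈ symOn R, ‖matchAvg ρ M (ρ g f)‖ ^ 2
        ≤ Nat.card (symOn R) * (1 - γ / 2) ^ M.length * ‖f‖ ^ 2 := by
  intro M
  induction M with
  | nil =>
    intro R _ _ _ f _
    simp [matchAvg, hρ _ _, card_filter_mem]
  | cons e M ih =>
    intro R hM hcard hγ f hf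
    set R' := (R.erase e.1).erase e.2 with hR'
    have hR'R : R' ⊆ R := (Finset.erase_subset _ _).trans (Finset.erase_subset _ _)
    have hc' : #R' + 2 = #R := card_erase_erase hM.1 hM.2.1 hM.2.2.1
    have hc'r : (#R' : ℝ) + 2 = #R := by exact_mod_cast hc'
    have hlen : ((e :: M).length : ℝ) = M.length + 1 := by simp
    rw [List.length_cons] at hcard
    rw [hlen] at hγ
    have hR2 : 2 ≤ #R := by omega
    have hhalf : ∑ g with g ∈ symOn R, ‖half ρ (swap e.1 e.2) (ρ g f)‖ ^ 2
        ≤ Nat.card (symOn R) * (1 - γ / 2) * ‖f‖ ^ 2 := by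
      simp only [norm_half_rho_sq hρ]
      rw [Finset.sum_sub_distrib, Finset.sum_const, card_filter_mem, nsmul_eq_mul,
        ← Finset.mul_sum]
      have h1 := sum_symOn_pair hM.1 hM.2.1 hM.2.2.1 (fun x y => ⟪f - ρ (swap x y) f, f⟫_ℝ)
        (by simp [rho_swap_self, -Equiv.swap_self])
      rw [← inner_energy] at h1
      have h2 := le_inner_energy hρ hγ2 (#R) R a rfl (by omega) (by omega)
        (by have : (0 : ℝ) ≤ M.length := by positivity
            linarith) f hf
      have hr2 : (2 : ℝ) ≤ #R := by exact_mod_cast hR2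
      have hpos : (0 : ℝ) < #R * (#R - 1) := by nlinarith
      have h3 : (Nat.card (symOn R) : ℝ) * (#R * (#R - 1) * γ * ‖f‖ ^ 2)
          ≤ Nat.card (symOn R) * ⟪energy ρ R f, f⟫_ℝ :=
        mul_le_mul_of_nonneg_left h2 (by positivity)
      rw [← h1] at h3
      have h4 : (#R * (#R - 1) : ℝ) * (Nat.card (symOn R) * γ * ‖f‖ ^ 2)
          ≤ #R * (#R - 1) * ∑ g with g ∈ symOn R,
            ⟪f - ρ (swap (g⁻¹ e.1) (g⁻¹ e.2)) f, f⟫_ℝ := by linarith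
      have h5 := le_of_mul_le_mul_left h4 hpos
      linarith
    -- The extra relabelling `h` is absorbed into `g`; it commutes with the first transposition
    -- because it fixes both of its points.
    have hshift : ∀ h ∈ symOn R', ∑ g with g ∈ symOn R, ‖matchAvg ρ (e :: M) (ρ g f)‖ ^ 2
        = ∑ g with g ∈ symOn R,
            ‖matchAvg ρ M (ρ h (half ρ (swap e.1 e.2) (ρ g f)))‖ ^ 2 := by
      intro h hh
      have hhR := symOn_mono hR'R hh
      refine Finset.sum_bij' (fun g _ => h⁻¹ * g) (fun g _ => h * g) ?_ ?_ ?_ ?_ ?_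
      · intro g hg
        simpa using Subgroup.mul_mem _ (Subgroup.inv_mem _ hhR) (by simpa using hg)
      · intro g hg; simpa using Subgroup.mul_mem _ hhR (by simpa using hg)
      · simp
      · simp
      · intro g _
        rw [matchAvg_cons' hM, ← half_rho_comm (swap_mul_comm (hh _ (by simp [hR']))
          (hh _ (by simp [hR']))), ← Module.End.mul_apply (ρ h), ← map_mul, mul_inv_cancel_left]
    have hstep : (Nat.card (symOn R') : ℝ)
          * ∑ g with g ∈ symOn R, ‖matchAvg ρ (e :: M) (ρ g f)‖ ^ 2
        ≤ ∑ g with g ∈ symOn R, Nat.card (symOn R') * (1 - γ / 2) ^ M.length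
            * ‖half ρ (swap e.1 e.2) (ρ g f)‖ ^ 2 := by
      rw [← card_filter_mem, ← nsmul_eq_mul, ← Finset.sum_const,
        Finset.sum_congr rfl fun h hh => hshift h (by simpa using hh), Finset.sum_comm,
        card_filter_mem]
      refine Finset.sum_le_sum fun g hg => ?_
      have hg' : g ∈ symOn R := by simpa using hg
      refine ih R' hM.2.2.2 (by omega) ?_ _ ?_
      · have : γ * #R' ≤ γ * #R := mul_le_mul_of_nonneg_left (by linarith) hγ0
        linarith
      · refine freeOn_anti hR'R ?_
        rw [half_apply]
        have hgf := rho_mem_freeOn hf hg'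
        exact Submodule.smul_mem _ _ (Submodule.add_mem _ hgf
          (rho_mem_freeOn hgf (swap_mem_symOn hM.1 hM.2.1)))
    rw [← Finset.mul_sum, mul_assoc] at hstep
    have hcpos : (0 : ℝ) < Nat.card (symOn R') := by exact_mod_cast Nat.card_pos
    have h6 := le_of_mul_le_mul_left hstep hcpos
    refine h6.trans ?_
    rw [List.length_cons, pow_succ]
    have h7 : (0 : ℝ) ≤ (1 - γ / 2) ^ M.length := pow_nonneg (by linarith) _
    calc (1 - γ / 2) ^ M.length * ∑ g with g ∈ symOn R, ‖half ρ (swap e.1 e.2) (ρ g f)‖ ^ 2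
        ≤ (1 - γ / 2) ^ M.length * (Nat.card (symOn R) * (1 - γ / 2) * ‖f‖ ^ 2) :=
          mul_le_mul_of_nonneg_left hhalf h7
      _ = _ := by ring

/-! ### Pairs that cross an invariant set -/

-- The vector `z` is arbitrary, and not just `f`, because the induction replaces it by its image
-- under a transposition of two points outside `A`; such an image is still `Sym(A)`-invariant.
set_option maxHeartbeats 1000000 in
theorem abs_inner_prodSwap_le (hρ : Orthogonal ρ) {A : Finset ι} {f : E}
    (hf : ∀ g ∈ symOn A, ρ g f = f) (hstar : ∀ x ∉ A, ∑ b ∈ A, ρ (swap x b) f = -f) :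
    ∀ (L : List (ι × ι)) (R : Finset ι), PairsIn R L → (∀ p ∈ L, p.1 ∉ A ∧ p.2 ∈ A) →
      3 * L.length ≤ #A + 1 → ∀ z : E, (∀ g ∈ symOn A, ρ g z = z) →
      |⟪ρ (prodSwap L) f, z⟫_ℝ| ≤ (1 / 2) ^ L.length * (‖f‖ * ‖z‖) := by
  intro L
  induction L with
  | nil =>
    intro R _ _ _ z _
    simpa [prodSwap] using abs_real_inner_le_norm f z
  | cons e L ih =>
    intro R hL hor hlen z hz
    obtain ⟨x, b⟩ := e
    set t := prodSwap L with ht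
    set B := (L.map Prod.snd).toFinset with hB
    have horL : ∀ p ∈ L, p.1 ∉ A ∧ p.2 ∈ A := fun p hp => hor p (by simp [hp])
    have hxA : x ∉ A := (hor (x, b) (by simp)).1
    have hbA : b ∈ A := (hor (x, b) (by simp)).2
    have hmemL : ∀ p ∈ L, (p.1 ≠ b ∧ p.1 ≠ x) ∧ (p.2 ≠ b ∧ p.2 ≠ x) := by
      intro p hp
      have := hL.2.2.2.mem hp
      simp only [Finset.mem_erase] at this
      exact ⟨⟨this.1.1, this.1.2.1⟩, ⟨this.2.1, this.2.2.1⟩⟩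
    have htx : t x = x := prodSwap_apply_of_forall_ne fun p hp =>
      ⟨(hmemL p hp).1.2.symm, (hmemL p hp).2.2.symm⟩
    have htA : ∀ c ∈ A, c ∉ B → t c = c := by
      intro c hc hcB
      refine prodSwap_apply_of_forall_ne fun p hp => ⟨?_, ?_⟩
      · rintro rfl; exact (horL p hp).1 hc
      · rintro rfl; exact hcB (by simp only [hB, List.mem_toFinset, List.mem_map]; exact ⟨p, hp, rfl⟩)
    have htB : ∀ c ∈ B, t c ∉ A := by
      intro c hc
      simp only [hB, List.mem_toFinset, List.mem_map] at hc
      obtain ⟨p, hp, rfl⟩ := hc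
      rw [ht, hL.2.2.2.prodSwap_snd hp]
      exact (horL p hp).1
    have hBA : B ⊆ A := by
      intro c hc
      simp only [hB, List.mem_toFinset, List.mem_map] at hc
      obtain ⟨p, hp, rfl⟩ := hc
      exact (horL p hp).2
    have hbB : b ∉ B := by
      intro hc
      simp only [hB, List.mem_toFinset, List.mem_map] at hc
      obtain ⟨p, hp, hpb⟩ := hc
      exact (hmemL p hp).2.1 hpb
    have hBcard : #B ≤ L.length := by
      simpa [hB] using List.toFinset_card_le (L.map Prod.snd)
    have hhead : prodSwap ((x, b) :: L) = t * swap x b := by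
      rw [prodSwap, ← ht, swap_mul_comm htx (htA b hbA hbB)]
    -- The partner `b` of `x` is varied over all of `A`. The star relation at `x` gives the sum of
    -- `v`, and symmetry shows that `v` is constant off the few points already paired.
    set v : ι → ℝ := fun c => ⟪ρ (t * swap x c) f, z⟫_ℝ with hv
    have hvconst : ∀ c ∈ A \ B, v c = v b := by
      intro c hc
      rw [Finset.mem_sdiff] at hc
      have hcA : swap b c ∈ symOn A := swap_mem_symOn hbA hc.1
      have hx' : swap b c x = x := hcA x hxA
      have h1 : swap b c * (t * swap x b) = t * swap x c * swap b c := by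
        rw [← mul_assoc, swap_mul_comm (htA b hbA hbB) (htA c hc.1 hc.2), mul_assoc, mul_assoc,
          Equiv.mul_swap_eq_swap_mul, hx', Equiv.swap_apply_left]
      calc v c = ⟪ρ (t * swap x c) (ρ (swap b c) f), z⟫_ℝ := by rw [hf _ hcA]
        _ = ⟪ρ (swap b c) (ρ (t * swap x b) f), ρ (swap b c) z⟫_ℝ := by
          rw [hz _ hcA, ← Module.End.mul_apply, ← map_mul, ← h1, map_mul, Module.End.mul_apply]
        _ = v b := hρ.inner_rho _ _ _
    -- If `c` is already paired, then `t c` lies outside `A`, so `swap x (t c)` can be moved past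
    -- `t` and over to `z`; the induction hypothesis bounds the rest.
    have hvB : ∀ c ∈ B, |v c| ≤ (1 / 2) ^ L.length * (‖f‖ * ‖z‖) := by
      intro c hc
      have h1 : t * swap x c = swap x (t c) * t := by
        rw [Equiv.mul_swap_eq_swap_mul, htx]
      have h2 : v c = ⟪ρ t f, ρ (swap x (t c))⁻¹ z⟫_ℝ := by
        simp only [hv]
        rw [h1, map_mul, Module.End.mul_apply, hρ.inner_rho_left]
      rw [h2, ← hρ (swap x (t c))⁻¹ z]
      refine ih _ hL.2.2.2 horL (by rw [List.length_cons] at hlen; omega) _ ?_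
      intro g hg
      rw [Equiv.swap_inv, ← Module.End.mul_apply, ← map_mul,
        ← swap_mul_comm (hg _ hxA) (hg _ (htB c hc)), map_mul, Module.End.mul_apply, hz g hg]
    have hsum : ∑ c ∈ A, v c = -⟪ρ t f, z⟫_ℝ := by
      simp only [hv, map_mul, Module.End.mul_apply]
      rw [← sum_inner, ← map_sum, hstar x hxA, map_neg, inner_neg_left]
    have hsplit : ((#A : ℝ) - #B) * v b = -⟪ρ t f, z⟫_ℝ - ∑ c ∈ B, v c := by
      rw [← hsum, ← Finset.sum_sdiff hBA, Finset.sum_congr rfl hvconst, Finset.sum_const,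
        nsmul_eq_mul, Finset.card_sdiff_of_subset hBA, Nat.cast_sub (Finset.card_le_card hBA)]
      ring
    set K := (1 / 2 : ℝ) ^ L.length * (‖f‖ * ‖z‖) with hK
    have hK0 : 0 ≤ K := by positivity
    have hb1 : |((#A : ℝ) - #B) * v b| ≤ (1 + #B) * K := by
      rw [hsplit]
      have h1 := ih _ hL.2.2.2 horL (by rw [List.length_cons] at hlen; omega) z hz
      have h2 : |∑ c ∈ B, v c| ≤ #B * K := by
        refine (Finset.abs_sum_le_sum_abs _ _).trans ((Finset.sum_le_sum hvB).trans ?_)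
        rw [Finset.sum_const, nsmul_eq_mul]
      have h3 := abs_sub (-⟪ρ t f, z⟫_ℝ) (∑ c ∈ B, v c)
      rw [abs_neg] at h3
      linarith
    -- This makes `(1 + #B) / (#A - #B)` at most `1 / 2`, which is the gain per pair.
    have hlen' : 3 * (#B : ℝ) + 2 ≤ #A := by
      rw [List.length_cons] at hlen
      exact_mod_cast (show 3 * #B + 2 ≤ #A by omega)
    have hBn : (0 : ℝ) ≤ #B := by positivity
    rw [abs_mul, abs_of_pos (by linarith)] at hb1
    have hfin : |v b| ≤ 1 / 2 * K := by
      by_contra! hc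
      have : ((#A : ℝ) - #B) * (1 / 2 * K) < (#A - #B) * |v b| :=
        mul_lt_mul_of_pos_left hc (by linarith)
      nlinarith
    rw [hhead, List.length_cons, pow_succ]
    calc |⟪ρ (t * swap x b) f, z⟫_ℝ| ≤ 1 / 2 * K := hfin
      _ = _ := by rw [hK]; ring

/-- Expanding one factor `half` either drops its transposition or moves it into the list `F`, where
it costs `1 / 2`. The mean of the two bounds is `(1 + 1 / 2) / 2 = 3 / 4`. -/
theorem inner_matchAvg_le (hρ : Orthogonal ρ) {A : Finset ι} {f : E}
    (hf : ∀ g ∈ symOn A, ρ g f = f) (hstar : ∀ x ∉ A, ∑ b ∈ A, ρ (swap x b) f = -f)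
    {R : Finset ι} :
    ∀ (M F : List (ι × ι)), PairsIn R (F ++ M) → (∀ p ∈ F ++ M, p.1 ∉ A ∧ p.2 ∈ A) →
      3 * (F ++ M).length ≤ #A + 1 →
      ⟪ρ (prodSwap F) (matchAvg ρ M f), f⟫_ℝ
        ≤ (1 / 2) ^ F.length * (3 / 4) ^ M.length * ‖f‖ ^ 2 := by
  intro M
  induction M with
  | nil =>
    intro F hF hor hlen
    rw [List.append_nil] at hF hor hlen
    have := (le_abs_self _).trans (abs_inner_prodSwap_le hρ hf hstar F R hF hor hlen f hf)
    simpa [matchAvg, sq] using this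
  | cons e M ih =>
    intro F hF hor hlen
    have happ : F ++ e :: M = (F ++ [e]) ++ M := by simp
    have h2 := ih (F ++ [e]) (happ ▸ hF) (happ ▸ hor) (happ ▸ hlen)
    have h1 : ⟪ρ (prodSwap F) (matchAvg ρ M f), f⟫_ℝ
        ≤ (1 / 2) ^ F.length * (3 / 4) ^ M.length * ‖f‖ ^ 2 := by
      have hsub : (F ++ M).Sublist (F ++ e :: M) :=
        (List.Sublist.refl F).append (List.sublist_cons_self e M)
      exact ih F (hF.sublist hsub) (fun p hp => hor p (hsub.subset hp))
        ((Nat.mul_le_mul_left 3 hsub.length_le).trans hlen)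
    rw [prodSwap_append, List.length_append, List.length_singleton] at h2
    have hs : prodSwap [e] = swap e.1 e.2 := by simp [prodSwap]
    rw [hs, map_mul, Module.End.mul_apply] at h2
    rw [matchAvg_cons, half_apply, map_smul, map_add, inner_smul_left, inner_add_left,
      List.length_cons]
    simp only [RCLike.conj_to_real]
    rw [pow_succ] at h2 ⊢
    linarith

end Pairs

end OnionMixing

namespace OnionMixing

/-! ### Contraction at small depth, by counting the pairs that cross a set. -/

section Crossing

open Equiv (Perm swap)

variable {ι : Type*} [Fintype ι] [DecidableEq ι]
variable {E : Type*} [NormedAddCommGroup E] [InnerProductSpace ℝ E]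
variable {ρ : Representation ℝ (Perm ι) E}

/-- The pairs with exactly one element in `A`, which is put into the second place. -/
def crossing (A : Finset ι) : List (ι × ι) → List (ι × ι)
  | [] => []
  | e :: M =>
    if e.1 ∉ A ∧ e.2 ∈ A then e :: crossing A M
    else if e.1 ∈ A ∧ e.2 ∉ A then e.swap :: crossing A M
    else crossing A M

theorem length_crossing_le (A : Finset ι) (M : List (ι × ι)) :
    (crossing A M).length ≤ M.length := by
  induction M with
  | nil => simp [crossing]
  | cons e M ih =>
    rw [crossing]
    split_ifs <;> simp <;> omega

theorem crossing_oriented (A : Finset ι) (M : List (ι × ι)) :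
    ∀ p ∈ crossing A M, p.1 ∉ A ∧ p.2 ∈ A := by
  induction M with
  | nil => simp [crossing]
  | cons e M ih =>
    rw [crossing]
    split_ifs with h1 h2
    · simpa [h1] using ih
    · simpa [h2] using ih
    · exact ih

theorem PairsIn.crossing {R : Finset ι} {M : List (ι × ι)} (hM : PairsIn R M) (A : Finset ι) :
    PairsIn R (crossing A M) := by
  induction M generalizing R with
  | nil => trivial
  | cons e M ih =>
    have := ih hM.2.2.2
    rw [OnionMixing.crossing]
    split_ifs with h1 h2
    · exact ⟨hM.1, hM.2.1, hM.2.2.1, this⟩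
    · exact ⟨hM.2.1, hM.1, hM.2.2.1.symm, by
        rwa [Prod.fst_swap, Prod.snd_swap, Finset.erase_right_comm]⟩
    · exact this.mono ((Finset.erase_subset _ _).trans (Finset.erase_subset _ _))

theorem crossing_congr {A B : Finset ι} {M : List (ι × ι)}
    (h : ∀ p ∈ M, (p.1 ∈ A ↔ p.1 ∈ B) ∧ (p.2 ∈ A ↔ p.2 ∈ B)) : crossing A M = crossing B M := by
  induction M with
  | nil => rfl
  | cons e M ih =>
    have he := h e (by simp)
    rw [crossing, crossing, ih fun p hp => h p (by simp [hp])]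
    simp only [he.1, he.2]

theorem length_crossing_compl (A : Finset ι) (M : List (ι × ι)) :
    (crossing Aᶜ M).length = (crossing A M).length := by
  induction M with
  | nil => rfl
  | cons e M ih =>
    rw [crossing, crossing]
    by_cases h1 : e.1 ∈ A <;> by_cases h2 : e.2 ∈ A <;> simp [h1, h2, ih]

/-- The projections of disjoint pairs commute, and those of the pairs that do not cross `A` can be
dropped since they do not increase norms. -/
theorem norm_matchAvg_le_crossing (hρ : Orthogonal ρ) {R : Finset ι} {M : List (ι × ι)}
    (hM : PairsIn R M) (A : Finset ι) (v : E) :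
    ‖matchAvg ρ M v‖ ≤ ‖matchAvg ρ (crossing A M) v‖ := by
  induction M generalizing R v with
  | nil => rfl
  | cons e M ih =>
    rw [crossing]
    have hc := hM.2.2.2.crossing A
    split_ifs with h1 h2
    · rw [matchAvg_cons' hM, matchAvg_cons, ← matchAvg_half_comm hc (by simp) (by simp)]
      exact ih hM.2.2.2 _
    · rw [matchAvg_cons' hM, matchAvg_cons, Prod.fst_swap, Prod.snd_swap, Equiv.swap_comm e.2 e.1,
        ← matchAvg_half_comm hc (by simp) (by simp)]
      exact ih hM.2.2.2 _
    · exact (hρ.norm_half_le _ _).trans (ih hM.2.2.2 v)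

theorem norm_matchAvg_sq_le_crossing (hρ : Orthogonal ρ) {A R : Finset ι} {f : E}
    (hf : ∀ g ∈ symOn A, ρ g f = f) (hfree : f ∈ freeOn ρ univ (#A + 1))
    {M : List (ι × ι)} (hM : PairsIn R M) (hlen : 3 * M.length ≤ #A + 1) :
    ‖matchAvg ρ M f‖ ^ 2 ≤ (3 / 4) ^ (crossing A M).length * ‖f‖ ^ 2 := by
  have hstar : ∀ x ∉ A, ∑ b ∈ A, ρ (swap x b) f = -f := fun x hx =>
    sum_swap_eq_neg hx hf (hfree _ (Finset.subset_univ _) (by rw [Finset.card_insert_of_notMem hx]))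
  have hc := hM.crossing A
  calc ‖matchAvg ρ M f‖ ^ 2 ≤ ‖matchAvg ρ (crossing A M) f‖ ^ 2 := by
        gcongr; exact norm_matchAvg_le_crossing hρ hM A f
    _ = ⟪matchAvg ρ (crossing A M) f, f⟫_ℝ := norm_matchAvg_sq hρ hc f
    _ ≤ _ := by
      have := inner_matchAvg_le hρ hf hstar (crossing A M) [] hc (crossing_oriented A M)
        ((Nat.mul_le_mul_left 3 (length_crossing_le A M)).trans hlen)
      simpa [prodSwap] using this

/-! ### Counting crossing pairs -/

open Polynomial in
/-- The generating function of subsets, weighted by their number of crossing pairs. -/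
noncomputable def crossPoly (m j : ℕ) : ℝ[X] := (1 + C (3 / 2) * X + X ^ 2) ^ m * (1 + X) ^ j

-- A pair contributes `1` if it avoids the subset, `3/4 X` for each of the two ways to cross it, and
-- `X²` if it lies inside; an unpaired letter contributes `1 + X`.
open Polynomial in
theorem sum_powerset_crossing {R : Finset ι} {M : List (ι × ι)} (hM : PairsIn R M) :
    ∑ B ∈ R.powerset, C ((3 / 4 : ℝ) ^ (crossing B M).length) * X ^ #B
      = crossPoly M.length (#R - 2 * M.length) := by
  induction M generalizing R with
  | nil =>
    have := Finset.sum_pow_mul_eq_add_pow (X : ℝ[X]) 1 R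
    simp [crossing, crossPoly] at this ⊢
    rw [this, add_comm]
  | cons e M ih =>
    obtain ⟨a, b⟩ := e
    obtain ⟨ha, hb, hab, hM'⟩ := hM
    simp only at ha hb hab hM'
    set R' := (R.erase a).erase b with hR'
    have haR : a ∉ insert b R' := by simp [hR', hab]
    have hbR : b ∉ R' := by simp [hR']
    have hR : R = insert a (insert b R') := by
      rw [hR', Finset.insert_erase (Finset.mem_erase.2 ⟨hab.symm, hb⟩), Finset.insert_erase ha]
    have hcard : #R' + 2 = #R := card_erase_erase (e := (a, b)) ha hb hab
    have hexp : #R - 2 * ((a, b) :: M).length = #R' - 2 * M.length := by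
      rw [List.length_cons]; omega
    have hne : ∀ p ∈ M, (p.1 ≠ a ∧ p.1 ≠ b) ∧ (p.2 ≠ a ∧ p.2 ≠ b) := by
      intro p hp
      have := hM'.mem hp
      simp only [hR', Finset.mem_erase] at this
      exact ⟨⟨this.1.2.1, this.1.1⟩, ⟨this.2.2.1, this.2.1⟩⟩
    rw [hexp]
    conv_lhs => rw [hR, Finset.sum_powerset_insert haR, Finset.sum_powerset_insert hbR,
      Finset.sum_powerset_insert hbR]
    have hB : ∀ B ∈ R'.powerset, a ∉ B ∧ b ∉ B := by
      intro B hB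
      rw [Finset.mem_powerset] at hB
      exact ⟨fun h => haR (by simp [hB h]), fun h => hbR (hB h)⟩
    have e1 : ∀ B ∈ R'.powerset, C ((3 / 4 : ℝ) ^ (crossing B ((a, b) :: M)).length) * X ^ #B
        = C ((3 / 4 : ℝ) ^ (crossing B M).length) * X ^ #B := by
      intro B hBm
      have := hB B hBm
      simp [crossing, this.1, this.2]
    have e2 : ∀ B ∈ R'.powerset,
        C ((3 / 4 : ℝ) ^ (crossing (insert b B) ((a, b) :: M)).length) * X ^ #(insert b B)
        = C ((3 / 4 : ℝ) ^ (crossing B M).length) * X ^ #B * (C (3 / 4) * X) := by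
      intro B hBm
      have := hB B hBm
      have hc : crossing (insert b B) M = crossing B M := crossing_congr fun p hp => by
        simp [hne p hp]
      simp only [crossing, hc, Finset.card_insert_of_notMem this.2]
      simp [this.1, hab, pow_succ]; ring
    have e3 : ∀ B ∈ R'.powerset,
        C ((3 / 4 : ℝ) ^ (crossing (insert a B) ((a, b) :: M)).length) * X ^ #(insert a B)
        = C ((3 / 4 : ℝ) ^ (crossing B M).length) * X ^ #B * (C (3 / 4) * X) := by
      intro B hBm
      have := hB B hBm
      have hc : crossing (insert a B) M = crossing B M := crossing_congr fun p hp => by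
        simp [hne p hp]
      simp only [crossing, hc, Finset.card_insert_of_notMem this.1]
      simp [this.2, hab.symm, pow_succ]; ring
    have e4 : ∀ B ∈ R'.powerset,
        C ((3 / 4 : ℝ) ^ (crossing (insert a (insert b B)) ((a, b) :: M)).length)
          * X ^ #(insert a (insert b B))
        = C ((3 / 4 : ℝ) ^ (crossing B M).length) * X ^ #B * X ^ 2 := by
      intro B hBm
      have := hB B hBm
      have hc : crossing (insert a (insert b B)) M = crossing B M := crossing_congr fun p hp => by
        simp [hne p hp]
      have hcb : #(insert a (insert b B)) = #B + 2 := by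
        rw [Finset.card_insert_of_notMem (by simp [hab, this.1]),
          Finset.card_insert_of_notMem this.2]
      simp only [crossing, hc, hcb]
      simp [pow_add]; ring
    rw [Finset.sum_congr rfl e1, Finset.sum_congr rfl e2, Finset.sum_congr rfl e3,
      Finset.sum_congr rfl e4, ← Finset.sum_mul, ← Finset.sum_mul, ih hM']
    have h32 : (C (3 / 2) : ℝ[X]) = C (3 / 4) + C (3 / 4) := by rw [← C_add]; norm_num
    rw [crossPoly, crossPoly, List.length_cons, pow_succ, h32]
    ring

/-- Crossing is symmetric under complements, so large subsets are counted through their small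
complements. This moves the coefficient to the depth `Fintype.card ι - a`. -/
theorem sum_powersetCard_crossing {M : List (ι × ι)} (hM : PairsIn univ M) {a : ℕ}
    (ha : a ≤ Fintype.card ι) :
    ∑ B ∈ powersetCard a univ, (3 / 4 : ℝ) ^ (crossing B M).length
      = (crossPoly M.length (Fintype.card ι - 2 * M.length)).coeff (Fintype.card ι - a) := by
  have h1 : ∑ B ∈ powersetCard a univ, (3 / 4 : ℝ) ^ (crossing B M).length
      = ∑ B ∈ powersetCard (Fintype.card ι - a) univ, (3 / 4 : ℝ) ^ (crossing B M).length := by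
    refine Finset.sum_bij' (fun B _ => Bᶜ) (fun B _ => Bᶜ) ?_ ?_ ?_ ?_ ?_
    · intro B hB
      simp only [Finset.mem_powersetCard_univ] at hB ⊢
      rw [Finset.card_compl, hB]
    · intro B hB
      simp only [Finset.mem_powersetCard_univ] at hB ⊢
      rw [Finset.card_compl, hB]; omega
    · simp
    · simp
    · intro B _; rw [length_crossing_compl]
  rw [h1, ← Finset.card_univ, ← sum_powerset_crossing hM, Polynomial.finsetSum_coeff]
  simp only [Polynomial.coeff_C_mul_X_pow]
  rw [← Finset.sum_filter, Finset.powersetCard_eq_filter]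
  simp only [eq_comm]

open Polynomial in
theorem coeff_crossPoly_succ (m j k : ℕ) :
    (crossPoly m j).coeff (k + 1) * (k + 1)
      = m * (3 / 2 * (crossPoly (m - 1) j).coeff k + 2 * (X * crossPoly (m - 1) j).coeff k)
        + j * (crossPoly m (j - 1)).coeff k := by
  rw [← Polynomial.coeff_derivative]
  have : derivative (crossPoly m j) = C (m : ℝ) * (C (3 / 2) * crossPoly (m - 1) j
      + C 2 * (X * crossPoly (m - 1) j)) + C (j : ℝ) * crossPoly m (j - 1) := by
    simp only [crossPoly, derivative_mul, derivative_pow, derivative_add, derivative_one,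
      derivative_X, derivative_C]
    simp
    have : (C 2 : ℝ[X]) = 2 := rfl
    ring
  rw [this]
  simp only [coeff_add, coeff_C_mul]

-- With `2 X` in place of `3/2 X` the polynomial would be `(1 + X) ^ (2 * m + j)`, with binomial
-- coefficients. The derivative gives a recursion in `k` in which the smaller middle coefficient
-- saves a factor `θ` at each step. The constant 15 makes the second hypothesis say `16 * k ≤ n` in
-- terms of the index `k` and degree `n` remaining after one step.
set_option maxHeartbeats 1000000 in
theorem coeff_crossPoly_le {θ : ℝ} (hθ1 : 1 / 2 ≤ θ) (hθ2 : θ ≤ 1) :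
    ∀ k m j : ℕ, 4 * (1 - θ) * (2 * m + j) ≤ m - k → 16 * k ≤ 2 * m + j + 15 →
      (crossPoly m j).coeff k ≤ θ ^ k * (2 * m + j).choose k := by
  intro k
  induction k using Nat.strong_induction_on with
  | _ k ih =>
  intro m j h1 h2
  rcases k with _ | k
  · simp [crossPoly, Polynomial.coeff_zero_eq_eval_zero]
  have hμ : 0 ≤ 4 * (1 - θ) := by linarith
  push_cast at h1
  have hm : (k : ℝ) + 1 ≤ m := by
    have : 0 ≤ 4 * (1 - θ) * (2 * m + j) := by positivity
    linarith
  have hm' : k + 1 ≤ m := by exact_mod_cast hm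
  obtain ⟨m, rfl⟩ : ∃ m', m = m' + 1 := ⟨m - 1, by omega⟩
  push_cast at h1 hm
  set Q : ℝ := ((2 * m + j + 1).choose k : ℝ) with hQ
  have hk0 : (0 : ℝ) < k + 1 := by positivity
  have hn0 : (0 : ℝ) < 2 * m + j + 1 := by positivity
  have hchoose : ((2 * (m + 1) + j).choose (k + 1) : ℝ) * (k + 1) = (2 * m + j + 2) * Q := by
    have := Nat.add_one_mul_choose_eq (2 * m + j + 1) k
    rw [show 2 * (m + 1) + j = 2 * m + j + 1 + 1 by ring]
    have h : (((2 * m + j + 1 + 1) * (2 * m + j + 1).choose k : ℕ) : ℝ)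
      = (((2 * m + j + 1 + 1).choose (k + 1) * (k + 1) : ℕ) : ℝ) := by exact_mod_cast this
    push_cast at h
    rw [← h]; ring
  have hw : (k : ℝ) ≤ (2 * m + j + 1) / 16 := by
    have : 16 * k ≤ 2 * m + j + 1 := by omega
    have : (16 : ℝ) * k ≤ 2 * m + j + 1 := by exact_mod_cast this
    linarith
  have hcA : ((2 * m + j).choose k : ℝ) * (2 * m + j + 1) = Q * (2 * m + j + 1 - k) := by
    have := Nat.choose_mul_succ_eq (2 * m + j) k
    have hle : k ≤ 2 * m + j + 1 := by omega
    have h : (((2 * m + j).choose k * (2 * m + j + 1) : ℕ) : ℝ)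
      = (((2 * m + j + 1).choose k * (2 * m + j + 1 - k) : ℕ) : ℝ) := by exact_mod_cast this
    push_cast [Nat.cast_sub hle] at h
    exact h
  have hA : (crossPoly m j).coeff k ≤ θ ^ k * (2 * m + j).choose k := by
    refine ih k (by omega) m j ?_ (by omega)
    nlinarith
  have hθk : 0 < θ ^ k := pow_pos (by linarith) k
  -- Multiplication by `X` lowers the index once more, so the induction hypothesis provides one
  -- factor `θ` too few. It is put on the left here and later removed with `θ ≥ 1 / 2`.
  have hB : θ * ((Polynomial.X * crossPoly m j).coeff k) * (2 * m + j + 1) ≤ θ ^ k * (Q * k) := by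
    rcases k with _ | k
    · simp
    · rw [Polynomial.coeff_X_mul]
      have h := ih k (by omega) m j (by push_cast at h1; nlinarith) (by omega)
      have hcB : ((2 * m + j).choose k : ℝ) * (2 * m + j + 1) = Q * (k + 1 : ℕ) := by
        have := Nat.add_one_mul_choose_eq (2 * m + j) k
        have h : (((2 * m + j + 1) * (2 * m + j).choose k : ℕ) : ℝ)
          = (((2 * m + j + 1).choose (k + 1) * (k + 1) : ℕ) : ℝ) := by exact_mod_cast this
        push_cast at h ⊢
        rw [hQ]; linarith
      calc θ * (crossPoly m j).coeff k * (2 * m + j + 1)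
          ≤ θ * (θ ^ k * (2 * m + j).choose k) * (2 * m + j + 1) := by gcongr
        _ = θ ^ (k + 1) * (((2 * m + j).choose k : ℝ) * (2 * m + j + 1)) := by ring
        _ = _ := by rw [hcB]
  have hC : (j : ℝ) * (crossPoly (m + 1) (j - 1)).coeff k ≤ j * (θ ^ k * Q) := by
    rcases j with _ | j
    · simp
    · refine mul_le_mul_of_nonneg_left ?_ (by positivity)
      have h := ih k (by omega) (m + 1) j (by push_cast at h1 ⊢; nlinarith) (by omega)
      rw [hQ, show 2 * m + (j + 1) + 1 = 2 * (m + 1) + j by ring]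
      exact h
  have hrec := coeff_crossPoly_succ (m + 1) j k
  rw [Nat.add_sub_cancel] at hrec
  have hQ0 : 0 ≤ Q := by positivity
  set c1 := (crossPoly m j).coeff k
  set c2 := (Polynomial.X * crossPoly m j).coeff k
  set c3 := (crossPoly (m + 1) (j - 1)).coeff k
  set n : ℝ := 2 * m + j + 1 with hn
  have hA' : c1 * n ≤ θ ^ k * (Q * (n - k)) := by
    rw [← hcA]; nlinarith
  have hB' : c2 * n ≤ 2 * (θ ^ k * (Q * k)) := by
    have h0 : 0 ≤ θ ^ k * (Q * k) := by positivity
    by_cases hc : c2 * n ≤ 0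
    · linarith
    · nlinarith
  have hfin : (crossPoly (m + 1) j).coeff (k + 1) * (k + 1) * n
      ≤ θ ^ (k + 1) * ((2 * m + j + 2) * Q) * n := by
    rw [hrec]
    push_cast
    have hm0 : (0 : ℝ) ≤ m + 1 := by positivity
    have s1 : (m + 1 : ℝ) * (3 / 2 * (c1 * n) + 2 * (c2 * n))
        ≤ (m + 1) * (3 / 2 * (θ ^ k * (Q * (n - k))) + 2 * (2 * (θ ^ k * (Q * k)))) := by
      gcongr
    have s2 : (j : ℝ) * c3 * n ≤ j * (θ ^ k * Q) * n := by gcongr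
    -- As `k ≤ n / 16`, the `m + 1` pairs have weight at most `7/4` each, instead of 2. The total
    -- saving `(m + 1) / 4` pays for `(1 - θ) * (2 * m + j + 2)`.
    have s3 : (m + 1 : ℝ) * (3 / 2 * (n - k) + 4 * k) + j * n ≤ θ * (2 * m + j + 2) * n := by
      have t1 : (3 / 2 : ℝ) * (n - k) + 4 * k ≤ 7 / 4 * n := by linarith
      have t2 : (m + 1 : ℝ) * (3 / 2 * (n - k) + 4 * k) ≤ (m + 1) * (7 / 4 * n) := by gcongr
      have t3 : (m + 1 : ℝ) * (7 / 4) + j ≤ θ * (2 * m + j + 2) := by nlinarith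
      have t4 := mul_le_mul_of_nonneg_right t3 hn0.le
      nlinarith
    have s4 : θ ^ k * Q * ((m + 1 : ℝ) * (3 / 2 * (n - k) + 4 * k) + j * n)
        ≤ θ ^ k * Q * (θ * (2 * m + j + 2) * n) := by gcongr
    rw [pow_succ]
    linarith
  have h3 := le_of_mul_le_mul_right hfin hn0
  rw [← hchoose, ← mul_assoc] at h3
  exact le_of_mul_le_mul_right h3 hk0

/-! ### Averages over all permutations -/

theorem exists_perm_map {A B : Finset ι} (h : #A = #B) :
    ∃ k : Perm ι, A.map k.toEmbedding = B := by
  let e := Finset.equivOfCardEq h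
  refine ⟨e.extendSubtype, Finset.eq_of_subset_of_card_le ?_ (by simp [h])⟩
  intro y hy
  rw [Finset.mem_map] at hy
  obtain ⟨x, hx, rfl⟩ := hy
  exact e.extendSubtype_mem x hx

/-- Permutations act transitively on the subsets of a given size, so the image of `A` under a random
permutation is uniform among them. -/
theorem sum_perm_map (w : Finset ι → ℝ) {A : Finset ι} :
    (Fintype.card ι).choose #A * ∑ g : Perm ι, w (A.map g.toEmbedding)
      = Fintype.card (Perm ι) * ∑ B ∈ powersetCard #A univ, w B := by
  have h1 : ∀ B ∈ powersetCard #A univ, ∑ g : Perm ι, w (B.map g.toEmbedding)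
      = ∑ g : Perm ι, w (A.map g.toEmbedding) := by
    intro B hB
    obtain ⟨k, rfl⟩ := exists_perm_map (Finset.mem_powersetCard_univ.1 hB).symm
    refine Fintype.sum_equiv (Equiv.mulRight k) _ _ fun g => ?_
    rw [Finset.map_map]; rfl
  have h2 : ∀ g : Perm ι, ∑ B ∈ powersetCard #A univ, w (B.map g.toEmbedding)
      = ∑ B ∈ powersetCard #A univ, w B := by
    intro g
    refine Finset.sum_bij' (fun B _ => B.map g.toEmbedding) (fun B _ => B.map g.symm.toEmbedding)
      ?_ ?_ ?_ ?_ ?_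
    · intro B hB; simpa using hB
    · intro B hB; simpa using hB
    · intro B _; ext; simp
    · intro B _; ext; simp
    · simp
  calc (Fintype.card ι).choose #A * ∑ g : Perm ι, w (A.map g.toEmbedding)
      = ∑ B ∈ powersetCard #A univ, ∑ g : Perm ι, w (B.map g.toEmbedding) := by
        rw [Finset.sum_congr rfl h1, Finset.sum_const, nsmul_eq_mul, Finset.card_powersetCard,
          Finset.card_univ]
    _ = _ := by
        rw [Finset.sum_comm, Finset.sum_congr rfl fun g _ => h2 g, Finset.sum_const, nsmul_eq_mul,
          Finset.card_univ]

theorem sum_perm_crossing_le {M : List (ι × ι)} (hM : PairsIn univ M) {A : Finset ι} {k : ℕ}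
    (hk : k + #A = Fintype.card ι) {θ : ℝ} (hθ1 : 1 / 2 ≤ θ) (hθ2 : θ ≤ 1)
    (h1 : 4 * (1 - θ) * Fintype.card ι ≤ M.length - k) (h2 : 16 * k ≤ Fintype.card ι + 15) :
    ∑ g : Perm ι, (3 / 4 : ℝ) ^ (crossing (A.map g.toEmbedding) M).length
      ≤ Fintype.card (Perm ι) * θ ^ k := by
  have hA : #A ≤ Fintype.card ι := Finset.card_le_univ A
  have h2M : 2 * M.length ≤ Fintype.card ι := hM.two_mul_length_le
  have hadd : 2 * M.length + (Fintype.card ι - 2 * M.length) = Fintype.card ι := by omega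
  have hka : Fintype.card ι - #A = k := by omega
  have h := sum_perm_map (fun B => (3 / 4 : ℝ) ^ (crossing B M).length) (A := A)
  rw [sum_powersetCard_crossing hM hA, hka] at h
  have hc := coeff_crossPoly_le hθ1 hθ2 k M.length (Fintype.card ι - 2 * M.length)
    (by rw [Nat.cast_sub h2M]; push_cast; convert h1 using 2; ring) (by omega)
  rw [hadd, ← Nat.choose_symm_of_eq_add (show Fintype.card ι = #A + k by omega)] at hc
  have hpos : (0 : ℝ) < (Fintype.card ι).choose #A := by exact_mod_cast Nat.choose_pos hA
  refine le_of_mul_le_mul_left ?_ hpos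
  rw [h]
  calc (Fintype.card (Perm ι) : ℝ) * _ ≤ Fintype.card (Perm ι) *
        (θ ^ k * (Fintype.card ι).choose #A) := by gcongr
    _ = _ := by ring

/-- The symmetrization of the average over a matching. -/
noncomputable def matchOp (ρ : Representation ℝ (Perm ι) E) (M : List (ι × ι)) :
    Module.End ℝ E := ∑ g : Perm ι, ρ g⁻¹ * matchAvg ρ M * ρ g

theorem matchOp_apply (M : List (ι × ι)) (x : E) :
    matchOp ρ M x = ∑ g : Perm ι, ρ g⁻¹ (matchAvg ρ M (ρ g x)) := by
  simp [matchOp, LinearMap.sum_apply]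

theorem matchOp_rho (M : List (ι × ι)) (u : Perm ι) (x : E) :
    matchOp ρ M (ρ u x) = ρ u (matchOp ρ M x) := by
  rw [matchOp_apply, matchOp_apply, map_sum]
  refine Fintype.sum_equiv (Equiv.mulRight u) _ _ fun g => ?_
  rw [Equiv.coe_mulRight, mul_inv_rev, map_mul, map_mul, Module.End.mul_apply,
    Module.End.mul_apply, ← Module.End.mul_apply (ρ u) (ρ u⁻¹), ← map_mul]
  simp

theorem matchOp_symmetric (hρ : Orthogonal ρ) {R : Finset ι} {M : List (ι × ι)}
    (hM : PairsIn R M) : (matchOp ρ M).IsSymmetric := by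
  intro x y
  rw [matchOp_apply, matchOp_apply, sum_inner, inner_sum]
  refine Finset.sum_congr rfl fun g _ => ?_
  rw [hρ.inner_rho_left, inv_inv, matchAvg_inner hρ hM, hρ.inner_rho_left]

theorem inner_matchOp (hρ : Orthogonal ρ) {R : Finset ι} {M : List (ι × ι)}
    (hM : PairsIn R M) (x : E) :
    ⟪matchOp ρ M x, x⟫_ℝ = ∑ g : Perm ι, ‖matchAvg ρ M (ρ g x)‖ ^ 2 := by
  rw [matchOp_apply, sum_inner]
  refine Finset.sum_congr rfl fun g _ => ?_
  rw [hρ.inner_rho_left, inv_inv, norm_matchAvg_sq hρ hM]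

theorem symOn_univ : symOn (univ : Finset ι) = ⊤ := by
  ext g; simp [mem_symOn]

/-- The symmetrized operator `matchOp` commutes with all permutations and preserves the layer, so
bounding its eigenvalues is enough. An eigenvector of the layer has a nonzero average over some
`Sym(A)` with `#A = a`, with the same eigenvalue, and the crossing estimate applies to that average.
-/
theorem sum_perm_matchAvg_le [FiniteDimensional ℝ E] (hρ : Orthogonal ρ) {M : List (ι × ι)}
    (hM : PairsIn univ M) {a k : ℕ} (hk : k + a = Fintype.card ι) (hlen : 3 * M.length ≤ a + 1)
    {θ : ℝ} (hθ1 : 1 / 2 ≤ θ) (hθ2 : θ ≤ 1)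
    (h1 : 4 * (1 - θ) * Fintype.card ι ≤ M.length - k) (h2 : 16 * k ≤ Fintype.card ι + 15)
    {f : E} (hf : f ∈ freeOn ρ univ (a + 1) ⊓ (freeOn ρ univ a)ᗮ) :
    ∑ g : Perm ι, ‖matchAvg ρ M (ρ g f)‖ ^ 2 ≤ Fintype.card (Perm ι) * θ ^ k * ‖f‖ ^ 2 := by
  have hall : ∀ g : Perm ι, g ∈ symOn (univ : Finset ι) := by simp [symOn_univ]
  have hsymm := matchOp_symmetric hρ hM
  have hmapsto : ∀ b, ∀ x ∈ freeOn ρ univ b, matchOp ρ M x ∈ freeOn ρ univ b := by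
    intro b x hx A hA hAb
    rw [← map_avg (matchOp ρ M) fun g _ y => matchOp_rho M g y, hx A hA hAb, map_zero]
  rw [← inner_matchOp hρ hM]
  refine inner_le_of_eigen hsymm _ ?_ ?_ hf
  · rintro x ⟨hx1, hx2⟩
    refine ⟨hmapsto _ x hx1, ?_⟩
    rw [SetLike.mem_coe, Submodule.mem_orthogonal] at hx2 ⊢
    intro u hu
    rw [← hsymm u x]
    exact hx2 _ (hmapsto _ u hu)
  · rintro c x ⟨hx1, hx2⟩ hx0 hc
    have hnot : x ∉ freeOn ρ univ a := fun hx => by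
      rw [SetLike.mem_coe, Submodule.mem_orthogonal] at hx2
      exact hx0 (inner_self_eq_zero.1 (hx2 x hx))
    rw [mem_freeOn] at hnot
    push Not at hnot
    obtain ⟨A, -, rfl, hA0⟩ := hnot
    set y := avg ρ (symOn A) x with hy
    have hcy : matchOp ρ M y = c • y := by
      rw [hy, map_avg _ fun g _ z => matchOp_rho M g z, hc, map_smul]
    have hyfree : y ∈ freeOn ρ univ (#A + 1) :=
      avg_mem_freeOn hx1 (by rw [symOn_univ]; exact le_top)
    have hbound : ∀ g : Perm ι, ‖matchAvg ρ M (ρ g y)‖ ^ 2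
        ≤ (3 / 4) ^ (crossing (A.map g.toEmbedding) M).length * ‖y‖ ^ 2 := by
      intro g
      have h3 := norm_matchAvg_sq_le_crossing hρ (A := A.map g.toEmbedding) (f := ρ g y)
        (by intro u hu; rw [hy, rho_avg_symOn]; exact rho_avg hu _)
        (by rw [Finset.card_map]; exact rho_mem_freeOn hyfree (hall g)) hM
        (by rwa [Finset.card_map])
      rwa [hρ] at h3
    have hsum := Finset.sum_le_sum fun g (_ : g ∈ (univ : Finset (Perm ι))) => hbound g
    rw [← inner_matchOp hρ hM, hcy, inner_smul_left, real_inner_self_eq_norm_sq,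
      ← Finset.sum_mul] at hsum
    have hpos : 0 < ‖y‖ ^ 2 := by positivity
    exact (le_of_mul_le_mul_right (by simpa using hsum) hpos).trans
      (sum_perm_crossing_le hM hk hθ1 hθ2 h1 h2)

end Crossing

end OnionMixing

namespace OnionMixing

/-! ### One hop: averaging over the blocks of a random coloring. -/

section Blocks

open Equiv (Perm swap)

variable {ι : Type*} [Fintype ι] [DecidableEq ι] {S : Type*}
variable {E : Type*} [NormedAddCommGroup E] [InnerProductSpace ℝ E]
variable {ρ : Representation ℝ (Perm ι) E}

/-- The permutations that preserve the coloring `β` and fix the elements with colors in `D`. -/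
def blockGroup (D : Set S) (β : ι → S) : Subgroup (Perm ι) where
  carrier := {y | ∀ i, β (y i) = β i ∧ (β i ∈ D → y i = i)}
  one_mem' := by simp
  mul_mem' := by
    intro x y hx hy i
    refine ⟨by rw [Perm.mul_apply, (hx _).1, (hy _).1], fun h => ?_⟩
    rw [Perm.mul_apply, (hy i).2 h, (hx i).2 h]
  inv_mem' := by
    intro x hx i
    have h1 := hx (x⁻¹ i)
    rw [show x (x⁻¹ i) = i by simp] at h1
    exact ⟨h1.1.symm, fun h => (h1.2 (h1.1 ▸ h)).symm⟩

theorem mem_blockGroup {D : Set S} {β : ι → S} {y : Perm ι} :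
    y ∈ blockGroup D β ↔ ∀ i, β (y i) = β i ∧ (β i ∈ D → y i = i) := Iff.rfl

theorem mem_blockGroup_comp {D : Set S} {β : ι → S} {g y : Perm ι} :
    y ∈ blockGroup D β ↔ g⁻¹ * y * g ∈ blockGroup D (β ∘ g) := by
  simp only [mem_blockGroup]
  constructor
  · intro h i
    simpa [Equiv.symm_apply_eq] using h (g i)
  · intro h i
    simpa [Equiv.symm_apply_eq] using h (g⁻¹ i)

variable [Fintype S]

/-- Greedy choice: as long as more than `Fintype.card S` letters are left, two of them share a
color. -/
theorem exists_pairsIn (D : Set S) (β : ι → S) (m : ℕ) (Z : Finset ι)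
    (hZ : Fintype.card S + 2 * m ≤ #Z) (hD : ∀ i ∈ Z, β i ∉ D) :
    ∃ M : List (ι × ι), M.length = m ∧ PairsIn Z M ∧ ∀ e ∈ M, swap e.1 e.2 ∈ blockGroup D β := by
  induction m generalizing Z with
  | zero => exact ⟨[], rfl, trivial, by simp⟩
  | succ m ih =>
    obtain ⟨x, hx, y, hy, hxy, hβ⟩ := Finset.exists_ne_map_eq_of_card_lt_of_maps_to
      (s := Z) (t := (univ : Finset S)) (f := β) (by rw [Finset.card_univ]; omega) (by simp)
    have hc := card_erase_erase (e := (x, y)) hx hy hxy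
    simp only at hc
    obtain ⟨M, hM1, hM2, hM3⟩ := ih ((Z.erase x).erase y) (by omega) fun i hi =>
      hD i (Finset.mem_of_mem_erase (Finset.mem_of_mem_erase hi))
    refine ⟨(x, y) :: M, by simp [hM1], ⟨hx, hy, hxy, hM2⟩, ?_⟩
    intro e he
    rcases List.mem_cons.1 he with rfl | he
    · intro i
      by_cases h1 : i = x
      · subst h1
        simp only [Equiv.swap_apply_left]
        exact ⟨hβ.symm, fun h => absurd h (hD _ hx)⟩
      · by_cases h2 : i = y
        · subst h2
          simp only [Equiv.swap_apply_right]
          exact ⟨hβ, fun h => absurd h (hD _ hy)⟩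
        · simp [Equiv.swap_apply_of_ne_of_ne h1 h2]
    · exact hM3 e he

open Classical in
/-- A Chernoff bound: few elements get a color outside `D` with small probability only. -/
theorem card_few_colors_le (D : Set S) {p : ℝ} (hp : p * Fintype.card S ≤ #{s : S | s ∉ D}) {z : ℕ}
    (hz : (z : ℝ) ≤ p * Fintype.card ι / 4) :
    (#{β : ι → S | #{i | β i ∉ D} < z} : ℝ)
      ≤ Fintype.card S ^ Fintype.card ι * Real.exp (-(p * Fintype.card ι / 4)) := by
  -- Markov's inequality for the product of these weights: its mean is at most `exp (-(p / 2) h)`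
  -- with `h = Fintype.card ι`, and on the bad event the product is at least `2 ^ (-z) ≥ exp (-(p h
  -- / 4))`.
  set w : S → ℝ := fun s => if s ∈ D then 1 else 1 / 2 with hw
  have hprod : ∀ β : ι → S, ∏ i, w (β i) = (1 / 2) ^ #{i | β i ∉ D} := by
    intro β
    simp only [hw]
    rw [Finset.prod_ite]
    simp
  have htot : ∑ β : ι → S, ∏ i, w (β i) = (∑ s, w s) ^ Fintype.card ι := by
    have := Finset.prod_univ_sum (fun _ : ι => (univ : Finset S)) (fun _ s => w s)
    rw [Fintype.piFinset_univ] at this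
    rw [← this, Finset.prod_const, Finset.card_univ]
  have hws : ∑ s, w s ≤ Fintype.card S * Real.exp (-(p / 2)) := by
    have h1 : ∑ s, w s = Fintype.card S - 1 / 2 * #{s : S | s ∉ D} := by
      have : ∀ s, w s = 1 - (if s ∉ D then 1 / 2 else 0) := by
        intro s; by_cases h : s ∈ D <;> simp [hw, h]; norm_num
      rw [Finset.sum_congr rfl fun s _ => this s, Finset.sum_sub_distrib, ← Finset.sum_filter]
      simp; ring
    have h2 := Real.add_one_le_exp (-(p / 2))
    have h3 : (0 : ℝ) ≤ Fintype.card S := by positivity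
    nlinarith
  have hws0 : 0 ≤ ∑ s, w s := Finset.sum_nonneg fun s _ => by
    simp only [hw]; split_ifs <;> norm_num
  have hbad : (#{β : ι → S | #{i | β i ∉ D} < z} : ℝ) * (1 / 2) ^ z
      ≤ (∑ s, w s) ^ Fintype.card ι := by
    rw [← htot, ← nsmul_eq_mul, ← Finset.sum_const]
    calc ∑ β : ι → S with #{i | β i ∉ D} < z, (1 / 2 : ℝ) ^ z
        ≤ ∑ β : ι → S with #{i | β i ∉ D} < z, ∏ i, w (β i) := by
          refine Finset.sum_le_sum fun β hβ => ?_
          rw [hprod]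
          exact pow_le_pow_of_le_one (by norm_num) (by norm_num)
            (by simpa using (Finset.mem_filter.1 hβ).2.le)
      _ ≤ _ := Finset.sum_le_univ_sum_of_nonneg fun β => by rw [hprod]; positivity
  have h2z : (2 : ℝ) ^ z ≤ Real.exp (p * Fintype.card ι / 4) := by
    calc (2 : ℝ) ^ z ≤ Real.exp 1 ^ z := by
          gcongr; linarith [Real.add_one_le_exp (1 : ℝ)]
      _ = Real.exp z := by rw [← Real.exp_nat_mul]; simp
      _ ≤ _ := Real.exp_le_exp.2 hz
  calc (#{β : ι → S | #{i | β i ∉ D} < z} : ℝ)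
      = (#{β : ι → S | #{i | β i ∉ D} < z} : ℝ) * (1 / 2) ^ z * 2 ^ z := by
        rw [mul_assoc, ← mul_pow]; norm_num
    _ ≤ (Fintype.card S * Real.exp (-(p / 2))) ^ Fintype.card ι
        * Real.exp (p * Fintype.card ι / 4) := by
        gcongr
        exact hbad.trans (by gcongr)
    _ = _ := by
        rw [mul_pow, mul_assoc, ← Real.exp_nat_mul, ← Real.exp_add]
        congr 2; ring

/-- One mixing step, given an estimate for all matchings of a fixed size. -/
theorem sum_norm_avg_blockGroup_le (hρ : Orthogonal ρ) (D : Set S) {p : ℝ}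
    (hp : p * Fintype.card S ≤ Nat.card {s : S // s ∉ D}) {m : ℕ}
    (hm : (Fintype.card S + 2 * m : ℝ) ≤ p * Fintype.card ι / 4) {f : E} {q : ℝ} (hq0 : 0 ≤ q)
    (hq : ∀ M : List (ι × ι), PairsIn univ M → M.length = m →
      ∑ g : Perm ι, ‖matchAvg ρ M (ρ g f)‖ ^ 2 ≤ Fintype.card (Perm ι) * q * ‖f‖ ^ 2) :
    ∑ β : ι → S, ‖avg ρ (blockGroup D β) f‖ ^ 2
      ≤ Fintype.card S ^ Fintype.card ι * (q + Real.exp (-(p * Fintype.card ι / 4))) * ‖f‖ ^ 2 := by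
  classical
  have hp' : p * Fintype.card S ≤ #{s : S | s ∉ D} := by
    simpa only [Nat.card_eq_fintype_card, Fintype.card_subtype] using hp
  have hcard : (0 : ℝ) < Fintype.card (Perm ι) := by exact_mod_cast Fintype.card_pos
  -- Relabelling the letters permutes the colorings, so `f` may be replaced by a random translate;
  -- this supplies the average over `g` in the matching estimates.
  have hshift : ∀ g : Perm ι, ∑ β : ι → S, ‖avg ρ (blockGroup D β) f‖ ^ 2
      = ∑ β : ι → S, ‖avg ρ (blockGroup D β) (ρ g f)‖ ^ 2 := by
    intro g
    symm
    refine Fintype.sum_equiv (Equiv.arrowCongr g.symm (Equiv.refl S)) _ _ fun β => ?_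
    have h2 : (Equiv.arrowCongr g.symm (Equiv.refl S)) β = β ∘ g := by
      ext i; simp
    rw [h2, ← rho_avg_conj (g := g) (fun y => mem_blockGroup_comp), hρ]
  set z := Fintype.card S + 2 * m with hz
  have hβ : ∀ β : ι → S, ∑ g : Perm ι, ‖avg ρ (blockGroup D β) (ρ g f)‖ ^ 2
      ≤ Fintype.card (Perm ι) * ((q + if #{i | β i ∉ D} < z then 1 else 0) * ‖f‖ ^ 2) := by
    intro β
    by_cases hbad : #{i | β i ∉ D} < z
    · rw [if_pos hbad]
      calc ∑ g : Perm ι, ‖avg ρ (blockGroup D β) (ρ g f)‖ ^ 2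
          ≤ ∑ g : Perm ι, ‖f‖ ^ 2 := by
            refine Finset.sum_le_sum fun g _ => ?_
            gcongr
            exact (hρ.norm_avg_le _ _).trans_eq (hρ g f)
        _ = Fintype.card (Perm ι) * (1 * ‖f‖ ^ 2) := by simp
        _ ≤ _ := by gcongr; linarith
    · rw [if_neg hbad, add_zero]
      obtain ⟨M, hM1, hM2, hM3⟩ := exists_pairsIn D β m {i | β i ∉ D} (by omega)
        (by intro i hi; simpa using hi)
      refine le_trans (Finset.sum_le_sum fun g _ => ?_) ((hq M (hM2.mono (by simp)) hM1).trans_eq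
        (by ring))
      rw [← avg_matchAvg hM3]
      gcongr
      exact hρ.norm_avg_le _ _
  have hfew := card_few_colors_le (ι := ι) D hp' (z := z) (by rw [hz]; push_cast; exact hm)
  refine le_of_mul_le_mul_left ?_ hcard
  calc (Fintype.card (Perm ι) : ℝ) * ∑ β : ι → S, ‖avg ρ (blockGroup D β) f‖ ^ 2
      = ∑ g : Perm ι, ∑ β : ι → S, ‖avg ρ (blockGroup D β) (ρ g f)‖ ^ 2 := by
        rw [← Finset.sum_congr rfl fun g _ => hshift g, Finset.sum_const, nsmul_eq_mul,
          Finset.card_univ]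
    _ = ∑ β : ι → S, ∑ g : Perm ι, ‖avg ρ (blockGroup D β) (ρ g f)‖ ^ 2 := Finset.sum_comm
    _ ≤ ∑ β : ι → S, Fintype.card (Perm ι) *
          ((q + if #{i | β i ∉ D} < z then 1 else 0) * ‖f‖ ^ 2) :=
        Finset.sum_le_sum fun β _ => hβ β
    _ = Fintype.card (Perm ι) * ((Fintype.card S ^ Fintype.card ι * q
          + #{β : ι → S | #{i | β i ∉ D} < z}) * ‖f‖ ^ 2) := by
        rw [← Finset.mul_sum, ← Finset.sum_mul, Finset.sum_add_distrib, Finset.sum_boole]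
        simp
    _ ≤ _ := by
        rw [mul_add (Fintype.card S ^ Fintype.card ι : ℝ)]
        gcongr

/-- One mixing step contracts the vectors of depth `k` exponentially in `k`. -/
theorem sum_norm_avg_le [FiniteDimensional ℝ E] (hρ : Orthogonal ρ) (D : Set S) {p : ℝ}
    (hp0 : 0 < p) (hp1 : p ≤ 1)
    (hp : p * Fintype.card S ≤ Nat.card {s : S // s ∉ D})
    (hS : (Fintype.card S : ℝ) ≤ p * Fintype.card ι / 8)
    (hι : 32768 ≤ p ^ 2 * Fintype.card ι)
    {k a : ℕ} (hk1 : 1 ≤ k) (hk : k + a = Fintype.card ι) {f : E}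
    (hf : f ∈ freeOn ρ univ (a + 1) ⊓ (freeOn ρ univ a)ᗮ) :
    ∑ β : ι → S, ‖avg ρ (blockGroup D β) f‖ ^ 2
      ≤ Fintype.card S ^ Fintype.card ι * Real.exp (-(p / 4096) * k) * ‖f‖ ^ 2 := by
  set h : ℝ := (Fintype.card ι : ℝ) with hh
  have hph : 32768 ≤ p * h := by nlinarith [mul_nonneg hp0.le (Nat.cast_nonneg (α := ℝ) (Fintype.card ι))]
  have hhpos : 0 < h := by
    by_contra! hc
    nlinarith
  have hkR : (k : ℝ) + a = h := by rw [hh]; exact_mod_cast hk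
  have hk0 : (1 : ℝ) ≤ k := by exact_mod_cast hk1
  have ha0 : (0 : ℝ) ≤ a := by positivity
  have hphh : p * h ≤ h := by nlinarith
  -- With at most `p * h / 8` colors, `2 * m ≤ p * h / 8` more letters fit under the Chernoff
  -- threshold `p * h / 4`.
  set m := ⌊p * h / 16⌋₊ with hm
  have hm1 : (m : ℝ) ≤ p * h / 16 := Nat.floor_le (by positivity)
  have hm2 : p * h / 32 ≤ m := by
    have := Nat.lt_floor_add_one (p * h / 16)
    rw [← hm] at this
    linarith
  have hmain : ∑ β : ι → S, ‖avg ρ (blockGroup D β) f‖ ^ 2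
      ≤ Fintype.card S ^ Fintype.card ι * (Real.exp (-(p / 2048) * k)
        + Real.exp (-(p * h / 4))) * ‖f‖ ^ 2 := by
    -- For small depth the crossing estimate is used with `m` pairs and `θ = 1 - m / (8 h)`, for
    -- which `4 (1 - θ) h = m / 2 ≤ m - k`. The sequential estimate would be too weak there, because
    -- it admits only about `k / 4` pairs.
    by_cases hkm : 2 * k ≤ m
    · refine sum_norm_avg_blockGroup_le hρ D hp (m := m) (by linarith) (Real.exp_nonneg _) ?_
      intro M hM hMm
      have hkmR : 2 * (k : ℝ) ≤ m := by exact_mod_cast hkm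
      have hmh : (m : ℝ) / (8 * h) ≤ 1 / 2 := by
        rw [div_le_iff₀ (by positivity)]; linarith
      have hm0 : 0 ≤ (m : ℝ) / (8 * h) := by positivity
      refine (sum_perm_matchAvg_le hρ hM hk ?_ (θ := 1 - m / (8 * h)) (by linarith) (by linarith)
        ?_ ?_ hf).trans ?_
      · have : 3 * (m : ℝ) ≤ a + 1 := by linarith
        rw [hMm]; exact_mod_cast this
      · rw [hMm, ← hh]
        have : 4 * (1 - (1 - (m : ℝ) / (8 * h))) * h = m / 2 := by field_simp; ring
        rw [this]; linarith
      · have : 16 * (k : ℝ) ≤ h + 15 := by linarith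
        rw [hh] at this
        exact_mod_cast this
      · gcongr
        have h1 : 1 - (m : ℝ) / (8 * h) ≤ Real.exp (-(p / 2048)) := by
          have h2 := Real.add_one_le_exp (-(p / 2048))
          have h3 : p / 2048 ≤ m / (8 * h) := by
            rw [le_div_iff₀ (by positivity)]; nlinarith
          linarith
        calc (1 - (m : ℝ) / (8 * h)) ^ k ≤ Real.exp (-(p / 2048)) ^ k :=
              pow_le_pow_left₀ (by linarith) h1 k
          _ = _ := by rw [← Real.exp_nat_mul]; ring_nf
    · push Not at hkm
      have hkmR : (m : ℝ) + 1 ≤ 2 * k := by exact_mod_cast hkm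
      -- With `γ = k / (2 h)` the sequential estimate needs `2 * m' ≤ k / 2`, which holds because `m
      -- < 2 * k`. The rate `m' / (4 h)` is at least `p / 2048`, since `2048 = 4 * 16 * 32`.
      set m' := ⌊(m : ℝ) / 8⌋₊ with hm'
      have hm'1 : (m' : ℝ) ≤ m / 8 := Nat.floor_le (by positivity)
      have hm'2 : (m : ℝ) / 16 ≤ m' := by
        have := Nat.lt_floor_add_one ((m : ℝ) / 8)
        rw [← hm'] at this
        linarith
      refine sum_norm_avg_blockGroup_le hρ D hp (m := m') (by
        have : (0 : ℝ) ≤ m := by positivity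
        linarith) (Real.exp_nonneg _) ?_
      intro M hM hMm
      have hγ : (k : ℝ) / (2 * h) ≤ 1 / 2 := by
        rw [div_le_iff₀ (by positivity)]; linarith
      have key := sum_norm_matchAvg_le hρ (γ := k / (2 * h)) (by positivity) hγ (a := a + 1) M univ
        hM ?_ ?_ f hf.1
      · have htop : Nat.card (symOn (univ : Finset ι)) = Fintype.card (Perm ι) := by
          rw [symOn_univ, Subgroup.card_top, Nat.card_eq_fintype_card]
        rw [htop] at key
        simp only [symOn_univ, Subgroup.mem_top, Finset.filter_true] at key
        refine key.trans ?_
        gcongr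
        have h1 : 1 - (k : ℝ) / (2 * h) / 2 ≤ Real.exp (-(k / (4 * h))) := by
          have h2 := Real.add_one_le_exp (-((k : ℝ) / (4 * h)))
          have h3 : (k : ℝ) / (2 * h) / 2 = k / (4 * h) := by field_simp; ring
          linarith
        calc (1 - (k : ℝ) / (2 * h) / 2) ^ M.length ≤ Real.exp (-(k / (4 * h))) ^ M.length :=
              pow_le_pow_left₀ (by linarith) h1 _
          _ = Real.exp (-(k * (m' / (4 * h)))) := by
              rw [← Real.exp_nat_mul, hMm]; congr 1; ring
          _ ≤ _ := by
              apply Real.exp_le_exp.2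
              have h3 : p / 2048 ≤ m' / (4 * h) := by
                rw [le_div_iff₀ (by positivity)]; nlinarith
              nlinarith
      · have : (a : ℝ) + 1 + 2 * m' ≤ h := by linarith
        rw [hMm, Finset.card_univ]
        rw [hh] at this
        exact_mod_cast this
      · rw [hMm, Finset.card_univ, ← hh]
        have : (k : ℝ) / (2 * h) * h = k / 2 := by field_simp
        rw [this]; push_cast; linarith
  refine hmain.trans ?_
  gcongr
  have hkh : (k : ℝ) ≤ h := by linarith
  have h1 : Real.exp (-(p * h / 4)) ≤ Real.exp (-(p / 2048) * k) * Real.exp (-(p * h / 8)) := by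
    rw [← Real.exp_add]
    apply Real.exp_le_exp.2
    nlinarith
  -- The Chernoff error is absorbed by giving up half of the rate `p / 2048`. The threshold `32768 =
  -- 8 * 4096` is what makes `4096 / p ≤ p * h / 8`.
  have h2 : Real.exp (-(p * h / 8)) ≤ p / 4096 * k := by
    rw [Real.exp_neg]
    have h3 := Real.add_one_le_exp (p * h / 8)
    have h4 : (4096 / p) ≤ Real.exp (p * h / 8) := by
      refine le_trans ?_ h3
      rw [div_le_iff₀ hp0]; nlinarith
    calc (Real.exp (p * h / 8))⁻¹ ≤ (4096 / p)⁻¹ := inv_anti₀ (by positivity) h4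
      _ = p / 4096 * 1 := by rw [inv_div, mul_one]
      _ ≤ _ := by gcongr
  have h5 : 1 + Real.exp (-(p * h / 8)) ≤ Real.exp (p / 4096 * k) :=
    le_trans (by linarith) (Real.add_one_le_exp (p / 4096 * k))
  calc Real.exp (-(p / 2048) * k) + Real.exp (-(p * h / 4))
      ≤ Real.exp (-(p / 2048) * k) * (1 + Real.exp (-(p * h / 8))) := by linarith
    _ ≤ Real.exp (-(p / 2048) * k) * Real.exp (p / 4096 * k) := by gcongr
    _ = _ := by rw [← Real.exp_add]; congr 1; ring

/-! ### Many steps -/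

/-- The successive averages over the block groups of a list of colorings. -/
noncomputable def walk (ρ : Representation ℝ (Perm ι) E) (D : Set S) (l : List (ι → S)) (f : E) :
    E := l.foldl (fun f β => avg ρ (blockGroup D β) f) f

theorem walk_cons (D : Set S) (β : ι → S) (l : List (ι → S)) (f : E) :
    walk ρ D (β :: l) f = walk ρ D l (avg ρ (blockGroup D β) f) := rfl

theorem walk_append_singleton (D : Set S) (β : ι → S) (l : List (ι → S)) (f : E) :
    walk ρ D (l ++ [β]) f = avg ρ (blockGroup D β) (walk ρ D l f) := by
  simp [walk]

theorem walk_add (D : Set S) (l : List (ι → S)) (f f' : E) :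
    walk ρ D l (f + f') = walk ρ D l f + walk ρ D l f' := by
  induction l generalizing f f' with
  | nil => rfl
  | cons β l ih => rw [walk_cons, map_add, ih]; rfl

theorem walk_mem {D : Set S} (W : Submodule ℝ E)
    (hW : ∀ β : ι → S, ∀ f ∈ W, avg ρ (blockGroup D β) f ∈ W) (l : List (ι → S)) {f : E}
    (hf : f ∈ W) : walk ρ D l f ∈ W := by
  induction l generalizing f with
  | nil => exact hf
  | cons β l ih => exact ih (hW β f hf)

theorem sum_norm_walk_le {D : Set S} (W : Submodule ℝ E)
    (hW : ∀ β : ι → S, ∀ f ∈ W, avg ρ (blockGroup D β) f ∈ W) {K : ℝ} (hK : 0 ≤ K)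
    (hstep : ∀ f ∈ W, ∑ β : ι → S, ‖avg ρ (blockGroup D β) f‖ ^ 2 ≤ K * ‖f‖ ^ 2) (L : ℕ) {f : E}
    (hf : f ∈ W) :
    ∑ b : Fin L → ι → S, ‖walk ρ D (List.ofFn b) f‖ ^ 2 ≤ K ^ L * ‖f‖ ^ 2 := by
  induction L generalizing f with
  | zero => simp [walk]
  | succ L ih =>
    rw [← Fintype.sum_equiv (Fin.consEquiv fun _ => ι → S)
      (fun x => ‖walk ρ D (List.ofFn x.2) (avg ρ (blockGroup D x.1) f)‖ ^ 2) _
      (fun x => by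
        rw [show Fin.consEquiv (fun _ => ι → S) x = Fin.cons x.1 x.2 from rfl, List.ofFn_cons,
          walk_cons]),
      Fintype.sum_prod_type]
    calc ∑ β : ι → S, ∑ b : Fin L → ι → S,
          ‖walk ρ D (List.ofFn b) (avg ρ (blockGroup D β) f)‖ ^ 2
        ≤ ∑ β : ι → S, K ^ L * ‖avg ρ (blockGroup D β) f‖ ^ 2 :=
          Finset.sum_le_sum fun β _ => ih (hW β f hf)
      _ ≤ K ^ L * (K * ‖f‖ ^ 2) := by
          rw [← Finset.mul_sum]
          exact mul_le_mul_of_nonneg_left (hstep f hf) (by positivity)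
      _ = _ := by ring

end Blocks

end OnionMixing

namespace OnionMixing

/-! ### The regular representation: dimensions and point masses. -/

section Regular

open Equiv (Perm swap)

variable {G : Type*} [Group G] [Fintype G] [DecidableEq G]

/-- The regular representation by right translations, on square-summable functions. -/
noncomputable def regular (G : Type*) [Group G] [Fintype G] :
    Representation ℝ G (EuclideanSpace ℝ G) where
  toFun g :=
    { toFun := fun f => WithLp.toLp 2 fun s => f (s * g)
      map_add' := fun _ _ => rfl
      map_smul' := fun _ _ => rfl }
  map_one' := by ext f s; simp
  map_mul' := by
    intro g h
    ext f s
    exact congrArg f (mul_assoc s g h).symm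

theorem regular_apply (g s : G) (f : EuclideanSpace ℝ G) : regular G g f s = f (s * g) := rfl

theorem regular_orthogonal : Orthogonal (regular G) := by
  intro g f
  rw [EuclideanSpace.norm_eq, EuclideanSpace.norm_eq]
  congr 1
  exact Fintype.sum_equiv (Equiv.mulRight g) _ _ fun s => rfl

theorem regular_single (g : G) :
    regular G g⁻¹ (EuclideanSpace.single 1 1) = EuclideanSpace.single g (1 : ℝ) := by
  ext s
  simp [regular_apply, mul_inv_eq_one]

/-- The components of point masses in an invariant subspace are small if its dimension is. -/
theorem card_mul_norm_starProjection_single (K : Submodule ℝ (EuclideanSpace ℝ G))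
    (hK : ∀ g, ∀ f ∈ K, regular G g f ∈ K) (s : G) :
    Fintype.card G * ‖K.starProjection (EuclideanSpace.single s 1)‖ ^ 2 = Module.finrank ℝ K := by
  have hcomm : ∀ g f, K.starProjection (regular G g f) = regular G g (K.starProjection f) := by
    intro g f
    refine Submodule.eq_starProjection_of_mem_orthogonal
      (hK g _ (Submodule.starProjection_apply_mem K f)) ?_
    rw [← map_sub, Submodule.mem_orthogonal]
    intro u hu
    have h1 := K.sub_starProjection_mem_orthogonal f
    rw [Submodule.mem_orthogonal] at h1
    rw [real_inner_comm, regular_orthogonal.inner_rho_left, real_inner_comm]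
    exact h1 _ (hK _ u hu)
  have hconst : ∀ s, ‖K.starProjection (EuclideanSpace.single s 1)‖
      = ‖K.starProjection (EuclideanSpace.single (1 : G) 1)‖ := by
    intro s
    rw [← regular_single, hcomm, regular_orthogonal]
  -- Summed over the standard basis, the squared norms of the projections give the trace of the
  -- projection, which is the dimension.
  have htr : ∑ s : G, ‖K.starProjection (EuclideanSpace.single s 1)‖ ^ 2
      = Module.finrank ℝ K := by
    have h1 : LinearMap.trace ℝ (EuclideanSpace ℝ G) (K.starProjection : _ →ₗ[ℝ] _)
        = Module.finrank ℝ K := by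
      refine LinearMap.IsProj.trace (p := K) ⟨fun x => Submodule.starProjection_apply_mem K x,
        fun x hx => ?_⟩
      exact Submodule.starProjection_eq_self_iff.2 hx
    rw [← h1, LinearMap.trace_eq_sum_inner _ (EuclideanSpace.basisFun G ℝ)]
    refine Finset.sum_congr rfl fun s _ => ?_
    rw [EuclideanSpace.basisFun_apply, ← real_inner_self_eq_norm_sq]
    exact (Submodule.inner_starProjection_left_eq_right K _ _).trans (congrArg _
      (Submodule.starProjection_eq_self_iff.2 (Submodule.starProjection_apply_mem K _)))
  rw [← htr, hconst s, Finset.sum_congr rfl fun s _ => by rw [hconst s], Finset.sum_const,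
    nsmul_eq_mul, Finset.card_univ]

variable {ι : Type*} [Fintype ι] [DecidableEq ι]

/-- The sums of a function over the permutations with prescribed values at `k` places. -/
noncomputable def tupleSums (ι : Type*) [Fintype ι] [DecidableEq ι] (k : ℕ) :
    EuclideanSpace ℝ (Perm ι) →ₗ[ℝ] ((Fin k → ι) × (Fin k → ι) → ℝ) where
  toFun f p := ∑ s : Perm ι, if s ∘ p.1 = p.2 then f s else 0
  map_add' f f' := by
    ext p
    simp only [PiLp.add_apply, Pi.add_apply, ← Finset.sum_add_distrib]
    exact Finset.sum_congr rfl fun s _ => by split_ifs <;> simp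
  map_smul' c f := by
    ext p
    simp [Finset.mul_sum]

/-- A left coset of `Sym(A)` consists of the permutations with prescribed values at the `k` letters
outside `A`, so the `Sym(A)`-averages are built from these sums. The rank of `tupleSums` then bounds
the dimension of the layers of depth at most `k`. -/
theorem ker_tupleSums_le {k a : ℕ} (hk : k + a = Fintype.card ι) :
    LinearMap.ker (tupleSums ι k) ≤ freeOn (regular (Perm ι)) univ a := by
  classical
  intro f hf A _ hA
  have hcard : #Aᶜ = k := by rw [Finset.card_compl]; omega
  set x : Fin k → ι := fun i => ((Finset.equivFinOfCardEq hcard).symm i : ι) with hx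
  have hxA : ∀ i, x i ∉ A := fun i => by
    have := ((Finset.equivFinOfCardEq hcard).symm i).2
    rwa [Finset.mem_compl] at this
  have hxsurj : ∀ j ∉ A, ∃ i, x i = j := fun j hj =>
    ⟨Finset.equivFinOfCardEq hcard ⟨j, by simpa using hj⟩, by simp [hx]⟩
  ext s
  rw [avg_apply]
  have h0 : ∑ s' : Perm ι, (if s' ∘ x = s ∘ x then f s' else 0) = 0 :=
    congrFun (LinearMap.mem_ker.1 hf) (x, s ∘ x)
  rw [← Finset.sum_filter] at h0
  have h1 : ∑ g with g ∈ symOn A, f (s * g) = 0 := by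
    rw [← h0]
    refine Finset.sum_bij' (fun g _ => s * g) (fun g _ => s⁻¹ * g) ?_ ?_ ?_ ?_ ?_
    · intro g hg
      have hg' : g ∈ symOn A := by simpa using hg
      simp only [Finset.mem_filter, Finset.mem_univ, true_and]
      ext i
      simp [hg' _ (hxA i)]
    · intro g hg
      simp only [Finset.mem_filter, Finset.mem_univ, true_and] at hg ⊢
      intro j hj
      obtain ⟨i, rfl⟩ := hxsurj j hj
      have := congrFun hg i
      simp only [Function.comp_apply] at this
      rw [Perm.mul_apply, this]; simp
    · simp
    · simp
    · simp
  simp only [PiLp.smul_apply, PiLp.zero_apply, WithLp.ofLp_sum, Finset.sum_apply, regular_apply, h1]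
  simp

theorem finrank_freeOn_orthogonal_le {k a : ℕ} (hk : k + a = Fintype.card ι) :
    Module.finrank ℝ (freeOn (regular (Perm ι)) univ a)ᗮ ≤ Fintype.card ι ^ (2 * k) := by
  have h1 := Submodule.finrank_mono (Submodule.orthogonal_le (ker_tupleSums_le (ι := ι) hk))
  have h2 := LinearMap.finrank_range_add_finrank_ker (tupleSums ι k)
  have h3 := Submodule.finrank_add_finrank_orthogonal (LinearMap.ker (tupleSums ι k))
  have h4 := Submodule.finrank_le (LinearMap.range (tupleSums ι k))
  rw [Module.finrank_pi, Fintype.card_prod, Fintype.card_fun, Fintype.card_fin, ← pow_add,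
    ← two_mul] at h4
  omega

end Regular

/-! ### Orthogonal decomposition of a walk by depth. -/

section Decomposition

open Equiv (Perm swap)

variable {ι : Type*} [Fintype ι] [DecidableEq ι] {S : Type*} [Fintype S]
variable {E : Type*} [NormedAddCommGroup E] [InnerProductSpace ℝ E] [FiniteDimensional ℝ E]
variable {ρ : Representation ℝ (Perm ι) E}

theorem freeOn_le_succ (R : Finset ι) (a : ℕ) : freeOn ρ R a ≤ freeOn ρ R (a + 1) := by
  intro f hf A hA hAa
  obtain ⟨B, hB, hBa⟩ := Finset.exists_subset_card_eq (show a ≤ #A by omega)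
  rw [← avg_avg_of_le (symOn_mono hB), hf B (hB.trans hA) hBa, map_zero]

theorem avg_mem_freeOn_orthogonal (hρ : Orthogonal ρ) {a : ℕ} (H : Subgroup (Perm ι)) {f : E}
    (hf : f ∈ (freeOn ρ univ a)ᗮ) : avg ρ H f ∈ (freeOn ρ univ a)ᗮ := by
  rw [Submodule.mem_orthogonal] at hf ⊢
  intro u hu
  rw [← hρ.inner_avg]
  exact hf _ (avg_mem_freeOn hu (by rw [symOn_univ]; exact le_top))

/-- The component of depth `#ι - a`. -/
noncomputable def layer (ρ : Representation ℝ (Perm ι) E) (a : ℕ) (f : E) : E :=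
  (freeOn ρ univ (a + 1)).starProjection f - (freeOn ρ univ a).starProjection f

theorem layer_mem (a : ℕ) (f : E) :
    layer ρ a f ∈ freeOn ρ univ (a + 1) ⊓ (freeOn ρ univ a)ᗮ := by
  refine ⟨Submodule.sub_mem _ (Submodule.starProjection_apply_mem _ f)
    (freeOn_le_succ _ _ (Submodule.starProjection_apply_mem _ f)), ?_⟩
  have h : layer ρ a f = (f - (freeOn ρ univ a).starProjection f)
      - (f - (freeOn ρ univ (a + 1)).starProjection f) := by rw [layer]; abel
  rw [SetLike.mem_coe, h]
  exact Submodule.sub_mem _ (Submodule.sub_starProjection_mem_orthogonal f)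
    (Submodule.orthogonal_le (freeOn_le_succ _ _) (Submodule.sub_starProjection_mem_orthogonal f))

theorem norm_layer_le (a : ℕ) (f : E) :
    ‖layer ρ a f‖ ≤ ‖(freeOn ρ univ a)ᗮ.starProjection f‖ := by
  have h : layer ρ a f = (freeOn ρ univ (a + 1)).starProjection
      ((freeOn ρ univ a)ᗮ.starProjection f) := by
    rw [Submodule.starProjection_orthogonal', sub_apply, map_sub, layer]
    simp only [one_apply_eq_self]
    rw [Submodule.starProjection_eq_self_iff.2
      (freeOn_le_succ _ _ (Submodule.starProjection_apply_mem _ f))]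
  rw [h]
  exact Submodule.norm_starProjection_apply_le _ _

/-- The mean square of a walk is at most the sum of the bounds of its layers. -/
theorem sum_norm_walk_le_layers (hρ : Orthogonal ρ) (D : Set S) {K : ℕ → ℝ} (hK : ∀ a, 0 ≤ K a)
    (L : ℕ) (f : E) (n : ℕ)
    (hstep : ∀ a, 1 ≤ a → a < n → ∀ f ∈ freeOn ρ univ (a + 1) ⊓ (freeOn ρ univ a)ᗮ,
      ∑ β : ι → S, ‖avg ρ (blockGroup D β) f‖ ^ 2 ≤ K a * ‖f‖ ^ 2)
    (hι : 1 ≤ Fintype.card ι) (hn : 1 ≤ n) :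
    ∑ b : Fin L → ι → S,
        ‖walk ρ D (List.ofFn b) ((freeOn ρ univ n).starProjection f)‖ ^ 2
      ≤ ∑ a ∈ Finset.Ico 1 n, K a ^ L * ‖layer ρ a f‖ ^ 2 := by
  induction n, hn using Nat.le_induction with
  | base =>
    have h0 : (freeOn ρ univ 1).starProjection f = 0 := by
      obtain ⟨A, hA, hA1⟩ := Finset.exists_subset_card_eq (show 1 ≤ #(univ : Finset ι) by
        rwa [Finset.card_univ])
      rw [← avg_symOn_of_card_le_one (ρ := ρ) hA1.le ((freeOn ρ univ 1).starProjection f)]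
      exact (Submodule.starProjection_apply_mem (freeOn ρ univ 1) f) A hA hA1
    have hw : ∀ l : List (ι → S), walk ρ D l 0 = 0 := fun l => by
      have := walk_mem (ρ := ρ) (D := D) ⊥ (by simp) l (f := (0 : E)) (by simp)
      simpa using this
    simp [h0, hw]
  | succ n hn ih =>
    have hinv : ∀ a, ∀ β : ι → S, ∀ f ∈ freeOn ρ univ a,
        avg ρ (blockGroup D β) f ∈ freeOn ρ univ a := fun a β f hf =>
      avg_mem_freeOn hf (by rw [symOn_univ]; exact le_top)
    have hsplit : (freeOn ρ univ (n + 1)).starProjection f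
        = layer ρ n f + (freeOn ρ univ n).starProjection f := by rw [layer]; abel
    -- Averages preserve both `freeOn` and its orthogonal complement, so the two parts stay
    -- orthogonal along the walk.
    have hpyth : ∀ l : List (ι → S),
        ‖walk ρ D l ((freeOn ρ univ (n + 1)).starProjection f)‖ ^ 2
        = ‖walk ρ D l (layer ρ n f)‖ ^ 2
          + ‖walk ρ D l ((freeOn ρ univ n).starProjection f)‖ ^ 2 := by
      intro l
      rw [hsplit, walk_add, sq, sq, sq]
      refine norm_add_sq_eq_norm_sq_add_norm_sq_real ?_
      have h1 := walk_mem (D := D) ((freeOn ρ univ n)ᗮ)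
        (fun β f hf => avg_mem_freeOn_orthogonal hρ (blockGroup D β) hf) l (layer_mem n f).2
      rw [Submodule.mem_orthogonal'] at h1
      exact h1 _ (walk_mem _ (hinv n) l (Submodule.starProjection_apply_mem _ f))
    simp only [hpyth]
    rw [Finset.sum_add_distrib, Finset.sum_Ico_succ_top hn, add_comm]
    refine add_le_add (ih fun a h1 h2 => hstep a h1 (by omega)) ?_
    exact sum_norm_walk_le (freeOn ρ univ (n + 1) ⊓ (freeOn ρ univ n)ᗮ) (fun β f hf => ⟨hinv _ β f hf.1,
      avg_mem_freeOn_orthogonal hρ _ hf.2⟩) (hK n) (hstep n hn (by omega)) L (layer_mem n f)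

end Decomposition

end OnionMixing

namespace OnionMixing

/-! ### Mixing of the walk on the symmetric group. -/

section Mixing

open Equiv (Perm swap)

theorem sum_Ico_pow_le {x : ℝ} (hx0 : 0 ≤ x) (hx : x ≤ 1 / 2) (n : ℕ) :
    ∑ k ∈ Finset.Ico 1 n, x ^ k ≤ 2 * x := by
  rcases Nat.eq_zero_or_pos n with rfl | hn
  · simpa using hx0
  have : ∑ k ∈ Finset.Ico 1 n, x ^ k + 2 * x ^ n ≤ 2 * x := by
    induction n, hn using Nat.le_induction with
    | base => simp
    | succ n hn ih =>
      rw [Finset.sum_Ico_succ_top hn, pow_succ]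
      have : 0 ≤ x ^ n := by positivity
      nlinarith
  have : 0 ≤ x ^ n := by positivity
  linarith

variable {ι : Type*} [Fintype ι] [DecidableEq ι] {S : Type*} [Fintype S]

/-- Mixing in mean square of the random walk on the permutations of `ι` that shuffles, in each of
`L` steps, the blocks of a random coloring. -/
theorem sum_norm_walk_single_le (D : Set S) {p : ℝ}
    (hp0 : 0 < p) (hp1 : p ≤ 1)
    (hp : p * Fintype.card S ≤ Nat.card {s : S // s ∉ D})
    (hS : (Fintype.card S : ℝ) ≤ p * Fintype.card ι / 8)
    (hι : 32768 ≤ p ^ 2 * Fintype.card ι) (L : ℕ)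
    (hL : (Fintype.card ι : ℝ) ^ 2 * Real.exp (-(p / 4096) * L) ≤ 1 / 2) (τ : Perm ι) :
    Fintype.card (Perm ι) * ∑ b : Fin L → ι → S, ‖walk (regular (Perm ι)) D (List.ofFn b)
        (EuclideanSpace.single 1 1 - EuclideanSpace.single τ 1)‖ ^ 2
      ≤ Fintype.card (Fin L → ι → S)
        * (8 * ((Fintype.card ι : ℝ) ^ 2 * Real.exp (-(p / 4096) * L))) := by
  set h := Fintype.card ι with hh
  set x := (h : ℝ) ^ 2 * Real.exp (-(p / 4096) * L) with hx
  set δ : EuclideanSpace ℝ (Perm ι) :=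
    EuclideanSpace.single 1 1 - EuclideanSpace.single τ 1 with hδ
  have hh1 : 1 ≤ h := by
    by_contra! hc
    have : h = 0 := by omega
    rw [this] at hι
    norm_num at hι
  have hfact : (0 : ℝ) < Fintype.card (Perm ι) := by exact_mod_cast Fintype.card_pos
  -- The difference of two point masses has total mass zero, so it has no component of depth 0, the
  -- only one that is not contracted.
  have hδfree : δ ∈ freeOn (regular (Perm ι)) univ h := by
    intro A _ hA
    have hAu : A = univ := (Finset.card_eq_iff_eq_univ A).1 hA
    rw [hAu, hδ, map_sub, ← regular_single τ, avg_rho (by simp [symOn_univ]), sub_self]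
  have hlayer : ∀ a, a < h → Fintype.card (Perm ι) * ‖layer (regular (Perm ι)) a δ‖ ^ 2
      ≤ 4 * (h : ℝ) ^ (2 * (h - a)) := by
    intro a ha
    set K := (freeOn (regular (Perm ι)) univ a)ᗮ with hK
    have hKinv : ∀ g, ∀ f ∈ K, regular (Perm ι) g f ∈ K := by
      intro g f hf
      rw [hK, Submodule.mem_orthogonal] at hf ⊢
      intro u hu
      rw [real_inner_comm, regular_orthogonal.inner_rho_left, real_inner_comm]
      exact hf _ (rho_mem_freeOn hu (by simp [symOn_univ]))
    have hdim : (Module.finrank ℝ K : ℝ) ≤ (h : ℝ) ^ (2 * (h - a)) := by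
      exact_mod_cast finrank_freeOn_orthogonal_le (ι := ι) (k := h - a) (a := a) (by omega)
    have h1 := card_mul_norm_starProjection_single K hKinv 1
    have h2 := card_mul_norm_starProjection_single K hKinv τ
    have h3 : ‖layer (regular (Perm ι)) a δ‖ ≤ ‖K.starProjection (EuclideanSpace.single 1 1)‖
        + ‖K.starProjection (EuclideanSpace.single τ 1)‖ := by
      refine (norm_layer_le a δ).trans ?_
      rw [hδ, map_sub]
      exact norm_sub_le _ _
    have h4 : ‖layer (regular (Perm ι)) a δ‖ ^ 2
        ≤ 2 * ‖K.starProjection (EuclideanSpace.single 1 1)‖ ^ 2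
        + 2 * ‖K.starProjection (EuclideanSpace.single τ 1)‖ ^ 2 := by
      have := pow_le_pow_left₀ (norm_nonneg _) h3 2
      nlinarith [sq_nonneg (‖K.starProjection (EuclideanSpace.single (1 : Perm ι) 1)‖
        - ‖K.starProjection (EuclideanSpace.single τ 1)‖)]
    calc (Fintype.card (Perm ι) : ℝ) * ‖layer (regular (Perm ι)) a δ‖ ^ 2
        ≤ Fintype.card (Perm ι) * (2 * ‖K.starProjection (EuclideanSpace.single 1 1)‖ ^ 2
        + 2 * ‖K.starProjection (EuclideanSpace.single τ 1)‖ ^ 2) := by gcongr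
      _ = 2 * (Module.finrank ℝ K : ℝ) + 2 * (Module.finrank ℝ K : ℝ) := by
        linear_combination 2 * h1 + 2 * h2
      _ ≤ _ := by linarith
  have hmain := sum_norm_walk_le_layers (regular_orthogonal (G := Perm ι)) D
    (K := fun a => Fintype.card S ^ h * Real.exp (-(p / 4096) * (h - a : ℕ)))
    (fun a => by positivity) L δ h
    (fun a ha1 hah f hf => sum_norm_avg_le regular_orthogonal D hp0 hp1 hp hS hι (by omega)
      (by omega) hf) hh1 hh1
  rw [Submodule.starProjection_eq_self_iff.2 hδfree] at hmain
  have hcardb : (Fintype.card (Fin L → ι → S) : ℝ) = (Fintype.card S ^ h) ^ L := by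
    simp [hh]
  calc (Fintype.card (Perm ι) : ℝ) * ∑ b : Fin L → ι → S,
        ‖walk (regular (Perm ι)) D (List.ofFn b) δ‖ ^ 2
      ≤ Fintype.card (Perm ι) * ∑ a ∈ Finset.Ico 1 h,
          (Fintype.card S ^ h * Real.exp (-(p / 4096) * (h - a : ℕ))) ^ L
            * ‖layer (regular (Perm ι)) a δ‖ ^ 2 := by gcongr
    _ = ∑ a ∈ Finset.Ico 1 h,
          (Fintype.card S ^ h * Real.exp (-(p / 4096) * (h - a : ℕ))) ^ L
            * (Fintype.card (Perm ι) * ‖layer (regular (Perm ι)) a δ‖ ^ 2) := by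
        rw [Finset.mul_sum]
        exact Finset.sum_congr rfl fun a _ => by ring
    _ ≤ ∑ a ∈ Finset.Ico 1 h,
          (Fintype.card S ^ h * Real.exp (-(p / 4096) * (h - a : ℕ))) ^ L
            * (4 * (h : ℝ) ^ (2 * (h - a))) := by
        refine Finset.sum_le_sum fun a ha => ?_
        have := hlayer a (Finset.mem_Ico.1 ha).2
        gcongr
    -- Both the dimension bound and the contraction are exponential in the depth, so each layer
    -- contributes a power of the same `x`.
    _ = ∑ a ∈ Finset.Ico 1 h, 4 * (Fintype.card S ^ h) ^ L * x ^ (h - a) := by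
        refine Finset.sum_congr rfl fun a _ => ?_
        rw [hx, mul_pow, mul_pow, ← pow_mul, ← Real.exp_nat_mul, ← Real.exp_nat_mul]
        have : (L : ℝ) * (-(p / 4096) * (h - a : ℕ)) = (h - a : ℕ) * (-(p / 4096) * L) := by ring
        rw [this]; ring
    _ = 4 * (Fintype.card S ^ h) ^ L * ∑ k ∈ Finset.Ico 1 h, x ^ k := by
        rw [← Finset.mul_sum]
        congr 1
        refine Finset.sum_bij' (fun a _ => h - a) (fun a _ => h - a) ?_ ?_ ?_ ?_ ?_
        · intro a ha; rw [Finset.mem_Ico] at ha ⊢; omega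
        · intro a ha; rw [Finset.mem_Ico] at ha ⊢; omega
        · intro a ha; rw [Finset.mem_Ico] at ha; omega
        · intro a ha; rw [Finset.mem_Ico] at ha; omega
        · intro a _; rfl
    _ ≤ 4 * (Fintype.card S ^ h) ^ L * (2 * x) := by
        gcongr
        exact sum_Ico_pow_le (by positivity) hL h
    _ = _ := by rw [hcardb]; ring

/-- Cauchy–Schwarz over the pairs `(b, s)`; the factor `Fintype.card (Perm ι)` that it costs is the
one carried by `sum_norm_walk_single_le`. -/
theorem sum_abs_walk_single_le (D : Set S) {p : ℝ}
    (hp0 : 0 < p) (hp1 : p ≤ 1)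
    (hp : p * Fintype.card S ≤ Nat.card {s : S // s ∉ D})
    (hS : (Fintype.card S : ℝ) ≤ p * Fintype.card ι / 8)
    (hι : 32768 ≤ p ^ 2 * Fintype.card ι) (L : ℕ)
    (hL : (Fintype.card ι : ℝ) ^ 2 * Real.exp (-(p / 4096) * L) ≤ 1 / 2) (τ : Perm ι) :
    ∑ b : Fin L → ι → S, ∑ s : Perm ι, |walk (regular (Perm ι)) D (List.ofFn b)
        (EuclideanSpace.single 1 1 - EuclideanSpace.single τ 1) s|
      ≤ Fintype.card (Fin L → ι → S)
        * √(8 * ((Fintype.card ι : ℝ) ^ 2 * Real.exp (-(p / 4096) * L))) := by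
  have h1 := sum_norm_walk_single_le D hp0 hp1 hp hS hι L hL τ
  set u : (Fin L → ι → S) → EuclideanSpace ℝ (Perm ι) := fun b =>
    walk (regular (Perm ι)) D (List.ofFn b)
      (EuclideanSpace.single 1 1 - EuclideanSpace.single τ 1) with hu
  set y := 8 * ((Fintype.card ι : ℝ) ^ 2 * Real.exp (-(p / 4096) * L)) with hy
  change ∑ b, ∑ s, |u b s| ≤ _
  change (Fintype.card (Perm ι) : ℝ) * ∑ b, ‖u b‖ ^ 2 ≤ _ at h1
  refine le_trans (Real.le_sqrt_of_sq_le (y := (Fintype.card (Fin L → ι → S) : ℝ) ^ 2 * y) ?_) ?_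
  · rw [← Fintype.sum_prod_type' (f := fun b s => |u b s|)]
    refine (sq_sum_le_card_mul_sum_sq).trans ?_
    rw [Fintype.sum_prod_type]
    simp only [sq_abs, Finset.card_univ, Fintype.card_prod, Nat.cast_mul]
    have h2 : ∀ b, ∑ s, u b s ^ 2 = ‖u b‖ ^ 2 := fun b => by
      rw [EuclideanSpace.norm_sq_eq]; simp
    simp only [h2]
    calc (Fintype.card (Fin L → ι → S) : ℝ) * Fintype.card (Perm ι) * ∑ b, ‖u b‖ ^ 2
        = Fintype.card (Fin L → ι → S) * (Fintype.card (Perm ι) * ∑ b, ‖u b‖ ^ 2) := by ring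
      _ ≤ Fintype.card (Fin L → ι → S) * (Fintype.card (Fin L → ι → S) * y) := by gcongr
      _ = _ := by ring
  · rw [Real.sqrt_mul (by positivity), Real.sqrt_sq (by positivity)]

end Mixing

end OnionMixing

namespace OnionMixing

open OnionRouting

/-! ### Exchanging onions at an unmonitored server. -/

section Protocol

open Equiv (Perm)

universe u

/-- The input in which user `i` has the input pair of user `π i`. -/
def permInput {M : Type u} {N : ℕ} (σ : SimpleInput M N) (π : Perm (Fin N)) : SimpleInput M N where
  msg i := σ.msg (π i)
  dest := σ.dest * π

theorem permInput_mul {M : Type u} {N : ℕ} (σ : SimpleInput M N) (π π' : Perm (Fin N)) :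
    permInput (permInput σ π) π' = permInput σ (π * π') := by
  simp [permInput, mul_assoc]

variable {P : Config}

/-- The coins in which the users exchange the remaining parts of their onions after hop `k + 1`. -/
def shift (k : Fin P.L) (π : Perm (Fin P.N)) (ω : Coins P) : Coins P :=
  (fun i j => if j ≤ k then ω.1 i j else ω.1 (π i) j,
    fun r => if (r : ℕ) ≤ k then ω.2 r else ω.2 r * π)

theorem shift_shift (k : Fin P.L) (π π' : Perm (Fin P.N)) (ω : Coins P) :
    shift k π' (shift k π ω) = shift k (π * π') ω := by
  refine Prod.ext ?_ ?_
  · funext i j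
    simp only [shift]
    split_ifs <;> rfl
  · funext r
    simp only [shift]
    split_ifs <;> simp [mul_assoc]

theorem shift_one (k : Fin P.L) (ω : Coins P) : shift k 1 ω = ω := by
  refine Prod.ext ?_ ?_
  · funext i j; simp [shift]
  · funext r; simp [shift]

/-- `shift` as a permutation of the coins. -/
def shiftEquiv (k : Fin P.L) (π : Perm (Fin P.N)) : Coins P ≃ Coins P where
  toFun := shift k π
  invFun := shift k π⁻¹
  left_inv ω := by rw [shift_shift, mul_inv_cancel, shift_one]
  right_inv ω := by rw [shift_shift, inv_mul_cancel, shift_one]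

variable {M : Type u} {σ : SimpleInput M P.N} {k : Fin P.L} {π : Perm (Fin P.N)} {ω : Coins P}

theorem hop_shift_of_le (i : Fin P.N) {q : ℕ} (hq : q ≤ k + 1) :
    hop P (permInput σ π) (shift k π ω) i q = hop P σ ω i q := by
  cases q with
  | zero => rfl
  | succ q =>
    have hqk : q ≤ k := by omega
    have hqL : q < P.L := by omega
    have : (⟨q, hqL⟩ : Fin P.L) ≤ k := hqk
    simp [hop, hqL, shift, this]

/-- At `q = k + 1` this overlaps with `hop_shift_of_le`: the exchanged onions are at the same server
then. This is what makes the exchange invisible on the links. -/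
theorem hop_shift_of_ge (hπ : ∀ i, ω.1 (π i) k = ω.1 i k) (i : Fin P.N) {q : ℕ} (hq : k + 1 ≤ q) :
    hop P (permInput σ π) (shift k π ω) i q = hop P σ ω (π i) q := by
  obtain ⟨q, rfl⟩ : ∃ q', q = q' + 1 := ⟨q - 1, by omega⟩
  have hqk : k ≤ q := by omega
  by_cases hqL : q < P.L
  · simp only [hop, hqL, shift, dif_pos]
    by_cases hle : (⟨q, hqL⟩ : Fin P.L) ≤ k
    · have : (⟨q, hqL⟩ : Fin P.L) = k := le_antisymm hle hqk
      rw [if_pos hle, this, hπ]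
    · rw [if_neg hle]
  · simp [hop, hqL, permInput]

theorem shift_snd_symm_of_le {r : Fin (P.L + 1)} (hr : (r : ℕ) ≤ k) (h : Fin P.N) :
    ((shift k π ω).2 r).symm h = (ω.2 r).symm h := by
  simp [shift, hr]

theorem shift_snd_symm_of_gt {r : Fin (P.L + 1)} (hr : (k : ℕ) < r) (h : Fin P.N) :
    ((shift k π ω).2 r).symm h = π.symm ((ω.2 r).symm h) := by
  simp only [shift, not_le.2 hr, if_false]
  rfl

theorem traffic_shift (hπ : ∀ i, ω.1 (π i) k = ω.1 i k) :
    traffic P (permInput σ π) (shift k π ω) = traffic P σ ω := by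
  funext r a b
  unfold traffic
  by_cases hr : (r : ℕ) ≤ k
  · simp only [hop_shift_of_le _ (show (r : ℕ) ≤ k + 1 by omega),
      hop_shift_of_le _ (show (r : ℕ) + 1 ≤ k + 1 by omega)]
  · simp only [hop_shift_of_ge hπ _ (show (k : ℕ) + 1 ≤ r by omega),
      hop_shift_of_ge hπ _ (show (k : ℕ) + 1 ≤ r + 1 by omega)]
    exact Finset.card_equiv π (by simp)

theorem localState_shift (hπ : ∀ i, ω.1 (π i) k = ω.1 i k) {c : Fin P.N} (hc : π c = c)
    (hfix : ∀ i, (ω.1 i k : Fin P.N) = c → π i = i) :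
    localState P (permInput σ π) (shift k π ω) c = localState P σ ω c := by
  have hpeel : (localState P (permInput σ π) (shift k π ω) c).peeled
      = (localState P σ ω c).peeled := by
    funext r h
    simp only [localState]
    rcases lt_trichotomy (r : ℕ) k with hr | hr | hr
    · rw [shift_snd_symm_of_le (by simpa using hr.le),
        hop_shift_of_le _ (show (r : ℕ) ≤ k + 1 by omega),
        hop_shift_of_le _ (show (r : ℕ) + 1 ≤ k + 1 by omega),
        hop_shift_of_le _ (show (r : ℕ) + 2 ≤ k + 1 by omega)]
      have : r < k := hr
      simp [shift, this]
    -- The exchange takes place in this round: a monitored server sees the old label and the new one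
    -- of the same onion, so its own onions must not take part.
    · have hrk : r = k := Fin.ext hr
      subst hrk
      rw [shift_snd_symm_of_le (by simp), hop_shift_of_le _ (show (r : ℕ) ≤ r + 1 by omega),
        hop_shift_of_le _ le_rfl, hop_shift_of_ge hπ _ (show (r : ℕ) + 1 ≤ r + 2 by omega)]
      split_ifs with hcond
      · have hi : π ((ω.2 r.castSucc).symm h) = (ω.2 r.castSucc).symm h := by
          apply hfix
          simpa [hop] using hcond
        rw [hi]
        simp [shift, hi]
      · rfl
    · rw [shift_snd_symm_of_gt (by simpa using hr),
        hop_shift_of_ge hπ _ (show (k : ℕ) + 1 ≤ r by omega),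
        hop_shift_of_ge hπ _ (show (k : ℕ) + 1 ≤ r + 1 by omega),
        hop_shift_of_ge hπ _ (show (k : ℕ) + 1 ≤ r + 2 by omega)]
      have : ¬ r < k := not_lt.2 (le_of_lt (Fin.lt_def.2 hr))
      simp [shift, this]
  have hrec : (localState P (permInput σ π) (shift k π ω) c).received
      = (localState P σ ω c).received := by
    funext h
    simp only [localState]
    have hkL := k.2
    rw [shift_snd_symm_of_gt (by simp), hop_shift_of_ge hπ _ (show (k : ℕ) + 1 ≤ P.L by omega),
      hop_shift_of_ge hπ _ (show (k : ℕ) + 1 ≤ P.L + 1 by omega)]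
    simp [permInput]
  have hin : (localState P (permInput σ π) (shift k π ω) c).input = (localState P σ ω c).input := by
    simp [localState, permInput, SimpleInput.input, hc]
  have hpath : (localState P (permInput σ π) (shift k π ω) c).path = (localState P σ ω c).path := by
    funext j
    simp [localState, shift, hc]
  have hformed : (localState P (permInput σ π) (shift k π ω) c).formed
      = (localState P σ ω c).formed := by
    funext r
    simp only [localState, shift]
    split_ifs <;> simp [hc]
  cases h1 : localState P (permInput σ π) (shift k π ω) c
  cases h2 : localState P σ ω c
  rw [h1, h2] at hpeel hrec hin hpath hformed
  simp only at hpeel hrec hin hpath hformed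
  subst hpeel hrec hin hpath hformed
  rfl

theorem observe_shift {C : Finset (Fin P.N)} (hπ : ∀ i, ω.1 (π i) k = ω.1 i k)
    (hC : ∀ c ∈ C, π c = c) (hfix : ∀ i, (ω.1 i k : Fin P.N) ∈ C → π i = i) :
    observe P C (permInput σ π) (shift k π ω) = observe P C σ ω := by
  unfold observe
  congr 1
  · exact traffic_shift hπ
  · funext c
    split_ifs with hc
    · rw [localState_shift hπ (hC c hc) fun i hi => hfix i (hi ▸ hc)]
    · rfl

/-- Inputs that agree on the monitored parties differ, for the adversary, by a permutation of the
other users. -/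
theorem exists_perm_observe {C : Finset (Fin P.N)} {σ₀ σ₁ : SimpleInput M P.N}
    (h : SimpleInput.AgreeOn C σ₀ σ₁) :
    ∃ τ : Perm {i // i ∉ C}, ∀ ω,
      observe P C σ₁ ω = observe P C (permInput σ₀ (Perm.ofSubtype τ)) ω := by
  -- After this permutation the destinations are those of `σ₁`. The messages may still differ, but
  -- only for unmonitored senders and recipients, where they are not observed.
  set π : Perm (Fin P.N) := σ₀.dest⁻¹ * σ₁.dest with hπ
  have hfix : ∀ c ∈ C, π c = c := by
    intro c hc
    have := congrArg Prod.snd (h c hc).1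
    simp only [SimpleInput.input] at this
    simp [hπ, ← this]
  have hmem : ∀ i, i ∉ C ↔ π i ∉ C := by
    intro i
    constructor
    · intro hi hc
      have := hfix _ hc
      rw [π.injective this] at hc
      exact hi hc
    · intro hi hc
      rw [hfix i hc] at hi
      exact hi hc
  refine ⟨π.subtypePerm (fun i => (hmem i).symm), fun ω => ?_⟩
  have hof : Perm.ofSubtype (π.subtypePerm (p := fun i => i ∉ C) (fun i => (hmem i).symm)) = π :=
    Perm.ofSubtype_subtypePerm (fun i => (hmem i).symm) fun i hi hc => hi (hfix i hc)
  rw [hof]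
  have hdest : (permInput σ₀ π).dest = σ₁.dest := by simp [permInput, hπ]
  have hhop : ∀ i q, hop P (permInput σ₀ π) ω i q = hop P σ₁ ω i q := by
    intro i q
    cases q with
    | zero => rfl
    | succ q => simp [hop, hdest]
  unfold observe
  congr 1
  · funext r a b
    simp only [traffic, hhop]
  · funext c
    split_ifs with hc
    · congr 1
      unfold localState
      simp only [hhop]
      congr 1
      · rw [← (h c hc).1]
        simp only [SimpleInput.input, permInput, Perm.mul_apply, hfix c hc]
      · funext x
        split_ifs with hx
        · have hout := (h c hc).2
          have hd : σ₁.dest ((ω.2 (Fin.last P.L)).symm x) = c := by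
            simpa [hop] using hx
          simp only [SimpleInput.output] at hout
          rw [← hd] at hout
          simp only [Equiv.symm_apply_apply] at hout
          rw [← hout]
          rfl
        · rfl
    · rfl

end Protocol

end OnionMixing

namespace OnionMixing

open OnionRouting

/-! ### From the exchange symmetry to the random walk. -/

section Mixture

open Equiv (Perm)

universe u

variable {P : Config}

/-- The servers that the unmonitored users pick as hop `k + 1`. -/
def column (C : Finset (Fin P.N)) (ω : Coins P) (k : Fin P.L) : {i // i ∉ C} → P.servers :=
  fun i => ω.1 i k

/-- The monitored servers. -/
def monitoredServers (C : Finset (Fin P.N)) : Set P.servers := {s | (s : Fin P.N) ∈ C}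

variable {C : Finset (Fin P.N)}

theorem column_shift {j k : Fin P.L} (hj : j ≤ k) (π : Perm (Fin P.N)) (ω : Coins P) :
    column C (shift k π ω) j = column C ω j := by
  funext i
  simp [column, shift, hj]

theorem observe_ofSubtype_shift {M : Type u} (σ : SimpleInput M P.N) {k : Fin P.L} {ω : Coins P}
    {y : Perm {i // i ∉ C}} (hy : y ∈ blockGroup (monitoredServers C) (column C ω k))
    (τ : Perm {i // i ∉ C}) :
    observe P C (permInput σ (Perm.ofSubtype (τ * y))) (shift k (Perm.ofSubtype y) ω)
      = observe P C (permInput σ (Perm.ofSubtype τ)) ω := by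
  rw [map_mul, ← permInput_mul]
  refine observe_shift ?_ ?_ ?_
  · intro i
    by_cases hi : i ∈ C
    · rw [Perm.ofSubtype_apply_of_not_mem y (by simpa using hi)]
    · rw [Perm.ofSubtype_apply_of_mem y hi]
      exact (hy ⟨i, hi⟩).1
  · intro c hc
    exact Perm.ofSubtype_apply_of_not_mem y (by simpa using hc)
  · intro i hiC
    by_cases hi : i ∈ C
    · exact Perm.ofSubtype_apply_of_not_mem y (by simpa using hi)
    · rw [Perm.ofSubtype_apply_of_mem y hi, (hy ⟨i, hi⟩).2 hiC]

/-- Averaging over the block group of a column does not change the mixture of a function that is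
invariant under the exchanges of users at that hop. -/
theorem sum_avg_mul {k : Fin P.L} {Φ : Perm {i // i ∉ C} → Coins P → ℝ}
    (hΦ : ∀ ω, ∀ y ∈ blockGroup (monitoredServers C) (column C ω k), ∀ s,
      Φ (s * y) (shift k (Perm.ofSubtype y) ω) = Φ s ω)
    {w : Coins P → EuclideanSpace ℝ (Perm {i // i ∉ C})}
    (hw : ∀ ω π, w (shift k π ω) = w ω) :
    ∑ ω, ∑ s, avg (regular _) (blockGroup (monitoredServers C) (column C ω k)) (w ω) s * Φ s ω
      = ∑ ω, ∑ s, w ω s * Φ s ω := by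
  classical
  set H : Coins P → Subgroup (Perm {i // i ∉ C}) := fun ω =>
    blockGroup (monitoredServers C) (column C ω k) with hH
  have hHs : ∀ ω π, H (shift k π ω) = H ω := fun ω π => by
    simp only [hH, column_shift le_rfl]
  set g : Coins P → ℝ := fun ω => ∑ s, w ω s * Φ s ω with hg
  -- For `y` in the block group, the right translation by `y` is traded for the exchange of coins,
  -- by invariance of `Φ`. The exchange is a bijection of the coins that keeps column `k` and the
  -- weight `w`, so it disappears in the sum over `ω`.
  have hstep : ∀ ω, ∀ y ∈ H ω, ∑ s, w ω (s * y) * Φ s ω = g (shift k (Perm.ofSubtype y) ω) := by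
    intro ω y hy
    refine Fintype.sum_equiv (Equiv.mulRight y) _ _ fun s => ?_
    rw [Equiv.coe_mulRight, hw, hΦ ω y hy]
  have hexp : ∀ ω, ∑ s, avg (regular _) (H ω) (w ω) s * Φ s ω
      = ∑ y, if y ∈ H ω then (Nat.card (H ω) : ℝ)⁻¹ * g (shift k (Perm.ofSubtype y) ω) else 0 := by
    intro ω
    have h1 : ∀ s, avg (regular _) (H ω) (w ω) s
        = (Nat.card (H ω) : ℝ)⁻¹ * ∑ y with y ∈ H ω, w ω (s * y) := by
      intro s
      rw [avg_apply, PiLp.smul_apply, smul_eq_mul, WithLp.ofLp_sum, Finset.sum_apply]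
      rfl
    simp_rw [h1, mul_assoc, Finset.sum_mul]
    rw [← Finset.mul_sum, Finset.sum_comm, Finset.mul_sum, Finset.sum_filter]
    refine Finset.sum_congr rfl fun y _ => ?_
    split_ifs with hy
    · rw [hstep ω y hy]
    · rfl
  calc ∑ ω, ∑ s, avg (regular _) (H ω) (w ω) s * Φ s ω
      = ∑ y, ∑ ω, if y ∈ H ω then (Nat.card (H ω) : ℝ)⁻¹ * g (shift k (Perm.ofSubtype y) ω)
          else 0 := by
        rw [Finset.sum_congr rfl fun ω _ => hexp ω, Finset.sum_comm]
    _ = ∑ y, ∑ ω, if y ∈ H ω then (Nat.card (H ω) : ℝ)⁻¹ * g ω else 0 := by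
        refine Finset.sum_congr rfl fun y _ => ?_
        refine Fintype.sum_equiv (shiftEquiv k (Perm.ofSubtype y)) _ _ fun ω => ?_
        change _ = if y ∈ H (shift k (Perm.ofSubtype y) ω) then
          (Nat.card (H (shift k (Perm.ofSubtype y) ω)) : ℝ)⁻¹ * g (shift k (Perm.ofSubtype y) ω)
          else 0
        rw [hHs]
    _ = ∑ ω, g ω := by
        rw [Finset.sum_comm]
        refine Finset.sum_congr rfl fun ω _ => ?_
        rw [← Finset.sum_filter, Finset.sum_const, card_filter_mem, nsmul_eq_mul,
          mul_inv_cancel_left₀ (natCard_ne_zero _)]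

/-- The hops are added in increasing order: the weight produced by the first `n` columns is
unchanged by an exchange after hop `n + 1`, as `sum_avg_mul` requires. -/
theorem sum_walk_mul {Φ : Perm {i // i ∉ C} → Coins P → ℝ}
    (hΦ : ∀ k ω, ∀ y ∈ blockGroup (monitoredServers C) (column C ω k), ∀ s,
      Φ (s * y) (shift k (Perm.ofSubtype y) ω) = Φ s ω)
    (f : EuclideanSpace ℝ (Perm {i // i ∉ C})) :
    ∑ ω, ∑ s, walk (regular _) (monitoredServers C) (List.ofFn (column C ω)) f s * Φ s ω
      = ∑ ω, ∑ s, f s * Φ s ω := by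
  have key : ∀ n, n ≤ P.L → ∑ ω, ∑ s, walk (regular _) (monitoredServers C)
      ((List.ofFn (column C ω)).take n) f s * Φ s ω = ∑ ω, ∑ s, f s * Φ s ω := by
    intro n
    induction n with
    | zero => intro _; rfl
    | succ n ih =>
      intro hn
      rw [← ih (by omega), ← sum_avg_mul (k := ⟨n, hn⟩) (hΦ _)
        (w := fun ω => walk (regular _) (monitoredServers C) ((List.ofFn (column C ω)).take n) f)]
      · refine Finset.sum_congr rfl fun ω _ => Finset.sum_congr rfl fun s _ => ?_
        have htake : (List.ofFn (column C ω)).take (n + 1)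
            = (List.ofFn (column C ω)).take n ++ [column C ω ⟨n, hn⟩] := by
          rw [← List.take_append_getElem (by simpa using hn)]
          simp
        rw [htake, walk_append_singleton]
      · intro ω π
        congr 1
        refine List.ext_getElem (by simp) fun i h1 h2 => ?_
        simp only [List.getElem_take, List.getElem_ofFn]
        refine column_shift ?_ π ω
        simp only [List.length_take, List.length_ofFn, lt_inf_iff] at h1
        exact h1.1.le
  rw [← key P.L le_rfl]
  refine Finset.sum_congr rfl fun ω _ => ?_
  rw [List.take_of_length_le (by simp)]

/-- Used to see that the columns of the unmonitored users are uniformly distributed under uniform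
coins. -/
theorem sum_comp_fst_equiv {X B R : Type*} [Fintype X] [Fintype B] [Fintype R] (e : X ≃ B × R)
    (φ : B → ℝ) :
    (∑ x, φ (e x).1) * Fintype.card B = Fintype.card X * ∑ b, φ b := by
  rw [Fintype.card_congr e, Fintype.card_prod, Fintype.sum_equiv e _ (fun z => φ z.1) fun _ => rfl,
    Fintype.sum_prod_type]
  simp only [Finset.sum_const, Finset.card_univ, nsmul_eq_mul, ← Finset.mul_sum]
  push_cast
  ring

/-- The coins, with the columns of the unmonitored users split off. -/
def columnEquiv (C : Finset (Fin P.N)) :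
    Coins P ≃ (Fin P.L → {i // i ∉ C} → P.servers) ×
      (({i // ¬ i ∉ C} → Fin P.L → P.servers) × (Fin (P.L + 1) → Perm (Fin P.N))) :=
  ((((Equiv.piEquivPiSubtypeProd (fun i => i ∉ C) fun _ => Fin P.L → P.servers).trans
    ((Equiv.piComm _).prodCongr (Equiv.refl _))).prodCongr (Equiv.refl _))).trans
    (Equiv.prodAssoc _ _ _)

theorem sum_column (φ : (Fin P.L → {i // i ∉ C} → P.servers) → ℝ) :
    (∑ ω, φ (column C ω)) * Fintype.card (Fin P.L → {i // i ∉ C} → P.servers)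
      = Fintype.card (Coins P) * ∑ b, φ b :=
  sum_comp_fst_equiv (columnEquiv C) φ

-- Each count is the sum over the coins of an indicator at the permutation `1` or `τ`. Their
-- difference is integrated against the walk instead of `δ₁ - δ_τ`, and every pair `(s, ω)` yields
-- only one observable. Finite sets `T` suffice, as they bound the infinite sum in `statDist`.
open Classical in
theorem sum_abs_observe_sub_le {M : Type u} (σ : SimpleInput M P.N) (τ : Perm {i // i ∉ C})
    (T : Finset (Observables M P)) :
    ∑ V ∈ T, |(#{ω | observe P C σ ω = V} : ℝ)
        - #{ω | observe P C (permInput σ (Perm.ofSubtype τ)) ω = V}|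
      ≤ ∑ ω, ∑ s, |walk (regular _) (monitoredServers C) (List.ofFn (column C ω))
        (EuclideanSpace.single 1 1 - EuclideanSpace.single τ 1) s| := by
  set Φ : Observables M P → Perm {i // i ∉ C} → Coins P → ℝ := fun V s ω =>
    if observe P C (permInput σ (Perm.ofSubtype s)) ω = V then 1 else 0 with hΦ
  set u : Coins P → EuclideanSpace ℝ (Perm {i // i ∉ C}) := fun ω =>
    walk (regular _) (monitoredServers C) (List.ofFn (column C ω))
        (EuclideanSpace.single 1 1 - EuclideanSpace.single τ 1) with hu
  have hΦ0 : ∀ V s ω, 0 ≤ Φ V s ω := fun V s ω => by simp only [hΦ]; split_ifs <;> norm_num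
  have h1 : ∀ V, (#{ω | observe P C σ ω = V} : ℝ)
        - #{ω | observe P C (permInput σ (Perm.ofSubtype τ)) ω = V}
      = ∑ ω, ∑ s, u ω s * Φ V s ω := by
    intro V
    rw [sum_walk_mul (Φ := Φ V) fun k ω y hy s => by
      simp only [hΦ, observe_ofSubtype_shift σ hy]]
    have hp1 : permInput σ (Perm.ofSubtype (1 : Perm {i // i ∉ C})) = σ := by
      simp [permInput]
    simp only [PiLp.sub_apply, sub_mul, Finset.sum_sub_distrib, PiLp.single_apply,
      ite_mul, one_mul, zero_mul, Finset.sum_ite_eq', Finset.mem_univ, if_true]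
    simp only [hΦ, hp1, Finset.sum_boole]
  have h2 : ∀ s ω, ∑ V ∈ T, Φ V s ω ≤ 1 := by
    intro s ω
    simp only [hΦ, Finset.sum_ite_eq]
    split_ifs <;> norm_num
  calc _ ≤ ∑ V ∈ T, ∑ ω, ∑ s, |u ω s| * Φ V s ω := by
        refine Finset.sum_le_sum fun V _ => ?_
        rw [h1]
        refine (Finset.abs_sum_le_sum_abs _ _).trans (Finset.sum_le_sum fun ω _ => ?_)
        refine (Finset.abs_sum_le_sum_abs _ _).trans (Finset.sum_le_sum fun s _ => ?_)
        rw [abs_mul, abs_of_nonneg (hΦ0 V s ω)]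
    _ = ∑ ω, ∑ s, |u ω s| * ∑ V ∈ T, Φ V s ω := by
        rw [Finset.sum_comm]
        refine Finset.sum_congr rfl fun ω _ => ?_
        rw [Finset.sum_comm]
        exact Finset.sum_congr rfl fun s _ => by rw [Finset.mul_sum]
    _ ≤ ∑ ω, ∑ s, |u ω s| := by
        refine Finset.sum_le_sum fun ω _ => Finset.sum_le_sum fun s _ => ?_
        exact mul_le_of_le_one_right (abs_nonneg _) (h2 s ω)

open Classical in
/-- The distributions of the observables for two inputs that agree on the monitored parties are
close. -/
theorem sum_abs_observe_sub_le_of_agreeOn {M : Type u} {σ₀ σ₁ : SimpleInput M P.N}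
    (hσ : SimpleInput.AgreeOn C σ₀ σ₁) {p : ℝ} (hp0 : 0 < p) (hp1 : p ≤ 1)
    (hC : (#(C ∩ P.servers) : ℝ) ≤ (1 - p) * #P.servers)
    (hS : (#P.servers : ℝ) ≤ p * (P.N - #C : ℝ) / 8)
    (hι : 32768 ≤ p ^ 2 * (P.N - #C : ℝ))
    (hL : (P.N : ℝ) ^ 2 * Real.exp (-(p / 4096) * P.L) ≤ 1 / 2)
    (T : Finset (Observables M P)) :
    ∑ V ∈ T, |(#{ω | observe P C σ₀ ω = V} : ℝ) - #{ω | observe P C σ₁ ω = V}|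
      ≤ Fintype.card (Coins P) * √(8 * ((P.N : ℝ) ^ 2 * Real.exp (-(p / 4096) * P.L))) := by
  obtain ⟨τ, hτ⟩ := exists_perm_observe hσ
  have hcard : (Fintype.card {i // i ∉ C} : ℝ) = P.N - #C := by
    rw [Fintype.card_subtype_compl, Fintype.card_fin, Fintype.card_coe, Nat.cast_sub]
    simpa using Finset.card_le_univ C
  have hcardS : (Fintype.card P.servers : ℝ) = #P.servers := by simp
  have hle : (Fintype.card {i // i ∉ C} : ℝ) ^ 2 * Real.exp (-(p / 4096) * P.L)
      ≤ (P.N : ℝ) ^ 2 * Real.exp (-(p / 4096) * P.L) := by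
    have : (Fintype.card {i // i ∉ C} : ℝ) ≤ P.N := by rw [hcard]; simp
    gcongr
  have hgood : p * Fintype.card P.servers
      ≤ Nat.card {s : P.servers // s ∉ monitoredServers C} := by
    have h1 : Nat.card {s : P.servers // s ∉ monitoredServers C} = #(P.servers \ C) := by
      rw [← Nat.card_eq_finsetCard]
      refine Nat.card_congr
        ⟨fun s => ⟨s.1, Finset.mem_sdiff.2 ⟨s.1.2, s.2⟩⟩,
        fun s => ⟨⟨s.1, (Finset.mem_sdiff.1 s.2).1⟩, (Finset.mem_sdiff.1 s.2).2⟩,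
        fun _ => rfl, fun _ => rfl⟩
    have h2 : (#(P.servers \ C) : ℝ) + #(C ∩ P.servers) = #P.servers := by
      rw [Finset.inter_comm]
      exact_mod_cast Finset.card_sdiff_add_card_inter P.servers C
    rw [h1, hcardS]
    linarith
  have hmix := sum_abs_walk_single_le (monitoredServers C) hp0 hp1 hgood
    (by rw [hcard, hcardS]; exact hS) (by rw [hcard]; exact hι) P.L (hle.trans hL) τ
  have hpush := sum_column (C := C) (P := P) fun b => ∑ s : Perm {i // i ∉ C},
    |walk (regular (Perm {i // i ∉ C})) (monitoredServers C) (List.ofFn b)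
      (EuclideanSpace.single 1 1 - EuclideanSpace.single τ 1) s|
  have hpos : (0 : ℝ) < Fintype.card (Fin P.L → {i // i ∉ C} → P.servers) := by
    exact_mod_cast Fintype.card_pos
  simp only [hτ]
  refine (sum_abs_observe_sub_le σ₀ τ T).trans ?_
  refine le_of_mul_le_mul_right (hpush.trans_le ?_) hpos
  calc _ ≤ (Fintype.card (Coins P) : ℝ) * _ := mul_le_mul_of_nonneg_left hmix (by positivity)
    _ ≤ (Fintype.card (Coins P) : ℝ) * (Fintype.card (Fin P.L → {i // i ∉ C} → P.servers)
        * √(8 * ((P.N : ℝ) ^ 2 * Real.exp (-(p / 4096) * P.L)))) := by gcongr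
    _ = _ := by ring

end Mixture

end OnionMixing

namespace OnionMixing

open OnionRouting

/-! ### Views, statistical distance and asymptotics. -/

section Privacy

universe u

open Classical in
theorem view_apply {P : Config} {M : Type u} (A : Adversary P) (σ : SimpleInput M P.N)
    (ρ : A.Rand) (V : Observables M P) :
    (view P A σ (ρ, V)).toReal
      = (A.law ρ).toReal
        * (#{ω | observe P (A.monitored ρ) σ ω = V} / Fintype.card (Coins P)) := by
  have h1 : ∀ ρ', ((PMF.uniformOfFintype (Coins P)).map
      fun ω => (ρ', observe P (A.monitored ρ') σ ω)) (ρ, V)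
      = if ρ' = ρ then (#{ω | observe P (A.monitored ρ) σ ω = V} : ENNReal)
        * (Fintype.card (Coins P) : ENNReal)⁻¹ else 0 := by
    intro ρ'
    rw [PMF.map_apply, tsum_fintype]
    split_ifs with h
    · subst h
      simp only [Prod.mk.injEq, true_and, PMF.uniformOfFintype_apply]
      rw [← Finset.sum_filter, Finset.sum_const, nsmul_eq_mul]
      simp only [eq_comm]
    · refine Finset.sum_eq_zero fun ω _ => if_neg fun hc => h (Prod.ext_iff.1 hc).1.symm
  rw [view, PMF.bind_apply, tsum_eq_single ρ fun ρ' hρ' => by rw [h1, if_neg hρ', mul_zero],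
    h1, if_pos rfl]
  simp [div_eq_mul_inv]

theorem sum_toReal_le_one {α : Type*} (p : PMF α) (s : Finset α) : ∑ a ∈ s, (p a).toReal ≤ 1 := by
  rw [← ENNReal.toReal_sum fun a _ => p.apply_ne_top a]
  refine ENNReal.toReal_le_of_le_ofReal zero_le_one ?_
  rw [ENNReal.ofReal_one, ← p.tsum_coe]
  exact ENNReal.sum_le_tsum s

open Classical in
theorem statDist_view_le {P : Config} {M : Type u} (A : Adversary P) (σ₀ σ₁ : SimpleInput M P.N)
    {ε : ℝ} (hε : 0 ≤ ε)
    (h : ∀ ρ ∈ A.law.support, ∀ T : Finset (Observables M P),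
      ∑ V ∈ T, |(#{ω | observe P (A.monitored ρ) σ₀ ω = V} : ℝ)
        - #{ω | observe P (A.monitored ρ) σ₁ ω = V}| ≤ Fintype.card (Coins P) * ε) :
    statDist (view P A σ₀) (view P A σ₁) ≤ 1 / 2 * ε := by
  unfold statDist
  refine mul_le_mul_of_nonneg_left (Real.tsum_le_of_sum_le (fun _ => abs_nonneg _) fun F => ?_)
    (by norm_num)
  have hc : (0 : ℝ) < Fintype.card (Coins P) := by exact_mod_cast Fintype.card_pos
  refine (Finset.sum_le_sum_of_subset_of_nonneg (Finset.subset_product (s := F))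
    fun _ _ _ => abs_nonneg _).trans ?_
  rw [Finset.sum_product]
  calc _ ≤ ∑ ρ ∈ F.image Prod.fst, (A.law ρ).toReal * ε := by
        refine Finset.sum_le_sum fun ρ _ => ?_
        by_cases hρ : ρ ∈ A.law.support
        · have h2 : ∀ V, |(view P A σ₀ (ρ, V)).toReal - (view P A σ₁ (ρ, V)).toReal|
              = (A.law ρ).toReal * (|(#{ω | observe P (A.monitored ρ) σ₀ ω = V} : ℝ)
                - #{ω | observe P (A.monitored ρ) σ₁ ω = V}| / Fintype.card (Coins P)) := by
            intro V
            rw [view_apply, view_apply, ← mul_sub, ← sub_div, abs_mul, abs_div,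
              abs_of_nonneg ENNReal.toReal_nonneg, abs_of_pos hc]
          simp only [h2]
          rw [← Finset.mul_sum, ← Finset.sum_div]
          refine mul_le_mul_of_nonneg_left ?_ ENNReal.toReal_nonneg
          rw [div_le_iff₀ hc, mul_comm ε]
          exact h ρ hρ _
        · have h0 : A.law ρ = 0 := by simpa [PMF.mem_support_iff] using hρ
          simp [view_apply, h0]
    _ ≤ 1 * ε := by
        rw [← Finset.sum_mul]
        exact mul_le_mul_of_nonneg_right (sum_toReal_le_one _ _) hε
    _ = ε := one_mul ε

theorem statDist_view_le_of_mem_passiveAdversaries {P : Config} {M : Type u} {κ : ℝ} (hκ0 : 0 ≤ κ)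
    (hκ1 : κ < 1) {A : Adversary P} (hA : A ∈ passiveAdversaries κ P) {σ₀ σ₁ : SimpleInput M P.N}
    (hσ : ∀ ρ ∈ A.law.support, SimpleInput.AgreeOn (A.monitored ρ) σ₀ σ₁)
    (hload : 32768 / (1 - κ) ^ 3 ≤ (P.N : ℝ) / #P.servers)
    (hL : (P.N : ℝ) ^ 2 * Real.exp (-((1 - κ) / 4096) * P.L) ≤ 1 / 2) :
    statDist (view P A σ₀) (view P A σ₁)
      ≤ 1 / 2 * √(8 * ((P.N : ℝ) ^ 2 * Real.exp (-((1 - κ) / 4096) * P.L))) := by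
  classical
  set p := 1 - κ with hp
  have hp0 : 0 < p := by linarith
  have hp1 : p ≤ 1 := by linarith
  have hn : (1 : ℝ) ≤ #P.servers := by exact_mod_cast P.servers_nonempty.card_pos
  have hload' : 32768 * #P.servers ≤ p ^ 3 * P.N := by
    rw [div_le_div_iff₀ (by positivity) (by linarith)] at hload
    linarith
  refine statDist_view_le A σ₀ σ₁ (Real.sqrt_nonneg _) fun ρ hρ T => ?_
  obtain ⟨h1, h2⟩ := hA ρ hρ
  -- At least a fraction `p` of the users is unmonitored. This costs one factor `p`, which is why
  -- the load threshold has `p ^ 3` where the mixing estimate has `p ^ 2`.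
  have h3 : p * P.N ≤ P.N - #(A.monitored ρ) := by rw [hp]; linarith
  refine sum_abs_observe_sub_le_of_agreeOn (hσ ρ hρ) hp0 hp1 (by rw [hp]; linarith) ?_ ?_ hL T
  · have h4 : p * (p * P.N) ≤ p * (P.N - #(A.monitored ρ)) := by gcongr
    have h5 : p ^ 3 * P.N ≤ p ^ 2 * P.N :=
      mul_le_mul_of_nonneg_right (pow_le_pow_of_le_one hp0.le hp1 (by norm_num)) (by positivity)
    linarith
  · have h4 : p ^ 2 * (p * P.N) ≤ p ^ 2 * (P.N - #(A.monitored ρ)) := by gcongr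
    linarith

theorem tendsto_logb_natCast_atTop : Tendsto (fun k : ℕ => Real.logb 2 k) atTop atTop :=
  (Real.tendsto_logb_atTop (by norm_num)).comp tendsto_natCast_atTop_atTop

/-- `exp (-c log² k)` decays faster than every polynomial grows. -/
theorem tendsto_eval_mul_exp_neg_logb_sq (R : Polynomial ℝ) {c : ℝ} (hc : 0 < c) :
    Tendsto (fun k : ℕ => R.eval (k : ℝ) * Real.exp (-(c * Real.logb 2 k ^ 2))) atTop (nhds 0) := by
  have h1 : (fun k : ℕ => R.eval (k : ℝ)) =O[atTop] fun k : ℕ => (k : ℝ) ^ R.natDegree := by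
    have := Polynomial.isBigO_atTop_of_degree_le R (Polynomial.X ^ R.natDegree : Polynomial ℝ)
      (by rw [Polynomial.degree_X_pow]; exact Polynomial.degree_le_natDegree)
    simpa [Function.comp_def] using this.comp_tendsto tendsto_natCast_atTop_atTop
  refine (h1.mul (isBigO_refl _ _)).trans_tendsto ?_
  have hlog2 : 0 < Real.log 2 := Real.log_pos (by norm_num)
  set d : ℝ := R.natDegree * Real.log 2 with hd
  -- With `x = logb 2 k`, a power of `k` times the exponential is `exp (x * (d - c * x))`.
  have h2 : Tendsto (fun x : ℝ => x * (d - c * x)) atTop atBot := by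
    refine tendsto_id.atTop_mul_atBot₀ ?_
    exact tendsto_const_nhds.add_atBot (tendsto_neg_atTop_atBot.comp
      (tendsto_id.const_mul_atTop hc))
  refine ((Real.tendsto_exp_atBot.comp h2).comp tendsto_logb_natCast_atTop).congr' ?_
  filter_upwards [eventually_gt_atTop 0] with k hk
  have hk' : (0 : ℝ) < k := by exact_mod_cast hk
  have hpow : (k : ℝ) ^ R.natDegree = Real.exp (R.natDegree * Real.log k) := by
    rw [Real.exp_nat_mul, Real.exp_log hk']
  have hlogb : Real.log 2 * Real.logb 2 k = Real.log k := by
    rw [Real.logb, mul_div_cancel₀ _ hlog2.ne']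
  simp only [Function.comp_apply]
  rw [hpow, ← Real.exp_add, ← hlogb, hd]
  congr 1
  ring

end Privacy

end OnionMixing

theorem mainTheorem2 (κ : ℝ) (hκ0 : 0 ≤ κ) (hκ1 : κ < 1)
    (P : ℕ → OnionRouting.Config) (M : ℕ → Type*)
    (hpoly : ∃ p : Polynomial ℕ, ∀ k : ℕ, (P k).N ≤ p.eval k)
    (hload : (fun k : ℕ => Real.logb 2 k ^ 2) =O[atTop]
      fun k => ((P k).N : ℝ) / ((P k).servers.card : ℝ))
    (hhops : (fun k : ℕ => Real.logb 2 k ^ 2) =O[atTop] fun k => ((P k).L : ℝ)) :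
    OnionRouting.StatisticallyPrivate P M (OnionRouting.passiveAdversaries κ) := by
  intro A hA σ₀ σ₁ hσ Q hQ
  obtain ⟨q, hq⟩ := hpoly
  obtain ⟨C₁, hC₁, hload⟩ := hload.exists_pos
  obtain ⟨C₂, hC₂, hhops⟩ := hhops.exists_pos
  have hp0 : 0 < 1 - κ := by linarith
  set c := (1 - κ) / 4096 / C₂ with hc
  have hc0 : 0 < c := by positivity
  set q' : Polynomial ℝ := q.map (Nat.castRingHom ℝ) with hq'
  have hlim1 := OnionMixing.tendsto_eval_mul_exp_neg_logb_sq (q' ^ 2) hc0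
  have hlim2 := OnionMixing.tendsto_eval_mul_exp_neg_logb_sq (2 * q' ^ 2 * Q ^ 2) hc0
  -- The load only has to pass a constant threshold; the decay comes from the number of hops.
  have hlarge : ∀ᶠ k : ℕ in atTop, C₁ * (32768 / (1 - κ) ^ 3) ≤ Real.logb 2 k ^ 2 :=
    ((tendsto_pow_atTop two_ne_zero).comp
      OnionMixing.tendsto_logb_natCast_atTop).eventually_ge_atTop _
  filter_upwards [hQ, hload.bound, hhops.bound, hlarge, hlim1.eventually_le_const one_half_pos,
    hlim2.eventually_lt_const one_pos] with k hQk hloadk hhopsk hlargek h1 h2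
  have hN : ((P k).N : ℝ) ≤ q'.eval (k : ℝ) := by
    rw [hq', Polynomial.eval_natCast_map, eq_natCast]
    exact_mod_cast hq k
  have hexp : Real.exp (-((1 - κ) / 4096) * (P k).L) ≤ Real.exp (-(c * Real.logb 2 k ^ 2)) := by
    rw [Real.exp_le_exp]
    rw [Real.norm_of_nonneg (by positivity), Real.norm_of_nonneg (by positivity)] at hhopsk
    have : c * Real.logb 2 k ^ 2 ≤ c * (C₂ * (P k).L) := by gcongr
    have hcC : c * (C₂ * (P k).L) = (1 - κ) / 4096 * (P k).L := by
      rw [hc]; field_simp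
    linarith
  have hx : ((P k).N : ℝ) ^ 2 * Real.exp (-((1 - κ) / 4096) * (P k).L)
      ≤ (q' ^ 2).eval (k : ℝ) * Real.exp (-(c * Real.logb 2 k ^ 2)) := by
    rw [Polynomial.eval_pow]
    gcongr
  rw [Real.norm_of_nonneg (by positivity), Real.norm_of_nonneg (by positivity)] at hloadk
  refine (OnionMixing.statDist_view_le_of_mem_passiveAdversaries hκ0 hκ1 (hA k) (hσ k)
    (le_of_mul_le_mul_left (hlargek.trans hloadk) hC₁) (hx.trans h1)).trans_lt ?_
  rw [lt_div_iff₀ hQk]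
  set x := ((P k).N : ℝ) ^ 2 * Real.exp (-((1 - κ) / 4096) * (P k).L) with hxdef
  have hx0 : 0 ≤ x := by positivity
  -- Squaring removes the square root and leaves `2 * x * Q ^ 2 < 1`, the reason for the polynomial
  -- chosen in `hlim2`.
  refine lt_of_pow_lt_pow_left₀ 2 zero_le_one ?_
  rw [mul_pow, mul_pow, Real.sq_sqrt (by positivity), one_pow]
  refine lt_of_le_of_lt ?_ h2
  have hev : (2 * q' ^ 2 * Q ^ 2).eval (k : ℝ)
      = 2 * (q' ^ 2).eval (k : ℝ) * Q.eval (k : ℝ) ^ 2 := by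
    simp [Polynomial.eval_pow]
  rw [hev]
  calc (1 / 2) ^ 2 * (8 * x) * Q.eval (k : ℝ) ^ 2 = 2 * Q.eval (k : ℝ) ^ 2 * x := by ring
    _ ≤ 2 * Q.eval (k : ℝ) ^ 2
        * ((q' ^ 2).eval (k : ℝ) * Real.exp (-(c * Real.logb 2 k ^ 2))) := by gcongr
    _ = _ := by ring
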